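/- Let $r\ge 3$ be an integer, let $\delta>0$ be a fixed real number, and let $X=X_{n,p}$ be the number of $r$-vertex cliques (copies of $K_r$) in the binomial random graph $G_{n,p}$ on $n$ labelled vertices, in which each of the $\binom n2$ possible edges is present independently with probability $p$. For real $c>0$ and $x\in[0,1]$ define $$\psi_r(\delta,c,x)=\frac{(\delta(1-x))^{2/r}}{2}+\frac{\lfloor x\delta c/r\rfloor+\{x\delta c/r\}^{1/(r-1)}}{c},\qquad \varphi_r(\delta,c)=\min_{x\in[0,1]}\psi_r(\delta,c,x),$$ where $\lfloor a\rfloor$ and $\{a\}=a-\lfloor a\rfloor$ are the integer and fractional parts of $a$. Then, for every $p=p(n)\in[0,1]$ satisfying $$n^{-1}(\log n)^{\frac1{r-2}}\ll p^{\frac{r-1}{2}}\ll 1\qquad(n\to\infty)$$ (where $a_n\ll b_n$ means $a_n=o(b_n)$), we have $$\lim_{n\to\infty}\frac{-\log \Pr\big(X\ge(1+\delta)\mathbb E[X]\big)}{n^2p^{r-1}\log(1/p)}=\begin{cases}\delta^{2/r}/2&\text{if } np^{r-1}\to0,\\ \varphi_r(\delta,c)&\text{if } np^{r-1}\to c\in(0,\infty),\\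 \min\{\delta^{2/r}/2,\ \delta/r\}&\text{if } np^{r-1}\to\infty.\end{cases}$$ Moreover, for every $c>0$ the minimum defining $\varphi_r(\delta,c)$ is attained, and $$\varphi_r(\delta,c)=\min\left\{\frac{\delta^{2/r}}2,\ \frac{\lfloor\delta c/r\rfloor+\{\delta c/r\}^{1/(r-1)}}{c},\ \frac{\lfloor\delta c/r\rfloor}{c}+\frac{\big(r\{\delta c/r\}/c\big)^{2/r}}{2}\right\}.$$ -/

import Mathlib

open Filter Topology Asymptotics MeasureTheory ProbabilityTheory

noncomputable section

/-- The random graph `G_{n,p}` on the vertex set `Fin n`, in which each of the `n.choose 2` possible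
edges is present independently with probability `p`. -/
def Gnp (n : ℕ) (p : unitInterval) : Measure (SimpleGraph (Fin n)) :=
  SimpleGraph.binomialRandom (Fin n) p

/-- The number of `r`-vertex cliques in the graph `G`, i.e. the number of copies of `K_r`. -/
def cliqueCount (r : ℕ) {n : ℕ} (G : SimpleGraph (Fin n)) : ℕ :=
  (G.cliqueSet r).ncard

/-- The expected number of `r`-vertex cliques in `G_{n,p}`. -/
def meanCliques (r n : ℕ) (p : unitInterval) : ℝ :=
  ∫ G, (cliqueCount r G : ℝ) ∂(Gnp n p)

/-- The upper tail probability `P(X ≥ (1 + δ) E[X])`, where `X` is the number of `r`-vertex cliques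
in `G_{n,p}`. -/
def upperTailProb (r n : ℕ) (p : unitInterval) (δ : ℝ) : ℝ :=
  (Gnp n p).real {G | (1 + δ) * meanCliques r n p ≤ (cliqueCount r G : ℝ)}

/-- The normalised cost `ψ_r(δ, c, x)` of a clique of weight `1 - x` combined with a hub of
weight `x`. -/
def psiCost (r : ℕ) (δ c x : ℝ) : ℝ :=
  (δ * (1 - x)) ^ ((2 : ℝ) / r) / 2 +
    ((⌊x * δ * c / r⌋ : ℝ) + Int.fract (x * δ * c / r) ^ ((1 : ℝ) / ((r : ℝ) - 1))) / c

/-- `φ_r(δ, c) = min_{x ∈ [0,1]} ψ_r(δ, c, x)`. -/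
def phiCost (r : ℕ) (δ c : ℝ) : ℝ :=
  sInf (psiCost r δ c '' Set.Icc (0 : ℝ) 1)

/-- The normalised logarithmic upper tail probability
`-log P(X ≥ (1 + δ) E[X]) / (n² p^(r-1) log (1/p))`. -/
def upperTailRate (r : ℕ) (δ : ℝ) (p : ℕ → unitInterval) (n : ℕ) : ℝ :=
  -Real.log (upperTailProb r n (p n) δ) /
    ((n : ℝ) ^ 2 * (p n : ℝ) ^ (r - 1) * Real.log (1 / (p n : ℝ)))

end

/-! Write s = r - 1, L = log(1/p) and Q = n²p^s. There are two cheap ways to create δ·E[X] extra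
cliques: plant a clique on about n p^(s/2) vertices, or plant about n p^s hubs, that is, vertices
joined to a positive fraction of all vertices. Both cost order Q edges at a price of L each. For
hubs, the sum of the s-th powers of the relative degrees is what counts. By convexity the cheapest
choice is as many full hubs as possible and one partial hub, which produces the integer and
fractional parts in ψ.

Lower bound on the tail: plant a clique and hubs that lift the conditional mean slightly above the
threshold (`exists_planted`, `le_factorial_mul_planted_gain`). By `pow_mul_condMean_sub_le` the tail
is then at least the probability of the planted edges, up to a constant number of factors p.

Upper bound: call U a seed if it has O(QL) edges and its conditional mean exceeds (1+δ-ε)E[X]. On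
the event that G contains no seed, the k-th moment of X is at most ((1+δ-ε)E[X])^k for k of order QL
(`integral_moment_le`). Markov's inequality therefore makes that part of the tail negligible, and
what remains is the probability of containing a seed (`upperTail_le_of_seeds`). Expand the excess
mean of a seed over the subgraphs J of K_r. Finner's inequality bounds the copies of each J, and
every J other than a spanning star or K_r loses a factor p (`exists_multigraph`,
`condMean_excess_le`). Stars come from the edges A at high-degree vertices, with cost bounded by
`hubCost_sum_pow_le`. Cliques come from a disjoint edge set B, with cost bounded by
`homCount_complete_le`. Hence |A| + |B| ≥ (φ - o(1))Q (`exists_hub_core_of_seed`).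

A union bound over all pairs (A, B) is affordable. A touches few hubs, and B can be pruned to a core
whose edges each lie in many cliques, so that B spans few vertices. Both choices have entropy o(L)
per edge. For B this is where the lower bound on p enters (`eventually_core_entropy_le`).

The three regimes follow by analysing φ: it is continuous in c, and concavity of ψ between
consecutive hub counts leaves three candidate minima (`phiCost_eq_min`). -/

noncomputable section

/-! ### Edge sets, conditional means and the law of the random graph -/

/-- The set of unordered pairs of distinct elements of `S`. -/
def pairsIn {V : Type*} [DecidableEq V] (S : Finset V) : Finset (Sym2 V) :=
  S.offDiag.image Sym2.mk.uncurry

/-- The set `U` of unordered pairs contains no loop. -/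
def Loopless {V : Type*} (U : Finset (Sym2 V)) : Prop := ∀ e ∈ U, ¬ e.IsDiag

lemma mk_mem_pairsIn {V : Type*} [DecidableEq V] {S : Finset V} {x y : V} :
    s(x, y) ∈ pairsIn S ↔ x ∈ S ∧ y ∈ S ∧ x ≠ y := by
  simp only [pairsIn, Finset.mem_image, Finset.mem_offDiag, Prod.exists, Function.uncurry_apply_pair,
    Sym2.eq_iff]
  grind

lemma loopless_pairsIn {V : Type*} [DecidableEq V] (S : Finset V) : Loopless (pairsIn S) := by
  intro e
  induction e using Sym2.ind with
  | _ x y => intro h; simpa using (mk_mem_pairsIn.1 h).2.2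

lemma Loopless.union {V : Type*} [DecidableEq V] {U W : Finset (Sym2 V)} (hU : Loopless U)
    (hW : Loopless W) : Loopless (U ∪ W) := by
  intro e he
  rcases Finset.mem_union.1 he with h | h
  exacts [hU e h, hW e h]

lemma card_pairsIn {V : Type*} [DecidableEq V] (S : Finset V) :
    (pairsIn S).card = S.card.choose 2 := Sym2.card_image_offDiag S

/-- The conditional expectation of the number of `r`-cliques in `G_{n,p}`, given that all pairs in
`U` are edges. -/
def condMean (r n : ℕ) (p : ℝ) (U : Finset (Sym2 (Fin n))) : ℝ :=
  ∑ S ∈ (Finset.univ : Finset (Fin n)).powersetCard r, p ^ (pairsIn S \ U).card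

open Classical in
/-- The indicator of the event that all pairs in `U` are edges of `G`. -/
def containsInd {V : Type*} (U : Finset (Sym2 V)) (G : SimpleGraph V) : ℝ :=
  if (U : Set (Sym2 V)) ⊆ G.edgeSet then 1 else 0

lemma containsInd_nonneg {V : Type*} (U : Finset (Sym2 V)) (G : SimpleGraph V) :
    0 ≤ containsInd U G := by
  unfold containsInd; split_ifs <;> norm_num

lemma containsInd_le_one {V : Type*} (U : Finset (Sym2 V)) (G : SimpleGraph V) :
    containsInd U G ≤ 1 := by
  unfold containsInd; split_ifs <;> norm_num

lemma containsInd_empty {V : Type*} (G : SimpleGraph V) :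
    containsInd ∅ G = 1 := by
  simp [containsInd]

lemma containsInd_mul {V : Type*} [DecidableEq V] (U W : Finset (Sym2 V)) (G : SimpleGraph V) :
    containsInd U G * containsInd W G = containsInd (U ∪ W) G := by
  unfold containsInd
  have h : ((U ∪ W : Finset (Sym2 V)) : Set (Sym2 V)) ⊆ G.edgeSet ↔
      (U : Set (Sym2 V)) ⊆ G.edgeSet ∧ (W : Set (Sym2 V)) ⊆ G.edgeSet := by
    rw [Finset.coe_union, Set.union_subset_iff]
  split_ifs <;> simp_all

/-- On a finite type, measurable singletons make every event measurable and every function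
integrable. -/
instance measurableSingletonClass_simpleGraph (n : ℕ) :
    MeasurableSingletonClass (SimpleGraph (Fin n)) where
  measurableSet_singleton G := by
    have h : ({G} : Set (SimpleGraph (Fin n))) =
        (fun G' : SimpleGraph (Fin n) => G'.edgeSet) ⁻¹' {G.edgeSet} := by
      ext G'
      simp
    rw [h]
    exact SimpleGraph.measurable_edgeSet (Set.toFinite _).measurableSet

instance isProbabilityMeasure_Gnp (n : ℕ) (p : unitInterval) : IsProbabilityMeasure (Gnp n p) := by
  unfold Gnp; infer_instance

lemma Gnp_real_superset (n : ℕ) (p : unitInterval) (U : Finset (Sym2 (Fin n))) (hU : Loopless U) :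
    (Gnp n p).real {G | (U : Set (Sym2 (Fin n))) ⊆ G.edgeSet} = (p : ℝ) ^ U.card := by
  classical
  have h : {G : SimpleGraph (Fin n) | (U : Set (Sym2 (Fin n))) ⊆ G.edgeSet} =
      (fun G : SimpleGraph (Fin n) => G.edgeSet) ⁻¹' {s | (U : Set _) ⊆ s} := rfl
  rw [measureReal_def, Gnp, SimpleGraph.binomialRandom_eq_map, Measure.map_apply
    SimpleGraph.measurable_fromEdgeSet (Set.toFinite _).measurableSet]
  have h2 : SimpleGraph.fromEdgeSet ⁻¹' {G : SimpleGraph (Fin n) |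
      (U : Set (Sym2 (Fin n))) ⊆ G.edgeSet} = {s | (U : Set _) ⊆ s} := by
    ext s
    simp only [Set.mem_preimage, Set.mem_ofPred_eq, SimpleGraph.edgeSet_fromEdgeSet]
    constructor
    · intro h e he; exact (h he).1
    · intro h e he; exact ⟨h he, by simpa using hU e he⟩
  rw [h2, setBernoulli_apply']
  have h3 : ((fun p : Sym2 (Fin n) → Prop => {i | p i}) ⁻¹' {s | (U : Set _) ⊆ s}) =
      Set.pi (U : Set (Sym2 (Fin n))) (fun _ => ({True} : Set Prop)) := by
    ext f
    simp [Set.pi, Set.subset_def]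
  rw [h3, Measure.infinitePi_pi _ (fun _ _ => MeasurableSet.of_discrete)]
  rw [Finset.prod_congr rfl (g := fun _ => ((unitInterval.toNNReal p : NNReal) : ENNReal))]
  · simp
  · intro e he
    have : e ∈ (Sym2.diagSetᶜ : Set (Sym2 (Fin n))) := by simpa using hU e he
    have hd : ¬ e.IsDiag := hU e he
    simp [hd]
    try rfl

lemma integral_containsInd (n : ℕ) (p : unitInterval) (U : Finset (Sym2 (Fin n)))
    (hU : Loopless U) : ∫ G, containsInd U G ∂(Gnp n p) = (p : ℝ) ^ U.card := by
  classical
  rw [← Gnp_real_superset n p U hU, ← integral_indicator_one (Set.toFinite _).measurableSet]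
  congr 1

lemma integrable_Gnp {n : ℕ} {p : unitInterval} (f : SimpleGraph (Fin n) → ℝ) :
    Integrable f (Gnp n p) := Integrable.of_finite

lemma cliqueCount_eq_sum (r n : ℕ) (G : SimpleGraph (Fin n)) :
    (cliqueCount r G : ℝ) =
      ∑ S ∈ (Finset.univ : Finset (Fin n)).powersetCard r, containsInd (pairsIn S) G := by
  classical
  have : G.cliqueSet r = ((((Finset.univ : Finset (Fin n)).powersetCard r).filter
      (fun S => ((pairsIn S : Finset (Sym2 (Fin n))) : Set (Sym2 (Fin n))) ⊆ G.edgeSet) :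
      Finset (Finset (Fin n))) : Set (Finset (Fin n))) := by
    ext S
    simp only [SimpleGraph.mem_cliqueSet_iff, Finset.coe_filter, Finset.mem_powersetCard_univ,
      Set.mem_ofPred_eq, SimpleGraph.isNClique_iff, SimpleGraph.isClique_iff]
    constructor
    · rintro ⟨h, hc⟩
      refine ⟨hc, fun e => ?_⟩
      induction e using Sym2.ind with
      | _ x y =>
        intro he
        obtain ⟨hx, hy, hxy⟩ := mk_mem_pairsIn.1 (Finset.mem_coe.1 he)
        exact h hx hy hxy
    · rintro ⟨hc, h⟩
      refine ⟨fun x hx y hy hxy => ?_, hc⟩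
      exact h (Finset.mem_coe.2 (mk_mem_pairsIn.2 ⟨hx, hy, hxy⟩))
  rw [cliqueCount, this, Set.ncard_coe_finset]
  simp [containsInd, Finset.sum_boole]

lemma cliqueCount_le_choose (r n : ℕ) (G : SimpleGraph (Fin n)) :
    (cliqueCount r G : ℝ) ≤ n.choose r := by
  rw [cliqueCount_eq_sum]
  refine (Finset.sum_le_sum fun S _ => containsInd_le_one _ G).trans ?_
  simp

/-- This justifies calling the explicit sum `condMean` a conditional expectation: U together with
the pairs in S has |U| + |pairsIn S \ U| elements. -/
lemma integral_containsInd_mul_cliqueCount (r n : ℕ) (p : unitInterval)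
    (U : Finset (Sym2 (Fin n))) (hU : Loopless U) :
    ∫ G, containsInd U G * cliqueCount r G ∂(Gnp n p) = (p : ℝ) ^ U.card * condMean r n p U := by
  simp only [cliqueCount_eq_sum, Finset.mul_sum, containsInd_mul, condMean]
  rw [integral_finsetSum _ (fun _ _ => integrable_Gnp _)]
  refine Finset.sum_congr rfl fun S _ => ?_
  rw [integral_containsInd n p _ (hU.union (loopless_pairsIn S)), ← pow_add,
    Finset.union_comm, ← Finset.card_sdiff_add_card, add_comm]

lemma meanCliques_eq (r n : ℕ) (p : unitInterval) :
    meanCliques r n p = n.choose r * (p : ℝ) ^ (r.choose 2) := by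
  have h := integral_containsInd_mul_cliqueCount r n p ∅ (by simp [Loopless])
  simp only [containsInd_empty, one_mul, Finset.card_empty, pow_zero] at h
  rw [meanCliques, h, condMean, Finset.sum_congr rfl (g := fun _ => (p : ℝ) ^ (r.choose 2))]
  · simp
  · intro S hS
    rw [Finset.sdiff_empty, card_pairsIn, Finset.mem_powersetCard_univ.1 hS]

/-! ### Planting and the high-moment method -/

/-- Planting the edges of `U` gives a lower bound on the upper tail. -/
lemma pow_mul_condMean_sub_le (r n : ℕ) (p : unitInterval) (U : Finset (Sym2 (Fin n)))
    (hU : Loopless U) (t : ℝ) (ht : 0 ≤ t) :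
    (p : ℝ) ^ U.card * (condMean r n p U - t) ≤
      n.choose r * (Gnp n p).real {G | t ≤ (cliqueCount r G : ℝ)} := by
  classical
  -- Pointwise, X on the event U ⊆ G is at most t when X < t, and at most the trivial bound
  -- `n.choose r` otherwise.
  have h1 : ∫ G, containsInd U G * cliqueCount r G ∂(Gnp n p) ≤
      ∫ G, (t * containsInd U G + n.choose r *
        (Set.indicator {G | t ≤ (cliqueCount r G : ℝ)} 1 G)) ∂(Gnp n p) := by
    refine integral_mono (integrable_Gnp _) (integrable_Gnp _) fun G => ?_
    by_cases h : t ≤ (cliqueCount r G : ℝ)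
    · simp only [Set.indicator_apply, Set.mem_ofPred_eq, h, if_true, Pi.one_apply, mul_one]
      have h2 := cliqueCount_le_choose r n G
      have h3 := containsInd_le_one U G
      have h4 := containsInd_nonneg U G
      have h5 : (0 : ℝ) ≤ cliqueCount r G := by positivity
      nlinarith [mul_nonneg ht h4]
    · simp only [Set.indicator_apply, Set.mem_ofPred_eq, h, if_false, mul_zero, add_zero]
      have h4 := containsInd_nonneg U G
      nlinarith
  rw [integral_add (integrable_Gnp _) (integrable_Gnp _), integral_const_mul, integral_const_mul,
    integral_indicator_one (Set.toFinite _).measurableSet, integral_containsInd n p U hU,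
    integral_containsInd_mul_cliqueCount r n p U hU] at h1
  linarith

open Classical in
/-- The indicator of the event that `G` contains no `U` with at most `M` edges conditioned on which
the expected number of cliques exceeds `B`. -/
def noSeedInd (r n : ℕ) (p B : ℝ) (M : ℕ) (G : SimpleGraph (Fin n)) : ℝ :=
  if ∀ U : Finset (Sym2 (Fin n)), Loopless U → U.card ≤ M →
    (U : Set (Sym2 (Fin n))) ⊆ G.edgeSet → condMean r n p U ≤ B then 1 else 0

lemma noSeedInd_nonneg (r n : ℕ) (p B : ℝ) (M : ℕ) (G : SimpleGraph (Fin n)) :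
    0 ≤ noSeedInd r n p B M G := by
  unfold noSeedInd; split_ifs <;> norm_num

/-- Peel off one factor X as a sum over possible cliques S, each enlarging U by at most `r.choose 2`
pairs. If `condMean` of U is at most B, summing the new factors p^|pairsIn S \ U| costs at most B.
Otherwise U itself is forbidden and the integrand vanishes. The budget M ensures that every set met
in the recursion is covered by the no-seed condition. -/
lemma integral_moment_le (r n : ℕ) (p : unitInterval) (B : ℝ) (hB : 0 ≤ B) (M k : ℕ) :
    ∀ U : Finset (Sym2 (Fin n)), Loopless U → U.card + r.choose 2 * k ≤ M →
      ∫ G, containsInd U G * (cliqueCount r G : ℝ) ^ k * noSeedInd r n p B M G ∂(Gnp n p) ≤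
        (p : ℝ) ^ U.card * B ^ k := by
  classical
  induction k with
  | zero =>
    intro U hU _
    rw [← integral_containsInd n p U hU]
    simp only [pow_zero, mul_one]
    refine integral_mono (integrable_Gnp _) (integrable_Gnp _) fun G => ?_
    refine mul_le_of_le_one_right (containsInd_nonneg U G) ?_
    unfold noSeedInd; split_ifs <;> norm_num
  | succ k ih =>
    intro U hU hM
    by_cases hs : condMean r n p U ≤ B
    · have h1 : ∀ G, containsInd U G * (cliqueCount r G : ℝ) ^ (k + 1) * noSeedInd r n p B M G =
          ∑ S ∈ (Finset.univ : Finset (Fin n)).powersetCard r,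
            containsInd (U ∪ pairsIn S) G * (cliqueCount r G : ℝ) ^ k * noSeedInd r n p B M G := by
        intro G
        rw [← Finset.sum_mul, ← Finset.sum_mul, pow_succ]
        simp only [← containsInd_mul]
        rw [← Finset.mul_sum, ← cliqueCount_eq_sum]
        ring
      simp only [h1]
      rw [integral_finsetSum _ (fun _ _ => integrable_Gnp _)]
      have h2 : ∀ S ∈ (Finset.univ : Finset (Fin n)).powersetCard r,
          ∫ G, containsInd (U ∪ pairsIn S) G * (cliqueCount r G : ℝ) ^ k *
            noSeedInd r n p B M G ∂(Gnp n p) ≤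
          (p : ℝ) ^ U.card * B ^ k * (p : ℝ) ^ (pairsIn S \ U).card := by
        intro S hS
        have hc : (U ∪ pairsIn S).card = U.card + (pairsIn S \ U).card := by
          rw [Finset.union_comm, ← Finset.card_sdiff_add_card, add_comm]
        have hle : (pairsIn S \ U).card ≤ r.choose 2 := by
          refine (Finset.card_le_card Finset.sdiff_subset).trans ?_
          rw [card_pairsIn, Finset.mem_powersetCard_univ.1 hS]
        refine (ih _ (hU.union (loopless_pairsIn S)) ?_).trans_eq ?_
        · rw [hc]; rw [mul_add] at hM; omega
        · rw [hc, pow_add]; ring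
      refine (Finset.sum_le_sum h2).trans ?_
      rw [← Finset.mul_sum, pow_succ, ← mul_assoc]
      have hp := p.2.1
      exact mul_le_mul_of_nonneg_left hs (by positivity)
    · have h0 : ∀ G, containsInd U G * (cliqueCount r G : ℝ) ^ (k + 1) *
          noSeedInd r n p B M G = 0 := by
        intro G
        by_cases hG : (U : Set (Sym2 (Fin n))) ⊆ G.edgeSet
        · have : noSeedInd r n p B M G = 0 := by
            unfold noSeedInd
            rw [if_neg]
            intro h
            exact hs (h U hU (by omega) hG)
          rw [this, mul_zero]
        · simp [containsInd, hG]
      simp only [h0, integral_zero]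
      have hp := p.2.1
      positivity

open Classical in
/-- The upper tail is dominated by a high-moment term and by the probability that the random graph
contains a small seed; every seed is assumed to contain a member of the family `W`. -/
lemma upperTail_le_of_seeds (r n : ℕ) (p : unitInterval) (B t : ℝ) (hB : 0 ≤ B) (ht : 0 < t)
    (M k : ℕ) (hk : r.choose 2 * k ≤ M) (W : Finset (Finset (Sym2 (Fin n))))
    (hW : ∀ w ∈ W, Loopless w)
    (h : ∀ U : Finset (Sym2 (Fin n)), Loopless U → U.card ≤ M → B < condMean r n p U →
      ∃ w ∈ W, w ⊆ U) :
    (Gnp n p).real {G | t ≤ (cliqueCount r G : ℝ)} ≤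
      (B / t) ^ k + ∑ w ∈ W, (p : ℝ) ^ w.card := by
  have h1 : (Gnp n p).real {G | t ≤ (cliqueCount r G : ℝ)} ≤
      ∫ G, ((1 / t ^ k) * (containsInd ∅ G * (cliqueCount r G : ℝ) ^ k * noSeedInd r n p B M G) +
        ∑ w ∈ W, containsInd w G) ∂(Gnp n p) := by
    rw [← integral_indicator_one (Set.toFinite _).measurableSet]
    refine integral_mono (integrable_Gnp _) (integrable_Gnp _) fun G => ?_
    have hnn : 0 ≤ ∑ w ∈ W, containsInd w G :=
      Finset.sum_nonneg fun w _ => containsInd_nonneg w G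
    have hn2 := noSeedInd_nonneg r n p B M G
    simp only [containsInd_empty, one_mul, Set.indicator_apply, Set.mem_ofPred_eq, Pi.one_apply]
    split_ifs with hG
    -- Without a seed, the k-th power of X/t is at least 1 (Markov). With a seed, some member of W
    -- lies in G.
    · by_cases hs : ∀ U : Finset (Sym2 (Fin n)), Loopless U → U.card ≤ M →
          (U : Set (Sym2 (Fin n))) ⊆ G.edgeSet → condMean r n p U ≤ B
      · have : noSeedInd r n p B M G = 1 := by unfold noSeedInd; rw [if_pos hs]
        rw [this, mul_one]
        have h3 : 1 ≤ 1 / t ^ k * (cliqueCount r G : ℝ) ^ k := by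
          rw [one_div_mul_eq_div, one_le_div (by positivity)]
          exact pow_le_pow_left₀ ht.le hG k
        linarith
      · push Not at hs
        obtain ⟨U, hU, hUM, hUG, hUB⟩ := hs
        obtain ⟨w, hw, hwU⟩ := h U hU hUM hUB
        have h3 : containsInd w G ≤ ∑ w ∈ W, containsInd w G :=
          Finset.single_le_sum (fun w _ => containsInd_nonneg w G) hw
        have h4 : containsInd w G = 1 := by
          unfold containsInd
          rw [if_pos]
          exact fun e he => hUG (hwU he)
        have : 0 ≤ 1 / t ^ k * ((cliqueCount r G : ℝ) ^ k * noSeedInd r n p B M G) := by positivity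
        linarith
    · positivity
  refine h1.trans ?_
  rw [integral_add (integrable_Gnp _) (integrable_Gnp _), integral_const_mul,
    integral_finsetSum _ (fun _ _ => integrable_Gnp _)]
  have h2 := integral_moment_le r n p B hB M k ∅ (by simp [Loopless]) (by simpa using hk)
  refine add_le_add ?_ (Finset.sum_le_sum fun w hw => (integral_containsInd n p w (hW w hw)).le)
  rw [Finset.card_empty, pow_zero, one_mul] at h2
  rw [div_pow, div_eq_mul_inv (B ^ k), mul_comm, one_div]
  exact mul_le_mul_of_nonneg_right h2 (by positivity)

/-! ### Hölder's and Finner's inequalities -/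

/-- Hölder's inequality for averages over a finite set, with total weight at most one. -/
lemma avg_prod_rpow_le {V ι : Type*} [Fintype V] [Nonempty V] (s : Finset ι) (f : ι → V → ℝ)
    (hf : ∀ e v, 0 ≤ f e v) (w : ι → ℝ) (hw : ∀ e, 0 ≤ w e) (hs : ∑ e ∈ s, w e ≤ 1) :
    (Fintype.card V : ℝ)⁻¹ * ∑ v, ∏ e ∈ s, f e v ^ w e ≤
      ∏ e ∈ s, ((Fintype.card V : ℝ)⁻¹ * ∑ v, f e v) ^ w e := by
  classical
  have hN : (0 : ℝ) < Fintype.card V := by exact_mod_cast Fintype.card_pos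
  by_cases hz : ∃ e ∈ s, w e ≠ 0 ∧ ∑ v, f e v = 0
  · obtain ⟨e, he, hwe, hfe⟩ := hz
    have h0 : ∀ v, f e v = 0 := fun v =>
      (Finset.sum_eq_zero_iff_of_nonneg (fun v _ => hf e v)).1 hfe v (Finset.mem_univ v)
    have h1 : ∀ v, ∏ e ∈ s, f e v ^ w e = 0 := fun v =>
      Finset.prod_eq_zero he (by rw [h0 v, Real.zero_rpow hwe])
    simp only [h1, Finset.sum_const_zero, mul_zero]
    exact Finset.prod_nonneg fun e _ => Real.rpow_nonneg
      (mul_nonneg (by positivity) (Finset.sum_nonneg fun v _ => hf e v)) _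
  · push Not at hz
    set a : ι → ℝ := fun e => (Fintype.card V : ℝ)⁻¹ * ∑ v, f e v with ha
    have hann : ∀ e, 0 ≤ a e := fun e =>
      mul_nonneg (by positivity) (Finset.sum_nonneg fun v _ => hf e v)
    have hapos : ∀ e ∈ s, w e ≠ 0 → 0 < a e := fun e he hwe =>
      lt_of_le_of_ne (hann e) (fun h => by
        have := hz e he hwe
        simp only [ha] at h
        rcases mul_eq_zero.1 h.symm with h | h
        · exact (inv_ne_zero hN.ne') h
        · exact this h)
    set P : ℝ := ∏ e ∈ s, a e ^ w e with hP
    have hPnn : 0 ≤ P := Finset.prod_nonneg fun e _ => Real.rpow_nonneg (hann e) _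
    have key : ∀ v, ∏ e ∈ s, f e v ^ w e ≤
        P * ((1 - ∑ e ∈ s, w e) + ∑ e ∈ s, w e * (f e v / a e)) := by
      intro v
      have h1 : ∏ e ∈ s, f e v ^ w e = P * ∏ e ∈ s, (f e v / a e) ^ w e := by
        rw [hP, ← Finset.prod_mul_distrib]
        refine Finset.prod_congr rfl fun e he => ?_
        by_cases hwe : w e = 0
        · simp [hwe]
        · rw [← Real.mul_rpow (hann e) (div_nonneg (hf e v) (hann e)),
            mul_div_cancel₀ _ (hapos e he hwe).ne']
      rw [h1]
      refine mul_le_mul_of_nonneg_left ?_ hPnn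
      -- After normalisation by the means this is weighted AM-GM. The slot `none`, with value 1 and
      -- weight 1 - ∑ w, brings the total weight to exactly one.
      have h2 := Real.geom_mean_le_arith_mean_weighted (Finset.insertNone s)
        (fun o => o.elim (1 - ∑ e ∈ s, w e) w) (fun o => o.elim 1 (fun e => f e v / a e))
        (by rintro (_ | e) _
            · simpa using hs
            · exact hw e)
        (by simp)
        (by rintro (_ | e) _
            · simp
            · exact div_nonneg (hf e v) (hann e))
      simpa using h2
    calc (Fintype.card V : ℝ)⁻¹ * ∑ v, ∏ e ∈ s, f e v ^ w e
        ≤ (Fintype.card V : ℝ)⁻¹ *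
          ∑ v, P * ((1 - ∑ e ∈ s, w e) + ∑ e ∈ s, w e * (f e v / a e)) := by
          gcongr with v _; exact key v
      _ = P * ((1 - ∑ e ∈ s, w e) + ∑ e ∈ s, w e * (a e / a e)) := by
          rw [← Finset.mul_sum, Finset.sum_add_distrib, Finset.sum_comm]
          simp only [← Finset.mul_sum, ← Finset.sum_div]
          rw [Finset.sum_const, Finset.card_univ, nsmul_eq_mul]
          have : ∀ e, (Fintype.card V : ℝ)⁻¹ * (w e * ((∑ v, f e v) / a e)) =
              w e * (a e / a e) := by
            intro e; rw [ha]; ring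
          rw [mul_left_comm, mul_add, Finset.mul_sum]
          simp only [this]
          rw [← mul_assoc, inv_mul_cancel₀ hN.ne', one_mul]
      _ ≤ P * ((1 - ∑ e ∈ s, w e) + ∑ e ∈ s, w e * 1) := by
          gcongr with e _
          · exact hw e
          · exact div_self_le_one _
      _ = P := by simp

/-- Finner's inequality for averages: if `F e` depends only on the coordinates in `A e`, and
each coordinate carries total weight at most one, then the average of the product of the powers
`F e ^ w e` is at most the product of the powers of the averages. -/
lemma finner {V ι : Type*} [Fintype V] [Nonempty V] (s : Finset ι) (w : ι → ℝ)
    (hw : ∀ e, 0 ≤ w e) (k : ℕ) :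
    ∀ (A : ι → Finset (Fin k)) (F : ι → (Fin k → V) → ℝ), (∀ e x, 0 ≤ F e x) →
      (∀ e x y, (∀ i ∈ A e, x i = y i) → F e x = F e y) →
      (∀ i, ∑ e ∈ s with i ∈ A e, w e ≤ 1) →
      ((Fintype.card V : ℝ) ^ k)⁻¹ * ∑ x, ∏ e ∈ s, F e x ^ w e ≤
        ∏ e ∈ s, (((Fintype.card V : ℝ) ^ k)⁻¹ * ∑ x, F e x) ^ w e := by
  classical
  have hN : (0 : ℝ) < Fintype.card V := by exact_mod_cast Fintype.card_pos
  induction k with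
  | zero =>
    intro A F hF _ _
    simp
  | succ k ih =>
    intro A F hF hdep hA
    set N : ℝ := (Fintype.card V : ℝ) with hNdef
    have hsplit : ∀ g : (Fin (k + 1) → V) → ℝ,
        ∑ x, g x = ∑ y : Fin k → V, ∑ v : V, g (Fin.cons v y) := by
      intro g
      rw [← (Fin.consEquiv (fun _ : Fin (k + 1) => V)).sum_comp, Fintype.sum_prod_type_right]
      rfl
    -- Average out coordinate 0. The functions independent of it factor out, and those depending on
    -- it have total weight at most one, so Hölder applies.
    set F' : ι → (Fin k → V) → ℝ := fun e y => N⁻¹ * ∑ v, F e (Fin.cons v y) with hF'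
    have hF'nn : ∀ e y, 0 ≤ F' e y := fun e y =>
      mul_nonneg (by positivity) (Finset.sum_nonneg fun v _ => hF e _)
    have h1 : ∀ y : Fin k → V, N⁻¹ * ∑ v, ∏ e ∈ s, F e (Fin.cons v y) ^ w e ≤
        ∏ e ∈ s, F' e y ^ w e := by
      intro y
      obtain ⟨v₀⟩ := ‹Nonempty V›
      have hconst : ∀ e, (0 : Fin (k + 1)) ∉ A e → ∀ v,
          F e (Fin.cons v y) = F' e y := by
        intro e he v
        have : ∀ v', F e (Fin.cons v' y) = F e (Fin.cons v y) := by
          intro v'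
          refine hdep e _ _ fun i hi => ?_
          rcases Fin.eq_zero_or_eq_succ i with rfl | ⟨j, rfl⟩
          · exact absurd hi he
          · simp
        simp only [hF', this]
        rw [Finset.sum_const, Finset.card_univ, nsmul_eq_mul, ← hNdef,
          inv_mul_cancel_left₀ hN.ne']
      have h2 : ∀ v, ∏ e ∈ s, F e (Fin.cons v y) ^ w e =
          (∏ e ∈ s with (0 : Fin (k + 1)) ∈ A e, F e (Fin.cons v y) ^ w e) *
            ∏ e ∈ s with ¬ (0 : Fin (k + 1)) ∈ A e, F' e y ^ w e := by
        intro v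
        rw [← Finset.prod_filter_mul_prod_filter_not s (fun e => (0 : Fin (k + 1)) ∈ A e)]
        congr 1
        refine Finset.prod_congr rfl fun e he => ?_
        rw [hconst e (Finset.mem_filter.1 he).2]
      simp only [h2]
      rw [← Finset.sum_mul, ← mul_assoc,
        ← Finset.prod_filter_mul_prod_filter_not s (fun e => (0 : Fin (k + 1)) ∈ A e)]
      refine mul_le_mul_of_nonneg_right ?_
        (Finset.prod_nonneg fun e _ => Real.rpow_nonneg (hF'nn e y) _)
      exact avg_prod_rpow_le _ (fun e v => F e (Fin.cons v y)) (fun e v => hF e _) w hw (hA 0)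
    have h3 := ih (fun e => Finset.univ.filter fun i => i.succ ∈ A e) F' hF'nn
      (by
        intro e x y hxy
        simp only [hF']
        congr 1
        refine Finset.sum_congr rfl fun v _ => hdep e _ _ fun i hi => ?_
        rcases Fin.eq_zero_or_eq_succ i with rfl | ⟨j, rfl⟩
        · simp
        · simpa using hxy j (by simpa using hi))
      (by
        intro i
        simpa using hA i.succ)
    have h4 : ∀ g : (Fin (k + 1) → V) → ℝ, (N ^ (k + 1))⁻¹ * ∑ x, g x =
        (N ^ k)⁻¹ * ∑ y : Fin k → V, N⁻¹ * ∑ v : V, g (Fin.cons v y) := by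
      intro g
      rw [hsplit, ← Finset.mul_sum, ← mul_assoc, pow_succ, mul_inv]
    simp only [h4]
    refine le_trans ?_ h3
    gcongr with y _
    exact h1 y

/-! ### Counting homomorphisms into sparse graphs -/

open Classical in
/-- The maps from `Fin k` to `V` sending all pairs of `J` to pairs of `U`. -/
def homSet {V : Type*} [Fintype V] {k : ℕ} (J : Finset (Sym2 (Fin k))) (U : Finset (Sym2 V)) :
    Finset (Fin k → V) :=
  Finset.univ.filter fun x : Fin k → V => ∀ e ∈ J, Sym2.map x e ∈ U

lemma mem_homSet {V : Type*} [Fintype V] {k : ℕ} {J : Finset (Sym2 (Fin k))}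
    {U : Finset (Sym2 V)} {x : Fin k → V} : x ∈ homSet J U ↔ ∀ e ∈ J, Sym2.map x e ∈ U := by
  simp [homSet]

/-- The number of maps from `Fin k` to `V` sending all pairs of `J` to pairs of `U`. -/
def homCount {V : Type*} [Fintype V] {k : ℕ} (J : Finset (Sym2 (Fin k))) (U : Finset (Sym2 V)) :
    ℕ :=
  (homSet J U).card

open Classical in
/-- The neighbours of `v` in the graph with edge set `U`. -/
def nbrs {V : Type*} [Fintype V] (U : Finset (Sym2 V)) (v : V) : Finset V :=
  Finset.univ.filter fun w => s(v, w) ∈ U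

lemma mem_nbrs {V : Type*} [Fintype V] {U : Finset (Sym2 V)} {v w : V} :
    w ∈ nbrs U v ↔ s(v, w) ∈ U := by simp [nbrs]

open Classical in
lemma card_adj_pairs_le {V : Type*} [Fintype V] (U : Finset (Sym2 V)) :
    (Finset.univ.filter fun q : V × V => s(q.1, q.2) ∈ U).card ≤ 2 * U.card := by
  refine Finset.card_le_mul_card_image_of_maps_to (f := fun q : V × V => s(q.1, q.2))
    (fun q hq => (Finset.mem_filter.1 hq).2) 2 fun e he => ?_
  induction e using Sym2.ind with
  | _ a b =>
    refine (Finset.card_le_card (t := {(a, b), (b, a)}) ?_).trans Finset.card_le_two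
    rintro ⟨x, y⟩ hq
    simp only [Finset.mem_filter, Sym2.eq_iff] at hq
    simp only [Finset.mem_insert, Finset.mem_singleton, Prod.mk.injEq]
    exact hq.2

lemma sum_card_nbrs_le {V : Type*} [Fintype V] (U : Finset (Sym2 V)) (H : Finset V) :
    ∑ v ∈ H, (nbrs U v).card ≤ 2 * U.card := by
  classical
  refine le_trans ?_ (card_adj_pairs_le U)
  rw [← Finset.card_sigma]
  refine Finset.card_le_card_of_injOn (fun q => (q.1, q.2)) ?_ ?_
  · rintro ⟨v, w⟩ h
    simp only [Finset.coe_sigma, Set.mem_sigma_iff, Finset.mem_coe, mem_nbrs] at h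
    simpa using h.2
  · rintro ⟨v, w⟩ _ ⟨v', w'⟩ _ h
    simp only [Prod.mk.injEq] at h
    obtain ⟨rfl, rfl⟩ := h
    rfl

open Classical in
-- The factor |V|² on the left avoids the truncated exponent k - 2.
lemma card_fiber_two {V : Type*} [Fintype V] {k : ℕ} {i j : Fin k} (hij : i ≠ j) (a b : V) :
    (Finset.univ.filter fun x : Fin k → V => x i = a ∧ x j = b).card * Fintype.card V ^ 2 =
      Fintype.card V ^ k := by
  have h : (Finset.univ.filter fun x : Fin k → V => x i = a ∧ x j = b) =
      Fintype.piFinset fun m => if m = i then {a} else if m = j then {b} else Finset.univ := by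
    ext x
    simp only [Finset.mem_filter, Finset.mem_univ, true_and, Fintype.mem_piFinset]
    constructor
    · rintro ⟨h1, h2⟩ m
      split_ifs with h3 h4
      · simp [h3, h1]
      · simp [h4, h2]
      · simp
    · intro h
      refine ⟨by simpa using h i, ?_⟩
      have := h j
      simpa [hij.symm] using this
  rw [h, Fintype.card_piFinset]
  have h2 : ∀ m : Fin k, (if m = i then ({a} : Finset V) else if m = j then {b} else
      Finset.univ).card = if m ∈ ({i, j} : Finset (Fin k)) then 1 else Fintype.card V := by
    intro m
    by_cases h3 : m = i
    · simp [h3]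
    · by_cases h4 : m = j
      · simp [h4, hij.symm]
      · simp [h3, h4]
  simp only [h2]
  rw [Finset.prod_ite]
  simp only [Finset.prod_const_one, one_mul, Finset.prod_const]
  have h5 : (Finset.univ.filter fun m : Fin k => m ∉ ({i, j} : Finset (Fin k))).card + 2 = k := by
    have := Finset.card_compl ({i, j} : Finset (Fin k))
    rw [Finset.card_pair hij, Fintype.card_fin] at this
    have h6 : ({i, j} : Finset (Fin k)).card ≤ k := by
      simpa using Finset.card_le_univ ({i, j} : Finset (Fin k))
    rw [Finset.card_pair hij] at h6
    have h7 : (Finset.univ.filter fun m : Fin k => m ∉ ({i, j} : Finset (Fin k))) =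
        ({i, j} : Finset (Fin k))ᶜ := by ext; simp
    rw [h7, this]
    omega
  rw [← pow_add, h5]

open Classical in
lemma card_map_mem_le {V : Type*} [Fintype V] {k : ℕ} (U : Finset (Sym2 V)) (e : Sym2 (Fin k))
    (he : ¬ e.IsDiag) :
    (Finset.univ.filter fun x : Fin k → V => Sym2.map x e ∈ U).card * Fintype.card V ^ 2 ≤
      2 * U.card * Fintype.card V ^ k := by
  induction e using Sym2.ind with
  | _ i j =>
    have hij : i ≠ j := by simpa using he
    have h : (Finset.univ.filter fun x : Fin k → V => Sym2.map x s(i, j) ∈ U).card =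
        ∑ q ∈ Finset.univ.filter fun q : V × V => s(q.1, q.2) ∈ U,
          (Finset.univ.filter fun x : Fin k → V => x i = q.1 ∧ x j = q.2).card := by
      rw [Finset.card_eq_sum_card_fiberwise (f := fun x => (x i, x j))
        (t := Finset.univ.filter fun q : V × V => s(q.1, q.2) ∈ U)]
      · refine Finset.sum_congr rfl fun q hq => ?_
        congr 1
        ext x
        rw [Finset.mem_filter, Finset.mem_filter, Finset.mem_filter]
        simp only [Finset.mem_univ, true_and, Prod.ext_iff]
        constructor
        · rintro ⟨_, h⟩; exact h
        · rintro ⟨h1, h2⟩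
          refine ⟨?_, h1, h2⟩
          change s(x i, x j) ∈ U
          rw [h1, h2]; exact (Finset.mem_filter.1 hq).2
      · intro x hx
        exact Finset.mem_coe.2 (Finset.mem_filter.2
          ⟨Finset.mem_univ _, (Finset.mem_filter.1 (Finset.mem_coe.1 hx)).2⟩)
    rw [h, Finset.sum_mul]
    simp only [card_fiber_two hij]
    rw [Finset.sum_const, smul_eq_mul]
    exact Nat.mul_le_mul_right _ (card_adj_pairs_le U)

/-- Counting homomorphisms by fractional matchings. -/
lemma homCount_le_of_weight {V : Type*} [Fintype V] [Nonempty V] {k : ℕ}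
    (J : Finset (Sym2 (Fin k))) (hJ : Loopless J) (U : Finset (Sym2 V)) (w : Sym2 (Fin k) → ℝ)
    (hw : ∀ e, 0 ≤ w e) (hi : ∀ i, ∑ e ∈ J with i ∈ e, w e ≤ 1) (β : ℝ)
    (hβ : 2 * (U.card : ℝ) ≤ β * (Fintype.card V : ℝ) ^ 2) :
    (homCount J U : ℝ) ≤ (Fintype.card V : ℝ) ^ k * β ^ (∑ e ∈ J, w e) := by
  classical
  have hN : (0 : ℝ) < Fintype.card V := by exact_mod_cast Fintype.card_pos
  have hβ0 : 0 ≤ β := by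
    by_contra h
    push Not at h
    have : β * (Fintype.card V : ℝ) ^ 2 < 0 := mul_neg_of_neg_of_pos h (by positivity)
    have h2 : (0 : ℝ) ≤ 2 * (U.card : ℝ) := by positivity
    linarith
  have h := finner (V := V) J w hw k (fun e => Finset.univ.filter fun i => i ∈ e)
    (fun e x => if Sym2.map x e ∈ U then 1 else 0)
    (fun e x => by split_ifs <;> norm_num)
    (fun e x y hxy => by
      have : Sym2.map x e = Sym2.map y e := Sym2.map_congr fun i hi => hxy i (by simpa using hi)
      simp only [this])
    (fun i => by simpa using hi i)
  -- Only an inequality, since an indicator raised to weight 0 equals 1 even where it vanishes.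
  have hcount : (homCount J U : ℝ) ≤
      ∑ x : Fin k → V, ∏ e ∈ J, (if Sym2.map x e ∈ U then (1 : ℝ) else 0) ^ w e := by
    rw [homCount, homSet, Finset.card_filter, Nat.cast_sum]
    refine Finset.sum_le_sum fun x _ => ?_
    split_ifs with hx
    · rw [Finset.prod_congr rfl (g := fun _ => (1 : ℝ))]
      · simp
      · intro e he
        rw [if_pos (hx e he), Real.one_rpow]
    · rw [Nat.cast_zero]
      refine Finset.prod_nonneg fun e _ => Real.rpow_nonneg ?_ _
      split_ifs <;> norm_num
  have hstep : ∏ e ∈ J, (((Fintype.card V : ℝ) ^ k)⁻¹ *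
      ∑ x : Fin k → V, (if Sym2.map x e ∈ U then (1 : ℝ) else 0)) ^ w e ≤
      ∏ e ∈ J, β ^ w e := by
    refine Finset.prod_le_prod (fun e _ => Real.rpow_nonneg (mul_nonneg (by positivity)
      (Finset.sum_nonneg fun x _ => by split_ifs <;> norm_num)) _) fun e he => ?_
    refine Real.rpow_le_rpow (mul_nonneg (by positivity)
      (Finset.sum_nonneg fun x _ => by split_ifs <;> norm_num)) ?_ (hw e)
    rw [Finset.sum_boole, inv_mul_le_iff₀ (by positivity)]
    have h2 := card_map_mem_le (V := V) U e (hJ e he)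
    have h3 : ((Finset.univ.filter fun x : Fin k → V => Sym2.map x e ∈ U).card : ℝ) *
        (Fintype.card V : ℝ) ^ 2 ≤ 2 * (U.card : ℝ) * (Fintype.card V : ℝ) ^ k := by
      exact_mod_cast h2
    have hN2 : (0 : ℝ) < (Fintype.card V : ℝ) ^ 2 := by positivity
    refine le_of_mul_le_mul_right ?_ hN2
    refine h3.trans ?_
    calc 2 * (U.card : ℝ) * (Fintype.card V : ℝ) ^ k ≤
        (β * (Fintype.card V : ℝ) ^ 2) * (Fintype.card V : ℝ) ^ k := by gcongr
      _ = _ := by ring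
  rw [← Real.rpow_sum_of_nonneg hβ0 (fun e _ => hw e)] at hstep
  have h4 := h.trans hstep
  rw [inv_mul_le_iff₀ (by positivity)] at h4
  exact hcount.trans h4

/-- Every nonempty graph on `s + 1` vertices other than a spanning star or the complete graph
supports a multigraph of maximum degree at most `s` having more edges. -/
lemma exists_multigraph {s : ℕ} (J : Finset (Sym2 (Fin (s + 1)))) (hJ : Loopless J)
    (hne : J.Nonempty) (hK : J ≠ pairsIn Finset.univ)
    (hstar : ∀ i, J ≠ (pairsIn Finset.univ).filter (i ∈ ·)) :
    ∃ M : Sym2 (Fin (s + 1)) → ℤ, (∀ e, 0 ≤ M e) ∧ (∀ i, ∑ e ∈ J with i ∈ e, M e ≤ s) ∧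
      (J.card : ℤ) + 1 ≤ ∑ e ∈ J, M e := by
  classical
  set deg : Fin (s + 1) → ℕ := fun i => (J.filter (i ∈ ·)).card with hdeg
  have hdeg_eq : ∀ i, deg i = (Finset.univ.filter fun j => s(i, j) ∈ J).card := by
    intro i
    refine (Finset.card_nbij (fun j => s(i, j)) ?_ ?_ ?_).symm
    · intro j hj
      simpa using hj
    · intro j _ j' _ h
      simpa using Sym2.congr_right.1 h
    · intro e he
      simp only [Finset.coe_filter, Set.mem_ofPred_eq] at he
      obtain ⟨j, rfl⟩ := he.2
      exact ⟨j, by simpa using he.1, rfl⟩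
  have hlt : ∀ i, (∃ j, j ≠ i ∧ s(i, j) ∉ J) → deg i < s := by
    rintro i ⟨j, hji, hj⟩
    rw [hdeg_eq]
    have : (Finset.univ.filter fun j => s(i, j) ∈ J) ⊆ (Finset.univ.erase i).erase j := by
      intro m hm
      simp only [Finset.mem_filter, Finset.mem_univ, true_and] at hm
      simp only [Finset.mem_erase, Finset.mem_univ, and_true]
      refine ⟨fun h => hj (h ▸ hm), fun h => ?_⟩
      subst h
      exact hJ _ hm (by simp)
    refine (Finset.card_le_card this).trans_lt ?_
    have h1 : j ∈ Finset.univ.erase i := by simp [hji]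
    have h2 := Finset.card_erase_lt_of_mem h1
    simpa using h2
  have hle : ∀ i, deg i ≤ s := by
    intro i
    rw [hdeg_eq]
    have : (Finset.univ.filter fun j => s(i, j) ∈ J) ⊆ Finset.univ.erase i := by
      intro m hm
      simp only [Finset.mem_filter, Finset.mem_univ, true_and] at hm
      simp only [Finset.mem_erase, Finset.mem_univ, and_true]
      rintro rfl
      exact hJ _ hm (by simp)
    simpa using Finset.card_le_card this
  have hsum : ∀ (T : Finset (Sym2 (Fin (s + 1)))) (f : Sym2 (Fin (s + 1))),
      ∑ e ∈ T, (if e = f then (1 : ℤ) else 0) = if f ∈ T then 1 else 0 := by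
    intro T f
    rw [Finset.sum_ite_eq']
  by_cases hcase : ∃ u v, s(u, v) ∈ J ∧ deg u < s ∧ deg v < s
  -- An edge with room at both ends can simply be doubled.
  · obtain ⟨u, v, huv, hu, hv⟩ := hcase
    refine ⟨fun e => 1 + if e = s(u, v) then 1 else 0, fun e => by dsimp only; split_ifs <;> norm_num,
      fun i => ?_, ?_⟩
    · rw [Finset.sum_add_distrib, hsum, Finset.sum_const, nsmul_eq_mul, mul_one]
      have h1 := hle i
      change (deg i : ℤ) + _ ≤ _
      split_ifs with h
      · simp only [Finset.mem_filter, Sym2.mem_iff] at h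
        rcases h.2 with rfl | rfl <;> omega
      · omega
    · rw [Finset.sum_add_distrib, hsum, if_pos huv, Finset.sum_const, nsmul_eq_mul, mul_one]
  -- Now every edge has an end of full degree s. Not being a star or complete yields two full
  -- vertices u, v and two non-adjacent vertices w, w' that are not full. Trade one copy of uv for
  -- second copies of uw and vw': u and v keep degree s, w and w' gain one, and the total grows by
  -- one.
  · push Not at hcase
    have hfull : ∀ i, s ≤ deg i → ∀ j, j ≠ i → s(i, j) ∈ J := by
      intro i hi j hj
      by_contra h
      exact absurd (hlt i ⟨j, hj, h⟩) (not_lt.2 hi)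
    obtain ⟨u, hu⟩ : ∃ u, s ≤ deg u := by
      obtain ⟨e, he⟩ := hne
      induction e using Sym2.ind with
      | _ a b =>
        by_cases ha : deg a < s
        · exact ⟨b, hcase a b he ha⟩
        · exact ⟨a, not_lt.1 ha⟩
    obtain ⟨w, hw⟩ : ∃ w, deg w < s := by
      by_contra h
      push Not at h
      refine hK (Finset.Subset.antisymm ?_ ?_)
      · intro e
        induction e using Sym2.ind with
        | _ a b =>
          intro he
          exact mk_mem_pairsIn.2 ⟨Finset.mem_univ _, Finset.mem_univ _, by simpa using hJ _ he⟩
      · intro e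
        induction e using Sym2.ind with
        | _ a b =>
          intro he
          exact hfull a (h a) b (mk_mem_pairsIn.1 he).2.2.symm
    obtain ⟨v, hvu, hv⟩ : ∃ v, v ≠ u ∧ s ≤ deg v := by
      by_contra h
      push Not at h
      refine hstar u (Finset.Subset.antisymm ?_ ?_)
      · intro e
        induction e using Sym2.ind with
        | _ a b =>
          intro he
          refine Finset.mem_filter.2 ⟨mk_mem_pairsIn.2
            ⟨Finset.mem_univ _, Finset.mem_univ _, by simpa using hJ _ he⟩, ?_⟩
          by_contra hn
          simp only [Sym2.mem_iff, not_or] at hn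
          exact absurd (hcase a b he (h a (Ne.symm hn.1))) (not_le.2 (h b (Ne.symm hn.2)))
      · intro e he
        obtain ⟨he1, he2⟩ := Finset.mem_filter.1 he
        obtain ⟨b, rfl⟩ := he2
        exact hfull u hu b (mk_mem_pairsIn.1 he1).2.2.symm
    obtain ⟨w', hw'w, hw'J⟩ : ∃ w', w' ≠ w ∧ s(w, w') ∉ J := by
      by_contra h
      push Not at h
      have : Finset.univ.erase w ⊆ Finset.univ.filter fun j => s(w, j) ∈ J := by
        intro j hj
        simpa using h j (by simpa using hj)
      have h2 := Finset.card_le_card this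
      rw [← hdeg_eq] at h2
      simp at h2
      omega
    have hw' : deg w' < s := hlt w' ⟨w, hw'w.symm, by rwa [Sym2.eq_swap]⟩
    have huw : u ≠ w := by rintro rfl; omega
    have hvw : v ≠ w := by rintro rfl; omega
    have huw' : u ≠ w' := by rintro rfl; omega
    have hvw' : v ≠ w' := by rintro rfl; omega
    have m1 : s(u, v) ∈ J := hfull u hu v hvu
    have m2 : s(u, w) ∈ J := hfull u hu w huw.symm
    have m3 : s(v, w') ∈ J := hfull v hv w' hvw'.symm
    refine ⟨fun e => 1 - (if e = s(u, v) then 1 else 0) + (if e = s(u, w) then 1 else 0) +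
      (if e = s(v, w') then 1 else 0), fun e => by dsimp only; split_ifs <;> norm_num, fun i => ?_, ?_⟩
    · rw [Finset.sum_add_distrib, Finset.sum_add_distrib, Finset.sum_sub_distrib, hsum, hsum, hsum,
        Finset.sum_const, nsmul_eq_mul, mul_one]
      change (deg i : ℤ) - _ + _ + _ ≤ _
      have h1 := hle i
      simp only [Finset.mem_filter, m1, m2, m3, true_and, Sym2.mem_iff]
      by_cases e1 : i = u
      · subst e1; simp [huw, hvu.symm, huw']; omega
      by_cases e2 : i = v
      · subst e2; simp [hvw, hvu]; omega
      by_cases e3 : i = w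
      · subst e3; simp [huw.symm, hvw.symm, hw'w.symm]; omega
      by_cases e4 : i = w'
      · subst e4; simp [huw'.symm, hvw'.symm, hw'w]; omega
      simp [e1, e2, e3, e4]; omega
    · rw [Finset.sum_add_distrib, Finset.sum_add_distrib, Finset.sum_sub_distrib, hsum, hsum, hsum,
        Finset.sum_const, nsmul_eq_mul, mul_one]
      simp only [m1, m2, m3, if_true]
      omega

/-- Sparse graphs contain few copies of any graph on `s + 1` vertices that is neither a spanning
star nor complete. -/
lemma homCount_le_of_ne {V : Type*} [Fintype V] [Nonempty V] {s : ℕ} (hs : 0 < s)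
    (J : Finset (Sym2 (Fin (s + 1)))) (hJ : Loopless J)
    (hne : J.Nonempty) (hK : J ≠ pairsIn Finset.univ)
    (hstar : ∀ i, J ≠ (pairsIn Finset.univ).filter (i ∈ ·)) (U : Finset (Sym2 V)) (p Λ : ℝ)
    (hp : 0 < p) (hp1 : p ≤ 1) (hΛ : 1 ≤ Λ)
    (hU : 2 * (U.card : ℝ) ≤ Λ * p ^ s * (Fintype.card V : ℝ) ^ 2) :
    (homCount J U : ℝ) ≤ (Fintype.card V : ℝ) ^ (s + 1) * Λ ^ (s + 1) * p ^ (J.card + 1) := by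
  classical
  obtain ⟨M, hM0, hMi, hM⟩ := exists_multigraph J hJ hne hK hstar
  have hs' : (0 : ℝ) < s := by exact_mod_cast hs
  -- The weights M/s load each vertex by at most one. Their total is at least (|J| + 1)/s, so the
  -- density p^s contributes p^(|J| + 1), one factor p more than is needed to cancel p^(-|J|).
  have h := homCount_le_of_weight J hJ U (fun e => (M e : ℝ) / s)
    (fun e => div_nonneg (by exact_mod_cast hM0 e) hs'.le)
    (fun i => by
      rw [← Finset.sum_div, div_le_one hs']
      exact_mod_cast hMi i) (Λ * p ^ s) hU
  refine h.trans ?_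
  rw [mul_assoc]
  refine mul_le_mul_of_nonneg_left ?_ (by positivity)
  rw [Real.mul_rpow (by positivity) (by positivity)]
  -- Summing degrees counts each edge at least once. This caps the power of Λ.
  have hle : ∑ e ∈ J, (M e : ℝ) / s ≤ (s + 1 : ℕ) := by
    have h1 : ∑ e ∈ J, M e ≤ ∑ i : Fin (s + 1), ∑ e ∈ J with i ∈ e, M e := by
      simp only [Finset.sum_filter]
      rw [Finset.sum_comm]
      refine Finset.sum_le_sum fun e _ => ?_
      induction e using Sym2.ind with
      | _ a b =>
        refine le_trans ?_ (Finset.single_le_sum (f := fun i => if i ∈ s(a, b) then M s(a, b) else 0)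
          (fun i _ => by
            split_ifs
            · exact hM0 _
            · exact le_rfl) (Finset.mem_univ a))
        simp
    have h2 : ∑ i : Fin (s + 1), ∑ e ∈ J with i ∈ e, M e ≤ (s + 1) * s := by
      refine (Finset.sum_le_sum fun i _ => hMi i).trans ?_
      simp
    rw [← Finset.sum_div, div_le_iff₀ hs']
    exact_mod_cast h1.trans h2
  have hnn : 0 ≤ ∑ e ∈ J, (M e : ℝ) / s :=
    Finset.sum_nonneg fun e _ => div_nonneg (by exact_mod_cast hM0 e) hs'.le
  refine mul_le_mul ?_ ?_ (by positivity) (by positivity)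
  · rw [← Real.rpow_natCast Λ]
    exact Real.rpow_le_rpow_of_exponent_le hΛ hle
  · rw [← Real.rpow_natCast, ← Real.rpow_natCast, ← Real.rpow_mul hp.le]
    refine Real.rpow_le_rpow_of_exponent_ge hp hp1 ?_
    rw [← Finset.sum_div, mul_div_cancel₀ _ hs'.ne']
    exact_mod_cast hM

/-- A graph with `m` edges contains at most `(2 m) ^ (k / 2)` homomorphic copies of the complete
graph on `k` vertices. -/
lemma homCount_complete_le {V : Type*} [Fintype V] [Nonempty V] {k : ℕ} (hk : 2 ≤ k)
    (U : Finset (Sym2 V)) :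
    (homCount (pairsIn (Finset.univ : Finset (Fin k))) U : ℝ) ≤
      (2 * (U.card : ℝ)) ^ ((k : ℝ) / 2) := by
  classical
  have hN : (0 : ℝ) < Fintype.card V := by exact_mod_cast Fintype.card_pos
  obtain ⟨s, rfl⟩ : ∃ s, k = s + 1 := ⟨k - 1, by omega⟩
  have hs : (0 : ℝ) < s := by
    have : 0 < s := by omega
    exact_mod_cast this
  have hdeg : ∀ i : Fin (s + 1),
      ((pairsIn (Finset.univ : Finset (Fin (s + 1)))).filter (i ∈ ·)).card ≤ s := by
    intro i
    have : (pairsIn (Finset.univ : Finset (Fin (s + 1)))).filter (i ∈ ·) ⊆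
        (Finset.univ.erase i).image fun j => s(i, j) := by
      intro e he
      obtain ⟨h1, h2⟩ := Finset.mem_filter.1 he
      obtain ⟨j, rfl⟩ := h2
      exact Finset.mem_image.2 ⟨j, by simpa using (mk_mem_pairsIn.1 h1).2.2.symm, rfl⟩
    refine (Finset.card_le_card this).trans (Finset.card_image_le.trans ?_)
    simp
  -- Weight 1/s on every edge is a fractional matching of total k/2. With β the exact edge density,
  -- the powers of |V| cancel.
  have h := homCount_le_of_weight (pairsIn (Finset.univ : Finset (Fin (s + 1))))
    (loopless_pairsIn _) U (fun _ => 1 / (s : ℝ)) (fun _ => by positivity)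
    (fun i => by
      rw [Finset.sum_const, nsmul_eq_mul, mul_one_div, div_le_one hs]
      exact_mod_cast hdeg i)
    (2 * (U.card : ℝ) / (Fintype.card V : ℝ) ^ 2) (by rw [div_mul_cancel₀ _ (by positivity)])
  refine h.trans_eq ?_
  have hsum : ∑ e ∈ pairsIn (Finset.univ : Finset (Fin (s + 1))), 1 / (s : ℝ) =
      ((s + 1 : ℕ) : ℝ) / 2 := by
    rw [Finset.sum_const, card_pairsIn, nsmul_eq_mul, Finset.card_univ, Fintype.card_fin,
      Nat.cast_choose_two]
    push_cast
    field_simp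
    ring
  rw [hsum, Real.div_rpow (by positivity) (by positivity), ← Real.rpow_natCast (_ : ℝ) 2,
    ← Real.rpow_mul hN.le]
  have : ((2 : ℕ) : ℝ) * (((s + 1 : ℕ) : ℝ) / 2) = ((s + 1 : ℕ) : ℝ) := by push_cast; ring
  rw [this, Real.rpow_natCast, mul_div_cancel₀ _ (by positivity)]

/-! ### Expanding the conditional mean over subgraphs of the clique -/

open Classical in
lemma factorial_le_card_injective {V : Type*} [Fintype V] [DecidableEq V] {r : ℕ} (S : Finset V)
    (hS : S.card = r) :
    r.factorial ≤ (Finset.univ.filter fun x : Fin r → V =>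
      Function.Injective x ∧ Finset.univ.image x = S).card := by
  have h1 : Fintype.card (Fin r ≃ S) = r.factorial := by
    rw [Fintype.card_equiv (Fintype.equivOfCardEq (by simp [hS])), Fintype.card_fin]
  rw [← h1, ← Finset.card_univ]
  refine Finset.card_le_card_of_injOn (fun f i => (f i : V)) ?_ ?_
  · intro f _
    simp only [Finset.coe_filter, Finset.mem_univ, true_and, Set.mem_ofPred_eq]
    refine ⟨fun i j h => f.injective (Subtype.ext h), ?_⟩
    ext v
    simp only [Finset.mem_image, Finset.mem_univ, true_and]
    constructor
    · rintro ⟨i, rfl⟩; exact (f i).2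
    · intro hv; exact ⟨f.symm ⟨v, hv⟩, by simp⟩
  · intro f _ f' _ h
    ext i
    exact congrFun h i

lemma pairsIn_image {V : Type*} [DecidableEq V] {r : ℕ} (x : Fin r → V)
    (hx : Function.Injective x) :
    pairsIn (Finset.univ.image x) = (pairsIn Finset.univ).image (Sym2.map x) := by
  ext e
  induction e using Sym2.ind with
  | _ a b =>
    simp only [mk_mem_pairsIn, Finset.mem_image, Finset.mem_univ, true_and]
    constructor
    · rintro ⟨⟨i, rfl⟩, ⟨j, rfl⟩, hne⟩
      exact ⟨s(i, j), mk_mem_pairsIn.2 ⟨Finset.mem_univ _, Finset.mem_univ _,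
        fun h => hne (h ▸ rfl)⟩, rfl⟩
    · rintro ⟨f, hf, hfe⟩
      induction f using Sym2.ind with
      | _ i j =>
        have hij := (mk_mem_pairsIn.1 hf).2.2
        rw [Sym2.map_mk, Sym2.eq_iff] at hfe
        rcases hfe with ⟨rfl, rfl⟩ | ⟨rfl, rfl⟩
        · exact ⟨⟨i, rfl⟩, ⟨j, rfl⟩, fun h => hij (hx h)⟩
        · exact ⟨⟨j, rfl⟩, ⟨i, rfl⟩, fun h => hij (hx h).symm⟩

open Classical in
/-- The indicator that the map `x` sends all pairs of `J` to pairs of `U`. -/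
def homInd {V : Type*} {k : ℕ} (J : Finset (Sym2 (Fin k))) (U : Finset (Sym2 V))
    (x : Fin k → V) : ℝ :=
  if ∀ e ∈ J, Sym2.map x e ∈ U then 1 else 0

/-- The left power is p^(r choose 2) times a product over pairs e of 1/p or 1, according to whether
e lands in U. Each factor is at most 1 + 1/p or 1 respectively. Expanding the product gives one term
per subgraph J, and J = ∅ cancels the subtracted term. -/
lemma pow_card_sdiff_le {n r : ℕ} {p : ℝ} (hp : 0 < p) (U : Finset (Sym2 (Fin n)))
    (x : Fin r → Fin n) (hx : Function.Injective x) :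
    p ^ (pairsIn (Finset.univ.image x) \ U).card - p ^ r.choose 2 ≤
      p ^ r.choose 2 * ∑ J ∈ (pairsIn (Finset.univ : Finset (Fin r))).powerset.erase ∅,
        (p⁻¹) ^ J.card * homInd J U x := by
  classical
  set E := pairsIn (Finset.univ : Finset (Fin r)) with hE
  have hcard : E.card = r.choose 2 := by rw [hE, card_pairsIn]; simp
  have h1 : (pairsIn (Finset.univ.image x) \ U).card =
      (E.filter fun e => Sym2.map x e ∉ U).card := by
    rw [pairsIn_image x hx, ← Finset.filter_notMem_eq_sdiff, Finset.filter_image,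
      Finset.card_image_of_injective _ (Sym2.map.injective hx)]
  have h2 : p ^ (pairsIn (Finset.univ.image x) \ U).card =
      p ^ r.choose 2 * ∏ e ∈ E, (if Sym2.map x e ∈ U then p⁻¹ else 1) := by
    rw [h1, Finset.prod_ite, Finset.prod_const_one, mul_one, Finset.prod_const, ← hcard,
      ← Finset.card_filter_add_card_filter_not (s := E) (fun e => Sym2.map x e ∈ U), pow_add,
      mul_right_comm, ← mul_pow, mul_inv_cancel₀ hp.ne', one_pow, one_mul]
  have h3 : ∏ e ∈ E, (if Sym2.map x e ∈ U then p⁻¹ else 1) ≤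
      ∏ e ∈ E, (1 + if Sym2.map x e ∈ U then p⁻¹ else 0) := by
    refine Finset.prod_le_prod (fun e _ => by split_ifs <;> positivity) fun e _ => ?_
    split_ifs <;> simp
  rw [Finset.prod_one_add] at h3
  have h4 : ∀ J ∈ E.powerset, ∏ e ∈ J, (if Sym2.map x e ∈ U then p⁻¹ else 0) =
      (p⁻¹) ^ J.card * homInd J U x := by
    intro J _
    unfold homInd
    split_ifs with h
    · rw [Finset.prod_congr rfl (g := fun _ => p⁻¹), Finset.prod_const, mul_one]
      intro e he
      rw [if_pos (h e he)]
    · push Not at h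
      obtain ⟨e, he, heU⟩ := h
      rw [mul_zero]
      exact Finset.prod_eq_zero he (by rw [if_neg heU])
  rw [Finset.sum_congr rfl h4, ← Finset.add_sum_erase _ _ (Finset.empty_mem_powerset E)] at h3
  have h5 : homInd ∅ U x = 1 := by simp [homInd]
  rw [Finset.card_empty, pow_zero, h5, mul_one] at h3
  rw [h2]
  have := mul_le_mul_of_nonneg_left h3 (pow_nonneg hp.le (r.choose 2))
  linarith

lemma sum_homInd_le {V : Type*} [Fintype V] {k : ℕ} (I : Finset (Fin k → V))
    (J : Finset (Sym2 (Fin k))) (U : Finset (Sym2 V)) :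
    ∑ x ∈ I, homInd J U x ≤ homCount J U := by
  classical
  unfold homInd
  rw [Finset.sum_boole, homCount, Nat.cast_le]
  refine Finset.card_le_card fun x hx => ?_
  rw [Finset.mem_filter] at hx
  exact mem_homSet.2 hx.2

open Classical in
lemma factorial_mul_sum_powersetCard_le {V : Type*} [Fintype V] [DecidableEq V] {r : ℕ}
    (f : Finset V → ℝ)
    (hf : ∀ S ∈ (Finset.univ : Finset V).powersetCard r, 0 ≤ f S) :
    r.factorial * ∑ S ∈ (Finset.univ : Finset V).powersetCard r, f S ≤
      ∑ x ∈ Finset.univ.filter fun x : Fin r → V => Function.Injective x,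
        f (Finset.univ.image x) := by
  rw [Finset.mul_sum, ← Finset.sum_fiberwise_of_maps_to
    (t := (Finset.univ : Finset V).powersetCard r) (g := fun x => Finset.univ.image x)
    (fun x hx => by
      rw [Finset.mem_powersetCard_univ, Finset.card_image_of_injective _
        (Finset.mem_filter.1 hx).2]
      simp)]
  refine Finset.sum_le_sum fun S hS => ?_
  rw [Finset.sum_congr rfl (g := fun _ => f S)
    (fun x hx => by rw [(Finset.mem_filter.1 hx).2]), Finset.sum_const, nsmul_eq_mul]
  refine mul_le_mul_of_nonneg_right ?_ (hf S hS)
  rw [Finset.filter_filter]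
  refine Nat.cast_le.2 ((factorial_le_card_injective S
    (Finset.mem_powersetCard_univ.1 hS)).trans (Finset.card_le_card fun x hx => ?_))
  simpa using hx

/-- Sum the pointwise expansion over all injections of r vertices. Every set S arises r! times, and
dropping injectivity only increases the counts. -/
lemma condMean_sub_le {n r : ℕ} {p : ℝ} (hp : 0 < p) (hp1 : p ≤ 1)
    (U : Finset (Sym2 (Fin n))) :
    r.factorial * (condMean r n p U - n.choose r * p ^ r.choose 2) ≤
      p ^ r.choose 2 * ∑ J ∈ (pairsIn (Finset.univ : Finset (Fin r))).powerset.erase ∅,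
        (p⁻¹) ^ J.card * (homCount J U : ℝ) := by
  classical
  have h0 : condMean r n p U - n.choose r * p ^ r.choose 2 =
      ∑ S ∈ (Finset.univ : Finset (Fin n)).powersetCard r,
        (p ^ (pairsIn S \ U).card - p ^ r.choose 2) := by
    rw [Finset.sum_sub_distrib, condMean]
    simp
  have hfnn : ∀ S ∈ (Finset.univ : Finset (Fin n)).powersetCard r,
      0 ≤ p ^ (pairsIn S \ U).card - p ^ r.choose 2 := by
    intro S hS
    rw [sub_nonneg]
    refine pow_le_pow_of_le_one hp.le hp1 ?_
    refine (Finset.card_le_card Finset.sdiff_subset).trans ?_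
    rw [card_pairsIn, Finset.mem_powersetCard_univ.1 hS]
  rw [h0]
  refine (factorial_mul_sum_powersetCard_le _ hfnn).trans ?_
  refine (Finset.sum_le_sum fun x hx =>
    pow_card_sdiff_le hp U x (Finset.mem_filter.1 hx).2).trans ?_
  rw [← Finset.mul_sum, Finset.sum_comm]
  refine mul_le_mul_of_nonneg_left (Finset.sum_le_sum fun J _ => ?_) (pow_nonneg hp.le _)
  rw [← Finset.mul_sum]
  exact mul_le_mul_of_nonneg_left (sum_homInd_le _ J U)
    (pow_nonneg (inv_nonneg.2 hp.le) _)

/-- Once the image of the centre is fixed, the leaves are arbitrary neighbours of it. -/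
lemma homCount_star {V : Type*} [Fintype V] {s : ℕ} (i : Fin (s + 1)) (U : Finset (Sym2 V)) :
    homCount ((pairsIn (Finset.univ : Finset (Fin (s + 1)))).filter (i ∈ ·)) U =
      ∑ v, (nbrs U v).card ^ s := by
  classical
  have h : ∀ x : Fin (s + 1) → V,
      (∀ e ∈ (pairsIn (Finset.univ : Finset (Fin (s + 1)))).filter (i ∈ ·), Sym2.map x e ∈ U) ↔
        ∀ j : Fin s, s(x i, x (i.succAbove j)) ∈ U := by
    intro x
    constructor
    · intro h j
      refine h s(i, i.succAbove j) (Finset.mem_filter.2 ⟨mk_mem_pairsIn.2 ⟨Finset.mem_univ _,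
        Finset.mem_univ _, (Fin.succAbove_ne i j).symm⟩, by simp⟩)
    · intro h e he
      obtain ⟨h1, h2⟩ := Finset.mem_filter.1 he
      obtain ⟨m, rfl⟩ := h2
      have hne := (mk_mem_pairsIn.1 h1).2.2
      obtain ⟨j, rfl⟩ := Fin.exists_succAbove_eq hne.symm
      exact h j
  have h2 : (homSet ((pairsIn (Finset.univ : Finset (Fin (s + 1)))).filter (i ∈ ·)) U).card =
      (Finset.univ.sigma fun v : V => Fintype.piFinset fun _ : Fin s => nbrs U v).card := by
    refine Finset.card_nbij' (fun x => ⟨x i, fun j => x (i.succAbove j)⟩)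
      (fun q => i.insertNth q.1 q.2) ?_ ?_ ?_ ?_
    · intro x hx
      have hx' := (h x).1 (mem_homSet.1 (Finset.mem_coe.1 hx))
      simpa [mem_nbrs] using hx'
    · intro q hq
      refine Finset.mem_coe.2 (mem_homSet.2 ((h _).2 ?_))
      simpa [mem_nbrs] using hq
    · intro x _
      simp only
      exact Fin.insertNth_self_removeNth i x
    · rintro ⟨v, y⟩ _
      simp
  rw [homCount, h2, Finset.card_sigma]
  simp [Fintype.card_piFinset]

/-- Only stars and cliques matter for the conditional expectation given a sparse graph. -/
lemma condMean_excess_le {n s : ℕ} (hn : 0 < n) (hs : 0 < s) {p Λ : ℝ} (hp : 0 < p)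
    (hp1 : p ≤ 1) (hΛ : 1 ≤ Λ) (U : Finset (Sym2 (Fin n)))
    (hU : 2 * (U.card : ℝ) ≤ Λ * p ^ s * (n : ℝ) ^ 2) :
    (s + 1).factorial * (condMean (s + 1) n p U - n.choose (s + 1) * p ^ (s + 1).choose 2) ≤
      p ^ (s + 1).choose 2 * ((s + 1) * ((p⁻¹) ^ s * ∑ v, ((nbrs U v).card : ℝ) ^ s) +
        (p⁻¹) ^ (s + 1).choose 2 * homCount (pairsIn (Finset.univ : Finset (Fin (s + 1)))) U +
        2 ^ (s + 1).choose 2 * ((n : ℝ) ^ (s + 1) * Λ ^ (s + 1) * p)) := by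
  classical
  have : Nonempty (Fin n) := ⟨⟨0, hn⟩⟩
  refine (condMean_sub_le hp hp1 U).trans (mul_le_mul_of_nonneg_left ?_ (by positivity))
  set E := pairsIn (Finset.univ : Finset (Fin (s + 1))) with hE
  have hEcard : E.card = (s + 1).choose 2 := by rw [hE, card_pairsIn]; simp
  set f : Finset (Sym2 (Fin (s + 1))) → ℝ := fun J => (p⁻¹) ^ J.card * (homCount J U : ℝ) with hf
  have hfnn : ∀ J, 0 ≤ f J := fun J => by positivity
  set stars := (Finset.univ : Finset (Fin (s + 1))).image fun i => E.filter (i ∈ ·) with hstars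
  have hstarcard : ∀ i : Fin (s + 1), (E.filter (i ∈ ·)).card = s := by
    intro i
    have : E.filter (i ∈ ·) = (Finset.univ.erase i).image fun j => s(i, j) := by
      ext e
      simp only [Finset.mem_filter, Finset.mem_image, Finset.mem_erase, Finset.mem_univ, and_true]
      constructor
      · rintro ⟨h1, j, rfl⟩
        exact ⟨j, (mk_mem_pairsIn.1 h1).2.2.symm, rfl⟩
      · rintro ⟨j, hj, rfl⟩
        exact ⟨mk_mem_pairsIn.2 ⟨Finset.mem_univ _, Finset.mem_univ _, hj.symm⟩, by simp⟩
    rw [this, Finset.card_image_of_injective _ (fun j j' h => Sym2.congr_right.1 h)]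
    simp
  -- Stars, the complete graph, and the rest. Overlaps are harmless because all terms are
  -- nonnegative.
  have hsub : E.powerset.erase ∅ ⊆
      (stars ∪ {E}) ∪ (E.powerset.erase ∅).filter (fun J => J ∉ stars ∪ {E}) := by
    intro J hJ
    by_cases h : J ∈ stars ∪ {E}
    · exact Finset.mem_union_left _ h
    · exact Finset.mem_union_right _ (Finset.mem_filter.2 ⟨hJ, h⟩)
  have hun : ∀ S T : Finset (Finset (Sym2 (Fin (s + 1)))),
      ∑ J ∈ S ∪ T, f J ≤ ∑ J ∈ S, f J + ∑ J ∈ T, f J := by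
    intro S T
    rw [← Finset.sum_union_inter]
    have : 0 ≤ ∑ J ∈ S ∩ T, f J := Finset.sum_nonneg fun J _ => hfnn J
    linarith
  refine (Finset.sum_le_sum_of_subset_of_nonneg hsub fun J _ _ => hfnn J).trans ?_
  refine (hun _ _).trans (add_le_add ((hun _ _).trans (add_le_add ?_ ?_)) ?_)
  · refine (Finset.sum_image_le_of_nonneg (fun J _ => hfnn _)).trans ?_
    rw [Finset.sum_congr rfl (g := fun _ => (p⁻¹) ^ s * ∑ v, ((nbrs U v).card : ℝ) ^ s)]
    · simp
    · intro i _
      simp only [hf, hstarcard]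
      rw [homCount_star]
      push_cast
      rfl
  · simp [hf, hEcard]
  · have hbound : ∀ J ∈ (E.powerset.erase ∅).filter (fun J => J ∉ stars ∪ {E}),
        f J ≤ (n : ℝ) ^ (s + 1) * Λ ^ (s + 1) * p := by
      intro J hJ
      simp only [Finset.mem_filter, Finset.mem_erase, Finset.mem_powerset, Finset.mem_union,
        Finset.mem_singleton, not_or, hstars, Finset.mem_image, Finset.mem_univ, true_and,
        not_exists] at hJ
      obtain ⟨⟨hne, hsub⟩, hst, hEq⟩ := hJ
      have h := homCount_le_of_ne hs J (fun e he => loopless_pairsIn _ e (hsub he))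
        (Finset.nonempty_iff_ne_empty.2 hne) hEq (fun i h => hst i h.symm) U p Λ hp hp1 hΛ
        (by simpa using hU)
      rw [Fintype.card_fin] at h
      simp only [hf]
      rw [inv_pow, inv_mul_le_iff₀ (by positivity)]
      refine h.trans_eq ?_
      ring
    refine (Finset.sum_le_sum hbound).trans ?_
    rw [Finset.sum_const, nsmul_eq_mul]
    refine mul_le_mul_of_nonneg_right ?_ (by positivity)
    have : ((E.powerset.erase ∅).filter (fun J => J ∉ stars ∪ {E})).card ≤
        2 ^ (s + 1).choose 2 := by
      rw [← hEcard, ← Finset.card_powerset]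
      exact Finset.card_le_card ((Finset.filter_subset _ _).trans (Finset.erase_subset _ _))
    exact_mod_cast this

/-! ### Edges at hubs and clique cores -/

open Classical in
/-- The pairs of `U` that meet the vertex set `H`. -/
def touching {V : Type*} (U : Finset (Sym2 V)) (H : Finset V) : Finset (Sym2 V) :=
  U.filter fun e => ∃ v ∈ H, v ∈ e

lemma mem_touching {V : Type*} {U : Finset (Sym2 V)} {H : Finset V} {e : Sym2 V} :
    e ∈ touching U H ↔ e ∈ U ∧ ∃ v ∈ H, v ∈ e := by
  classical
  rw [touching, Finset.mem_filter]

lemma touching_subset {V : Type*} (U : Finset (Sym2 V)) (H : Finset V) : touching U H ⊆ U :=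
  fun _ he => (mem_touching.1 he).1

lemma nbrs_touching {V : Type*} [Fintype V] (U : Finset (Sym2 V)) {H : Finset V} {v : V}
    (hv : v ∈ H) : nbrs (touching U H) v = nbrs U v := by
  ext w
  rw [mem_nbrs, mem_nbrs, mem_touching]
  exact ⟨fun h => h.1, fun h => ⟨h, v, hv, Sym2.mem_mk_left v w⟩⟩

/-- Only edges inside H can be counted twice: neighbours outside H inject into the touching edges,
and each vertex has at most |H| neighbours in H. -/
lemma sum_card_nbrs_le_touching {V : Type*} [Fintype V] (U : Finset (Sym2 V))
    (H : Finset V) :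
    ∑ v ∈ H, (nbrs U v).card ≤ (touching U H).card + H.card ^ 2 := by
  classical
  have h1 : ∀ v ∈ H, (nbrs U v).card ≤ (nbrs U v \ H).card + H.card := fun v _ =>
    Finset.card_le_card_sdiff_add_card
  refine (Finset.sum_le_sum h1).trans ?_
  rw [Finset.sum_add_distrib, Finset.sum_const, smul_eq_mul, sq, ← Finset.card_sigma]
  refine Nat.add_le_add_right ?_ _
  refine Finset.card_le_card_of_injOn (fun q => s(q.1, q.2)) ?_ ?_
  · rintro ⟨v, w⟩ h
    simp only [Finset.coe_sigma, Set.mem_sigma_iff, Finset.mem_coe, Finset.mem_sdiff,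
      mem_nbrs] at h
    exact mem_touching.2 ⟨h.2.1, v, h.1, Sym2.mem_mk_left v w⟩
  · rintro ⟨v, w⟩ h ⟨v', w'⟩ h' heq
    simp only [Finset.coe_sigma, Set.mem_sigma_iff, Finset.mem_coe, Finset.mem_sdiff] at h h'
    simp only [Sym2.eq_iff] at heq
    rcases heq with ⟨rfl, rfl⟩ | ⟨rfl, rfl⟩
    · rfl
    · exact absurd h'.1 h.2.2

/-- Deleting the edges at `H` destroys few cliques. -/
lemma homCount_le_sdiff_touching {V : Type*} [Fintype V] [DecidableEq V] {s : ℕ}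
    (U : Finset (Sym2 V)) (H : Finset V) :
    homCount (pairsIn (Finset.univ : Finset (Fin (s + 1)))) U ≤
      homCount (pairsIn (Finset.univ : Finset (Fin (s + 1)))) (U \ touching U H) +
        (s + 1) * (H.card * homCount (pairsIn (Finset.univ : Finset (Fin s))) U) := by
  classical
  set E := pairsIn (Finset.univ : Finset (Fin (s + 1))) with hE
  set T : Fin (s + 1) → Finset (Fin (s + 1) → V) := fun i =>
    Finset.univ.filter fun x => x i ∈ H ∧ ∀ e ∈ E, Sym2.map x e ∈ U with hT
  have hsub : homSet E U ⊆ homSet E (U \ touching U H) ∪ Finset.univ.biUnion T := by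
    intro x hx
    rw [mem_homSet] at hx
    by_cases h : ∃ i, x i ∈ H
    · obtain ⟨i, hi⟩ := h
      refine Finset.mem_union_right _ (Finset.mem_biUnion.2 ⟨i, Finset.mem_univ _, ?_⟩)
      exact Finset.mem_filter.2 ⟨Finset.mem_univ _, hi, hx⟩
    · push Not at h
      refine Finset.mem_union_left _ (mem_homSet.2 fun e he => ?_)
      refine Finset.mem_sdiff.2 ⟨hx e he, fun hc => ?_⟩
      obtain ⟨v, hv, hve⟩ := (mem_touching.1 hc).2
      obtain ⟨i, _, rfl⟩ := Sym2.mem_map.1 hve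
      exact h i hv
  -- A clique whose i-th vertex lies in H is determined by that vertex and the K_s on the remaining
  -- ones.
  have hTi : ∀ i, (T i).card ≤ H.card * homCount (pairsIn (Finset.univ : Finset (Fin s))) U := by
    intro i
    rw [homCount, ← Finset.card_product]
    refine Finset.card_le_card_of_injOn (fun x => (x i, fun j => x (i.succAbove j))) ?_ ?_
    · intro x hx
      obtain ⟨h1, h2⟩ := (Finset.mem_filter.1 (Finset.mem_coe.1 hx)).2
      refine Finset.mem_coe.2 (Finset.mem_product.2 ⟨h1, mem_homSet.2 fun e he => ?_⟩)
      induction e using Sym2.ind with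
      | _ a b =>
        refine h2 s(i.succAbove a, i.succAbove b) (mk_mem_pairsIn.2
          ⟨Finset.mem_univ _, Finset.mem_univ _, fun h => ?_⟩)
        exact (mk_mem_pairsIn.1 he).2.2 (Fin.succAbove_right_injective h)
    · intro x _ y _ hxy
      simp only [Prod.mk.injEq] at hxy
      funext j
      rcases eq_or_ne j i with rfl | hj
      · exact hxy.1
      · obtain ⟨m, rfl⟩ := Fin.exists_succAbove_eq hj
        exact congrFun hxy.2 m
  refine (Finset.card_le_card hsub).trans ((Finset.card_union_le _ _).trans ?_)
  refine Nat.add_le_add_left (Finset.card_biUnion_le.trans ?_) _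
  refine (Finset.sum_le_sum fun i _ => hTi i).trans ?_
  simp

/-- Every graph has a subgraph with almost as many cliques in which each edge is contained in many
cliques. -/
lemma exists_core {V : Type*} [Fintype V] [DecidableEq V] {k : ℕ} (J : Finset (Sym2 (Fin k)))
    (B : Finset (Sym2 V)) (l : ℝ) (hl : 0 ≤ l) :
    ∃ B' ⊆ B, (homCount J B : ℝ) ≤ homCount J B' + l * B.card ∧
      ∀ e ∈ B', l ≤ (homCount J B' : ℝ) - homCount J (B'.erase e) := by
  -- Maximise the number of cliques minus l times the number of edges. Comparison with B bounds the
  -- loss, and comparison with `B'.erase e` shows that e lies in many cliques.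
  obtain ⟨B', hB', hmax⟩ := Finset.exists_max_image B.powerset
    (fun B' => (homCount J B' : ℝ) - l * B'.card) ⟨B, Finset.mem_powerset_self B⟩
  rw [Finset.mem_powerset] at hB'
  refine ⟨B', hB', ?_, fun e he => ?_⟩
  · have h := hmax B (Finset.mem_powerset_self B)
    have h2 : 0 ≤ l * B'.card := by positivity
    linarith
  · have h := hmax (B'.erase e)
      (Finset.mem_powerset.2 ((Finset.erase_subset _ _).trans hB'))
    have h3 : (((B'.erase e).card : ℕ) : ℝ) = B'.card - 1 := by
      rw [Finset.card_erase_of_mem he, Nat.cast_sub (Finset.card_pos.2 ⟨e, he⟩)]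
      simp
    rw [h3] at h
    linarith

lemma card_pinned_le {V : Type*} [Fintype V] [DecidableEq V] {k : ℕ} {i j : Fin k} (hij : i ≠ j) (a b : V)
    (N : Finset V) :
    (Finset.univ.filter fun x : Fin k → V => x i = a ∧ x j = b ∧ ∀ m, m ≠ i → x m ∈ N).card ≤
      N.card ^ (k - 2) := by
  have h : (Finset.univ.filter fun x : Fin k → V =>
      x i = a ∧ x j = b ∧ ∀ m, m ≠ i → x m ∈ N) ⊆
      Fintype.piFinset fun m => if m = i then {a} else if m = j then {b} else N := by
    intro x
    simp only [Finset.mem_filter, Finset.mem_univ, true_and, Fintype.mem_piFinset]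
    rintro ⟨h1, h2, h3⟩ m
    split_ifs with h4 h5
    · simp [h4, h1]
    · simp [h5, h2]
    · exact h3 m h4
  refine (Finset.card_le_card h).trans ?_
  rw [Fintype.card_piFinset]
  have h2 : ∀ m : Fin k, (if m = i then ({a} : Finset V) else if m = j then {b} else N).card =
      if m ∈ ({i, j} : Finset (Fin k)) then 1 else N.card := by
    intro m
    by_cases h3 : m = i
    · simp [h3]
    · by_cases h4 : m = j
      · simp [h4, hij.symm]
      · simp [h3, h4]
  simp only [h2]
  rw [Finset.prod_ite]
  simp only [Finset.prod_const_one, one_mul, Finset.prod_const]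
  have h7 : (Finset.univ.filter fun m : Fin k => m ∉ ({i, j} : Finset (Fin k))) =
      ({i, j} : Finset (Fin k))ᶜ := by ext; simp
  rw [h7, Finset.card_compl, Finset.card_pair hij, Fintype.card_fin]

/-- The number of cliques through an edge is bounded in terms of the degree of an endpoint. -/
lemma homCount_sub_erase_le {V : Type*} [Fintype V] [DecidableEq V] {k : ℕ}
    (B : Finset (Sym2 V)) {u v : V} :
    (homCount (pairsIn (Finset.univ : Finset (Fin k))) B : ℝ) -
      homCount (pairsIn (Finset.univ : Finset (Fin k))) (B.erase s(u, v)) ≤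
      (k : ℝ) ^ 2 * ((nbrs B u).card : ℝ) ^ (k - 2) := by
  set E := pairsIn (Finset.univ : Finset (Fin k)) with hE
  set T : Fin k × Fin k → Finset (Fin k → V) := fun q =>
    if q.1 = q.2 then ∅ else Finset.univ.filter fun x : Fin k → V =>
      x q.1 = u ∧ x q.2 = v ∧ ∀ m, m ≠ q.1 → x m ∈ nbrs B u with hT
  -- A clique lost with the edge uv sends some ordered pair (i, j) to (u, v), and its other vertices
  -- are neighbours of u.
  have hsub : homSet E B ⊆ homSet E (B.erase s(u, v)) ∪ Finset.univ.biUnion T := by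
    intro x hx
    rw [mem_homSet] at hx
    by_cases h : ∀ e ∈ E, Sym2.map x e ≠ s(u, v)
    · exact Finset.mem_union_left _ (mem_homSet.2 fun e he =>
        Finset.mem_erase.2 ⟨h e he, hx e he⟩)
    · push Not at h
      obtain ⟨e, he, heq⟩ := h
      obtain ⟨i, j, hij, hi, hj⟩ : ∃ i j, i ≠ j ∧ x i = u ∧ x j = v := by
        induction e using Sym2.ind with
        | _ a b =>
          have hab := (mk_mem_pairsIn.1 he).2.2
          rw [Sym2.map_mk, Sym2.eq_iff] at heq
          rcases heq with ⟨h1, h2⟩ | ⟨h1, h2⟩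
          · exact ⟨a, b, hab, h1, h2⟩
          · exact ⟨b, a, hab.symm, h2, h1⟩
      refine Finset.mem_union_right _ (Finset.mem_biUnion.2 ⟨(i, j), Finset.mem_univ _, ?_⟩)
      simp only [hT, if_neg hij]
      refine Finset.mem_filter.2 ⟨Finset.mem_univ _, hi, hj, fun m hm => ?_⟩
      rw [mem_nbrs, ← hi]
      exact hx s(i, m) (mk_mem_pairsIn.2 ⟨Finset.mem_univ _, Finset.mem_univ _, hm.symm⟩)
  have hTq : ∀ q, (T q).card ≤ (nbrs B u).card ^ (k - 2) := by
    rintro ⟨i, j⟩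
    by_cases hij : i = j
    · simp [hT, hij]
    · simp only [hT, if_neg hij]
      exact card_pinned_le hij u v _
  have h := (Finset.card_le_card hsub).trans ((Finset.card_union_le _ _).trans
    (Nat.add_le_add_left (Finset.card_biUnion_le.trans
      (Finset.sum_le_sum fun q _ => hTq q)) _))
  rw [Finset.sum_const, Finset.card_univ, Fintype.card_prod, Fintype.card_fin, smul_eq_mul] at h
  have h2 : (homCount E B : ℝ) ≤ homCount E (B.erase s(u, v)) +
      ((k * k : ℕ) : ℝ) * ((nbrs B u).card : ℝ) ^ (k - 2) := by
    exact_mod_cast h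
  push_cast at h2
  rw [sq]
  linarith

open Classical in
/-- The vertices covered by `B`. -/
def covered {V : Type*} [Fintype V] (B : Finset (Sym2 V)) : Finset V :=
  Finset.univ.filter fun v => ∃ e ∈ B, v ∈ e

lemma mem_covered {V : Type*} [Fintype V] {B : Finset (Sym2 V)} {v : V} :
    v ∈ covered B ↔ ∃ e ∈ B, v ∈ e := by
  classical
  rw [covered, Finset.mem_filter]
  simp

lemma subset_pairsIn_covered {V : Type*} [Fintype V] [DecidableEq V] (B : Finset (Sym2 V))
    (hB : Loopless B) : B ⊆ pairsIn (covered B) := by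
  intro e he
  induction e using Sym2.ind with
  | _ a b =>
    refine mk_mem_pairsIn.2 ⟨?_, ?_, by simpa using hB _ he⟩
    · exact mem_covered.2 ⟨_, he, Sym2.mem_mk_left a b⟩
    · exact mem_covered.2 ⟨_, he, Sym2.mem_mk_right a b⟩

/-- In a core, the number of covered vertices is small. -/
lemma card_covered_mul_le {V : Type*} [Fintype V] [DecidableEq V] {s : ℕ} (hs : 2 ≤ s)
    (B : Finset (Sym2 V)) (d l : ℝ) (hl : ((s + 1 : ℕ) : ℝ) ^ 2 * d ^ (s - 1) ≤ l)
    (hB : ∀ e ∈ B, l ≤ (homCount (pairsIn (Finset.univ : Finset (Fin (s + 1)))) B : ℝ) -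
      homCount (pairsIn (Finset.univ : Finset (Fin (s + 1)))) (B.erase e)) :
    ((covered B).card : ℝ) * d ≤ 2 * B.card := by
  classical
  -- An edge at u lies in at least l cliques, which forces u to have degree at least d in B. The
  -- degree sum then limits the number of covered vertices.
  have hdeg : ∀ u ∈ covered B, d ≤ (nbrs B u).card := by
    intro u hu
    obtain ⟨e, he, hue⟩ := mem_covered.1 hu
    obtain ⟨v, rfl⟩ := hue
    have h1 := (hB _ he).trans (homCount_sub_erase_le B)
    have h2 : d ^ (s - 1) ≤ ((nbrs B u).card : ℝ) ^ (s - 1) := by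
      have h3 := hl.trans h1
      have h4 : s + 1 - 2 = s - 1 := by omega
      rw [h4] at h3
      exact le_of_mul_le_mul_left h3 (by positivity)
    exact le_of_pow_le_pow_left₀ (by omega) (by positivity) h2
  calc ((covered B).card : ℝ) * d = ∑ u ∈ covered B, d := by rw [Finset.sum_const, nsmul_eq_mul]
    _ ≤ ∑ u ∈ covered B, ((nbrs B u).card : ℝ) := Finset.sum_le_sum hdeg
    _ ≤ 2 * B.card := by exact_mod_cast sum_card_nbrs_le B (covered B)

/-! ### Counting edge sets confined to small regions -/

/-- A set of at most K vertices is the range of a list of length K padded with `none`. -/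
lemma card_small_subsets_le {V : Type*} [Fintype V] (K : ℕ) :
    ((Finset.univ : Finset (Finset V)).filter fun H => H.card ≤ K).card ≤
      (Fintype.card V + 1) ^ K := by
  classical
  have h : ((Finset.univ : Finset (Finset V)).filter fun H => H.card ≤ K) ⊆
      (Finset.univ : Finset (Fin K → Option V)).image
        fun f => Finset.univ.filter fun v => ∃ i, f i = some v := by
    intro H hH
    have hK : H.card ≤ K := (Finset.mem_filter.1 hH).2
    refine Finset.mem_image.2 ⟨fun i => if h : i.1 < H.card then
      some ((H.equivFin.symm ⟨i.1, h⟩ : H) : V) else none, Finset.mem_univ _, ?_⟩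
    ext v
    simp only [Finset.mem_filter, Finset.mem_univ, true_and]
    constructor
    · rintro ⟨i, hi⟩
      split_ifs at hi with h
      rw [Option.some.injEq] at hi
      rw [← hi]
      exact (H.equivFin.symm ⟨i.1, h⟩).2
    · intro hv
      have h1 := (H.equivFin ⟨v, hv⟩).2
      exact ⟨⟨(H.equivFin ⟨v, hv⟩).1, h1.trans_le hK⟩, by simp⟩
  refine (Finset.card_le_card h).trans (Finset.card_image_le.trans ?_)
  simp

lemma choose_le_exp_mul_div_pow (T m : ℕ) :
    (T.choose m : ℝ) ≤ (Real.exp 1 * T / m) ^ m := by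
  rcases Nat.eq_zero_or_pos m with rfl | hm
  · simp
  · have hm' : (0 : ℝ) < m := by exact_mod_cast hm
    have h1 := Nat.choose_le_pow_div (α := ℝ) m T
    have h2 := Real.pow_div_factorial_le_exp (m : ℝ) hm'.le m
    have h3 : Real.exp (m : ℝ) = Real.exp 1 ^ m := by rw [← Real.exp_nat_mul, mul_one]
    rw [h3] at h2
    refine h1.trans ?_
    rw [div_pow, mul_pow]
    rw [div_le_iff₀ (by positivity)] at h2 ⊢
    rw [div_mul_eq_mul_div, le_div_iff₀ (by positivity)]
    calc (T : ℝ) ^ m * (m : ℝ) ^ m ≤ (T : ℝ) ^ m * (Real.exp 1 ^ m * m.factorial) := by gcongr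
      _ = _ := by ring

open Classical in
/-- The edge sets with `m` edges confined to the region `P H` for some set `H` of at most `K`
vertices. -/
def confined {V : Type*} [Fintype V] (P : Finset V → Finset (Sym2 V)) (K m : ℕ) :
    Finset (Finset (Sym2 V)) :=
  Finset.univ.filter fun A => A.card = m ∧ ∃ H : Finset V, H.card ≤ K ∧ A ⊆ P H

lemma mem_confined {V : Type*} [Fintype V] {P : Finset V → Finset (Sym2 V)} {K m : ℕ}
    {A : Finset (Sym2 V)} :
    A ∈ confined P K m ↔ A.card = m ∧ ∃ H : Finset V, H.card ≤ K ∧ A ⊆ P H := by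
  classical
  rw [confined, Finset.mem_filter]
  simp

/-- Counting edge sets confined to a region determined by a small vertex set. -/
lemma card_confined_le {V : Type*} [Fintype V] (P : Finset V → Finset (Sym2 V)) (K T m : ℕ)
    (hP : ∀ H : Finset V, H.card ≤ K → (P H).card ≤ T) :
    ((confined P K m).card : ℝ) ≤
      ((Fintype.card V : ℝ) + 1) ^ K * (Real.exp 1 * T / m) ^ m := by
  classical
  have hsub : confined P K m ⊆
      ((Finset.univ : Finset (Finset V)).filter fun H => H.card ≤ K).biUnion
        fun H => (P H).powersetCard m := by
    intro A hA
    obtain ⟨h1, H, h2, h3⟩ := mem_confined.1 hA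
    exact Finset.mem_biUnion.2 ⟨H, Finset.mem_filter.2 ⟨Finset.mem_univ _, h2⟩,
      Finset.mem_powersetCard.2 ⟨h3, h1⟩⟩
  have h1 := (Finset.card_le_card hsub).trans (Finset.card_biUnion_le.trans
    (Finset.sum_le_sum (g := fun _ => T.choose m) fun H hH => by
      rw [Finset.card_powersetCard]
      exact Nat.choose_le_choose m (hP H (Finset.mem_filter.1 hH).2)))
  rw [Finset.sum_const, smul_eq_mul] at h1
  have h2 := h1.trans (Nat.mul_le_mul_right _ (card_small_subsets_le (V := V) K))
  refine (Nat.cast_le.2 h2).trans ?_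
  push_cast
  gcongr
  exact choose_le_exp_mul_div_pow T m

open Classical in
lemma card_touching_univ_le {V : Type*} [Fintype V] (H : Finset V) :
    (touching (Finset.univ : Finset (Sym2 V)) H).card ≤ H.card * Fintype.card V := by
  have : touching (Finset.univ : Finset (Sym2 V)) H ⊆
      (H ×ˢ (Finset.univ : Finset V)).image fun q => s(q.1, q.2) := by
    intro e he
    obtain ⟨v, hv, w, rfl⟩ := (mem_touching.1 he).2
    exact Finset.mem_image.2 ⟨(v, w), by simpa using hv, rfl⟩
  refine (Finset.card_le_card this).trans (Finset.card_image_le.trans ?_)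
  simp [Finset.card_product]

/-! ### The cost of hubs -/

/-- The normalised number of edges needed for hubs creating `T` full-degree stars. -/
def hubCost (r : ℕ) (T : ℝ) : ℝ := (⌊T⌋ : ℝ) + Int.fract T ^ ((1 : ℝ) / ((r : ℝ) - 1))

lemma psiCost_eq (r : ℕ) (δ c x : ℝ) :
    psiCost r δ c x = (δ * (1 - x)) ^ ((2 : ℝ) / r) / 2 + hubCost r (x * δ * c / r) / c := rfl

lemma one_div_sub_one_pos {r : ℕ} (hr : 3 ≤ r) : 0 < (1 : ℝ) / ((r : ℝ) - 1) := by
  have : (3 : ℝ) ≤ r := by exact_mod_cast hr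
  exact one_div_pos.2 (by linarith)

lemma one_div_sub_one_le {r : ℕ} (hr : 3 ≤ r) : (1 : ℝ) / ((r : ℝ) - 1) ≤ 1 / 2 := by
  have : (3 : ℝ) ≤ r := by exact_mod_cast hr
  exact one_div_le_one_div_of_le (by norm_num) (by linarith)

lemma two_div_pos {r : ℕ} (hr : 3 ≤ r) : 0 < (2 : ℝ) / r := by
  have : (3 : ℝ) ≤ r := by exact_mod_cast hr
  positivity

lemma two_div_le_one {r : ℕ} (hr : 3 ≤ r) : (2 : ℝ) / r ≤ 1 := by
  have : (3 : ℝ) ≤ r := by exact_mod_cast hr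
  rw [div_le_one (by linarith)]
  linarith

lemma le_hubCost {r : ℕ} (hr : 3 ≤ r) (T : ℝ) : T ≤ hubCost r T := by
  have h : Int.fract T ≤ Int.fract T ^ ((1 : ℝ) / ((r : ℝ) - 1)) := by
    refine Real.self_le_rpow_of_le_one (Int.fract_nonneg T) (Int.fract_lt_one T).le ?_
    linarith [one_div_sub_one_le hr]
  have := Int.floor_add_fract T
  unfold hubCost
  linarith

lemma hubCost_le {r : ℕ} (hr : 3 ≤ r) (T : ℝ) : hubCost r T ≤ T + 1 := by
  have h : Int.fract T ^ ((1 : ℝ) / ((r : ℝ) - 1)) ≤ 1 :=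
    Real.rpow_le_one (Int.fract_nonneg T) (Int.fract_lt_one T).le (one_div_sub_one_pos hr).le
  have := Int.floor_le T
  unfold hubCost
  linarith

lemma hubCost_natCast {r : ℕ} (hr : 3 ≤ r) (k : ℕ) : hubCost r k = k := by
  simp [hubCost, Real.zero_rpow (one_div_sub_one_pos hr).ne', -one_div]

lemma hubCost_zero {r : ℕ} (hr : 3 ≤ r) : hubCost r 0 = 0 := by
  simpa using hubCost_natCast hr 0

lemma hubCost_add_natCast (r : ℕ) (k : ℕ) (T : ℝ) : hubCost r (k + T) = k + hubCost r T := by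
  simp only [hubCost, Int.floor_natCast_add, Int.fract_natCast_add]
  push_cast
  ring

lemma hubCost_of_mem_Ico {r : ℕ} {T : ℝ} (h0 : 0 ≤ T) (h1 : T < 1) :
    hubCost r T = T ^ ((1 : ℝ) / ((r : ℝ) - 1)) := by
  rw [hubCost, Int.fract_eq_self.2 ⟨h0, h1⟩, Int.floor_eq_zero_iff.2 ⟨h0, h1⟩]
  simp

/-- At T = 1 a completed partial hub agrees with one full hub, so the root formula holds up to the
closed endpoint. -/
lemma hubCost_of_mem_Icc {r : ℕ} (hr : 3 ≤ r) {T : ℝ} (h0 : 0 ≤ T) (h1 : T ≤ 1) :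
    hubCost r T = T ^ ((1 : ℝ) / ((r : ℝ) - 1)) := by
  rcases h1.eq_or_lt with rfl | h
  · rw [Real.one_rpow]
    simpa using hubCost_natCast hr 1
  · exact hubCost_of_mem_Ico h0 h

lemma hubCost_mono {r : ℕ} (hr : 3 ≤ r) : Monotone (hubCost r) := by
  intro a b hab
  have ha := (one_div_sub_one_pos hr).le
  unfold hubCost
  rcases (Int.floor_le_floor hab).eq_or_lt with h | h
  · rw [h]
    gcongr
    rw [Int.fract, Int.fract, h]
    linarith
  · have h1 : ((⌊a⌋ : ℤ) : ℝ) + 1 ≤ (⌊b⌋ : ℤ) := by exact_mod_cast h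
    have h2 : Int.fract a ^ ((1 : ℝ) / ((r : ℝ) - 1)) ≤ 1 :=
      Real.rpow_le_one (Int.fract_nonneg a) (Int.fract_lt_one a).le ha
    have h3 : 0 ≤ Int.fract b ^ ((1 : ℝ) / ((r : ℝ) - 1)) :=
      Real.rpow_nonneg (Int.fract_nonneg b) _
    linarith

lemma hubCost_nonneg {r : ℕ} (hr : 3 ≤ r) {T : ℝ} (hT : 0 ≤ T) : 0 ≤ hubCost r T :=
  hT.trans (le_hubCost hr T)

lemma continuous_hubCost {r : ℕ} (hr : 3 ≤ r) : Continuous (hubCost r) := by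
  have ha := one_div_sub_one_pos hr
  -- The correction to the identity is a function of the fractional part that vanishes at both 0 and
  -- 1, so no jump occurs at integers.
  have h : hubCost r = fun T => T + (fun u : ℝ => u ^ ((1 : ℝ) / ((r : ℝ) - 1)) - u)
      (Int.fract T) := by
    funext T
    have := Int.floor_add_fract T
    simp only [hubCost]
    linarith
  rw [h]
  refine continuous_id.add ?_
  refine ContinuousOn.comp_fract'' (f := fun u : ℝ => u ^ ((1 : ℝ) / ((r : ℝ) - 1)) - u) ?_ ?_
  · exact ((continuous_id.rpow_const fun _ => Or.inr ha.le).sub continuous_id).continuousOn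
  · simp [Real.zero_rpow ha.ne', -one_div]

/-- Convexity of powers: moving mass outwards increases the sum of powers. -/
lemma pow_add_pow_le_one_add {u a : ℝ} (hu : 0 ≤ u) (hu1 : u ≤ 1) (ha : 0 ≤ a) (ha1 : a ≤ 1)
    (h : 1 ≤ u + a) (s : ℕ) : u ^ s + a ^ s ≤ 1 + (u + a - 1) ^ s := by
  induction s with
  | zero => norm_num
  | succ s ih =>
    have h1 : a ^ s ≤ 1 := pow_le_one₀ ha ha1
    have h2 : (u + a - 1) ^ s ≤ a ^ s := pow_le_pow_left₀ (by linarith) (by linarith) s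
    have h3 : 0 ≤ (1 - a) * (1 - a ^ s) := mul_nonneg (by linarith) (by linarith)
    have h4 : (u + a - 1) * (a ^ s - (u + a - 1) ^ s) ≤ u * (a ^ s - (u + a - 1) ^ s) :=
      mul_le_mul_of_nonneg_right (by linarith) (by linarith)
    have h5 : u * (a ^ s - (u + a - 1) ^ s) ≤ u * (1 - u ^ s) :=
      mul_le_mul_of_nonneg_left (by linarith) hu
    have h6 : (1 - u) * a ^ s ≤ (1 - u) * 1 := mul_le_mul_of_nonneg_left h1 (by linarith)
    rw [pow_succ, pow_succ, pow_succ]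
    nlinarith

/-- This is the price of one more hub of relative degree a. Only the fractional part u^s of T
matters. If u^s + a^s < 1, the s-norm of (u, a) is at most its 1-norm. Otherwise
`pow_add_pow_le_one_add` replaces the pair (u, a) by a full hub and a partial one of degree u + a -
1. -/
lemma hubCost_add_pow_le {s : ℕ} (hs : 2 ≤ s) {T a : ℝ} (hT : 0 ≤ T) (ha : 0 ≤ a) (ha1 : a ≤ 1) :
    hubCost (s + 1) (T + a ^ s) ≤ hubCost (s + 1) T + a := by
  have hr : 3 ≤ s + 1 := by omega
  have hs0 : s ≠ 0 := by omega
  obtain ⟨k, f, hf0, hf1, rfl⟩ : ∃ (k : ℕ) (f : ℝ), 0 ≤ f ∧ f < 1 ∧ T = k + f := by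
    refine ⟨⌊T⌋₊, T - ⌊T⌋₊, sub_nonneg.2 (Nat.floor_le hT), ?_, by ring⟩
    linarith [Nat.lt_floor_add_one T]
  rw [add_assoc, hubCost_add_natCast, hubCost_add_natCast, add_assoc]
  gcongr
  have hexp : (1 : ℝ) / (((s + 1 : ℕ) : ℝ) - 1) = (s : ℝ)⁻¹ := by push_cast; simp
  set u := f ^ ((s : ℝ)⁻¹) with hu
  have hu0 : 0 ≤ u := Real.rpow_nonneg hf0 _
  have hu1 : u ≤ 1 := Real.rpow_le_one hf0 hf1.le (by positivity)
  have huf : u ^ s = f := Real.rpow_inv_natCast_pow hf0 hs0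
  rw [hubCost_of_mem_Ico hf0 hf1, hexp, ← hu, ← huf]
  have hroot : ∀ t : ℝ, 0 ≤ t → (t ^ s) ^ ((s : ℝ)⁻¹) = t := fun t ht =>
    Real.pow_rpow_inv_natCast ht hs0
  have ha1' : a ^ s ≤ 1 := pow_le_one₀ ha ha1
  by_cases hlt : u ^ s + a ^ s < 1
  · rw [hubCost_of_mem_Ico (by positivity) hlt, hexp]
    rw [← hroot (u + a) (by positivity)]
    exact Real.rpow_le_rpow (by positivity) (pow_add_pow_le hu0 ha hs0) (by positivity)
  · push Not at hlt
    have h1 : 1 ≤ u + a := by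
      by_contra h
      push Not at h
      have h2 : (u + a) ^ s < 1 := pow_lt_one₀ (by positivity) h hs0
      linarith [pow_add_pow_le hu0 ha hs0]
    have h2 := pow_add_pow_le_one_add hu0 hu1 ha ha1 h1 s
    have h3 : u ^ s + a ^ s = (1 : ℕ) + (u ^ s + a ^ s - 1) := by push_cast; ring
    rw [h3, hubCost_add_natCast, hubCost_of_mem_Icc hr (by linarith) (by
      linarith), hexp]
    have h4 : (u ^ s + a ^ s - 1) ^ ((s : ℝ)⁻¹) ≤ u + a - 1 := by
      rw [← hroot (u + a - 1) (by linarith)]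
      exact Real.rpow_le_rpow (by linarith) (by linarith) (by positivity)
    push_cast
    linarith

/-- `hubCost` is the least total degree needed to achieve a given sum of powers of degrees. -/
lemma hubCost_sum_pow_le {ι : Type*} {s : ℕ} (hs : 2 ≤ s) (H : Finset ι) (y : ι → ℝ)
    (h0 : ∀ v ∈ H, 0 ≤ y v) (h1 : ∀ v ∈ H, y v ≤ 1) :
    hubCost (s + 1) (∑ v ∈ H, y v ^ s) ≤ ∑ v ∈ H, y v := by
  classical
  induction H using Finset.induction_on with
  | empty => simp [hubCost_zero (show 3 ≤ s + 1 by omega)]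
  | insert a H ha ih =>
    rw [Finset.sum_insert ha, Finset.sum_insert ha, add_comm (y a ^ s), add_comm (y a)]
    have h2 := ih (fun v hv => h0 v (Finset.mem_insert_of_mem hv))
      (fun v hv => h1 v (Finset.mem_insert_of_mem hv))
    have h3 := hubCost_add_pow_le hs (T := ∑ v ∈ H, y v ^ s)
      (Finset.sum_nonneg fun v hv => pow_nonneg (h0 v (Finset.mem_insert_of_mem hv)) s)
      (h0 a (Finset.mem_insert_self a H)) (h1 a (Finset.mem_insert_self a H))
    linarith

/-! ### The variational problem for the rate -/

lemma psiCost_nonneg {r : ℕ} (hr : 3 ≤ r) {δ c x : ℝ} (hδ : 0 < δ) (hc : 0 < c)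
    (hx : x ∈ Set.Icc (0 : ℝ) 1) : 0 ≤ psiCost r δ c x := by
  rw [psiCost_eq]
  have h1 : 0 ≤ 1 - x := by linarith [hx.2]
  have h2 := hx.1
  have h3 : 0 ≤ hubCost r (x * δ * c / r) := hubCost_nonneg hr (by positivity)
  positivity

lemma bddBelow_psiCost {r : ℕ} (hr : 3 ≤ r) {δ c : ℝ} (hδ : 0 < δ) (hc : 0 < c) :
    BddBelow (psiCost r δ c '' Set.Icc (0 : ℝ) 1) := by
  refine ⟨0, ?_⟩
  rintro _ ⟨x, hx, rfl⟩
  exact psiCost_nonneg hr hδ hc hx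

lemma phiCost_le {r : ℕ} (hr : 3 ≤ r) {δ c x : ℝ} (hδ : 0 < δ) (hc : 0 < c)
    (hx : x ∈ Set.Icc (0 : ℝ) 1) : phiCost r δ c ≤ psiCost r δ c x :=
  csInf_le (bddBelow_psiCost hr hδ hc) ⟨x, hx, rfl⟩

lemma le_phiCost {r : ℕ} {δ c a : ℝ} (h : ∀ x ∈ Set.Icc (0 : ℝ) 1, a ≤ psiCost r δ c x) :
    a ≤ phiCost r δ c := by
  refine le_csInf ⟨_, 0, by simp, rfl⟩ ?_
  rintro _ ⟨x, hx, rfl⟩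
  exact h x hx

/-- The `max` keeps the denominator away from zero, giving continuity on the whole plane and hence
continuity in c of the infimum over the compact interval. -/
lemma continuous_psiCost_uncurry {r : ℕ} (hr : 3 ≤ r) (δ : ℝ) {c₀ : ℝ} (hc : 0 < c₀) :
    Continuous fun q : ℝ × ℝ => psiCost r δ (max q.1 c₀) q.2 := by
  simp only [psiCost_eq]
  refine Continuous.add ?_ ?_
  · refine Continuous.div_const (Continuous.rpow_const (by fun_prop) fun _ => Or.inr ?_) _
    exact (two_div_pos hr).le
  · refine Continuous.div ((continuous_hubCost hr).comp (by fun_prop)) (by fun_prop) fun q => ?_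
    exact (lt_of_lt_of_le hc (le_max_right _ _)).ne'

lemma continuous_psiCost {r : ℕ} (hr : 3 ≤ r) (δ : ℝ) {c : ℝ} (hc : 0 < c) :
    Continuous (psiCost r δ c) := by
  have := (continuous_psiCost_uncurry hr δ hc).comp (Continuous.prodMk_right c)
  simpa [Function.comp_def] using this

lemma isLeast_phiCost {r : ℕ} (hr : 3 ≤ r) (δ : ℝ) {c : ℝ} (hc : 0 < c) :
    IsLeast (psiCost r δ c '' Set.Icc (0 : ℝ) 1) (phiCost r δ c) := by
  have hcomp : IsCompact (psiCost r δ c '' Set.Icc (0 : ℝ) 1) :=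
    isCompact_Icc.image (continuous_psiCost hr δ hc)
  exact hcomp.isLeast_sInf ⟨_, 0, by simp, rfl⟩

lemma tendsto_phiCost {r : ℕ} (hr : 3 ≤ r) (δ : ℝ) {c : ℝ} (hc : 0 < c) {u : ℕ → ℝ}
    (hu : Tendsto u atTop (𝓝 c)) :
    Tendsto (fun n => phiCost r δ (u n)) atTop (𝓝 (phiCost r δ c)) := by
  have h1 : Continuous fun c' : ℝ =>
      sInf ((fun x => psiCost r δ (max c' (c / 2)) x) '' Set.Icc (0 : ℝ) 1) :=
    IsCompact.continuous_sInf (f := fun c' x => psiCost r δ (max c' (c / 2)) x) isCompact_Icc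
      (continuous_psiCost_uncurry hr δ (half_pos hc))
  have h2 := (h1.tendsto c).comp hu
  have h3 : max c (c / 2) = c := max_eq_left (by linarith)
  simp only [h3] at h2
  refine h2.congr' ?_
  filter_upwards [hu.eventually (lt_mem_nhds (show c / 2 < c by linarith))] with n hn
  simp only [Function.comp_apply, max_eq_left hn.le]
  rfl

lemma psiCost_zero {r : ℕ} (hr : 3 ≤ r) (δ c : ℝ) :
    psiCost r δ c 0 = δ ^ ((2 : ℝ) / r) / 2 := by
  rw [psiCost_eq]
  simp [hubCost_zero hr]

lemma psiCost_one {r : ℕ} (hr : 3 ≤ r) (δ c : ℝ) :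
    psiCost r δ c 1 = hubCost r (δ * c / r) / c := by
  rw [psiCost_eq]
  simp [Real.zero_rpow (two_div_pos hr).ne']

/-- The normalised cost of the clique that complements `T` full hubs is concave in `T`. -/
lemma concaveOn_clique_add_hubs {r : ℕ} (hr : 3 ≤ r) (δ : ℝ) {c : ℝ} (hc : 0 < c) (a : ℝ) :
    ConcaveOn ℝ (Set.Icc a (δ * c / r)) fun T =>
      (δ - r * T / c) ^ ((2 : ℝ) / r) / 2 := by
  have hr0 : (0 : ℝ) < r := by
    have : 0 < r := by omega
    exact_mod_cast this
  refine ⟨convex_Icc _ _, ?_⟩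
  intro x hx y hy p q hp hq hpq
  have hmem : ∀ t ∈ Set.Icc a (δ * c / r), δ - r * t / c ∈ Set.Ici (0 : ℝ) := by
    intro t ht
    have h1 := ht.2
    rw [le_div_iff₀ hr0] at h1
    have h2 : r * t / c ≤ δ := by rw [div_le_iff₀ hc]; linarith
    exact sub_nonneg.2 h2
  have h := (Real.concaveOn_rpow (two_div_pos hr).le (two_div_le_one hr)).2
    (hmem x hx) (hmem y hy) hp hq hpq
  simp only [smul_eq_mul] at h ⊢
  have he : p * (δ - r * x / c) + q * (δ - r * y / c) = δ - r * (p * x + q * y) / c := by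
    have : δ = (p + q) * δ := by rw [hpq, one_mul]
    rw [eq_sub_iff_add_eq, ← sub_eq_zero]
    linear_combination δ * hpq
  rw [he] at h
  linarith

/-- Parametrise by the star mass T = xδc/r in [0, T₁]. Between consecutive integers the cost is
concave, so a minimum occurs at an integer or at T₁. At integers the cost agrees with a single
function G, concave on [0, T₁], so among them only 0 and ⌊T₁⌋ can be minimal. -/
lemma phiCost_eq_min {r : ℕ} (hr : 3 ≤ r) {δ c : ℝ} (hδ : 0 < δ) (hc : 0 < c) :
    phiCost r δ c =
        min (δ ^ ((2 : ℝ) / r) / 2)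
          (min
            (((⌊δ * c / r⌋ : ℝ) + Int.fract (δ * c / r) ^ ((1 : ℝ) / ((r : ℝ) - 1))) / c)
            ((⌊δ * c / r⌋ : ℝ) / c
              + ((r : ℝ) * Int.fract (δ * c / r) / c) ^ ((2 : ℝ) / r) / 2)) := by
  have hr0 : (0 : ℝ) < r := by
    have : 0 < r := by omega
    exact_mod_cast this
  set T₁ := δ * c / r with hT₁
  have hT₁0 : 0 < T₁ := by positivity
  obtain ⟨k, hk⟩ : ∃ k : ℕ, (⌊T₁⌋ : ℤ) = k := ⟨⌊T₁⌋.toNat, by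
    rw [Int.toNat_of_nonneg (Int.floor_nonneg.2 hT₁0.le)]⟩
  have hkT : (k : ℝ) ≤ T₁ := by
    have := Int.floor_le T₁
    rw [hk] at this
    exact_mod_cast this
  have hTk : T₁ < k + 1 := by
    have := Int.lt_floor_add_one T₁
    rw [hk] at this
    exact_mod_cast this
  set G : ℝ → ℝ := fun T => (δ - r * T / c) ^ ((2 : ℝ) / r) / 2 + T / c with hG
  have hrT : r * T₁ / c = δ := by rw [hT₁]; field_simp
  have hfr : r * Int.fract T₁ / c = δ - r * k / c := by
    rw [Int.fract, hk, mul_sub, sub_div, hrT]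
    push_cast
    ring
  have hG0 : G 0 = δ ^ ((2 : ℝ) / r) / 2 := by simp [hG]
  have hGk : (⌊T₁⌋ : ℝ) / c + ((r : ℝ) * Int.fract T₁ / c) ^ ((2 : ℝ) / r) / 2 = G k := by
    rw [hfr, hk, hG]
    push_cast
    ring
  have hψ : ∀ T, psiCost r δ c (T / T₁) =
      (δ - r * T / c) ^ ((2 : ℝ) / r) / 2 + hubCost r T / c := by
    intro T
    rw [psiCost_eq]
    have h1 : T / T₁ * δ * c / r = T := by
      rw [hT₁]; field_simp
    have h2 : δ * (1 - T / T₁) = δ - r * T / c := by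
      rw [hT₁]; field_simp
    rw [h1, h2]
  rw [hGk]
  change _ = min _ (min (hubCost r T₁ / c) _)
  refine le_antisymm ?_ ?_
  · refine le_min ?_ (le_min ?_ ?_)
    · rw [← psiCost_zero hr δ c]
      exact phiCost_le hr hδ hc (by simp)
    · rw [hT₁, ← psiCost_one hr δ c]
      exact phiCost_le hr hδ hc (by simp)
    · have h := hψ k
      rw [hubCost_natCast hr] at h
      change _ ≤ (δ - r * k / c) ^ ((2 : ℝ) / r) / 2 + k / c
      rw [← h]
      refine phiCost_le hr hδ hc ⟨by positivity, ?_⟩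
      rw [div_le_one hT₁0]
      exact hkT
  · refine le_phiCost fun x hx => ?_
    obtain ⟨T, rfl, hT0, hTT⟩ : ∃ T, x = T / T₁ ∧ 0 ≤ T ∧ T ≤ T₁ :=
      ⟨x * T₁, by field_simp, mul_nonneg hx.1 hT₁0.le, by nlinarith [hx.2]⟩
    rw [hψ]
    have hGconc : ConcaveOn ℝ (Set.Icc 0 T₁) G :=
      (concaveOn_clique_add_hubs hr δ hc 0).add
        ⟨convex_Icc _ _, fun x _ y _ p q _ _ _ => by simp only [smul_eq_mul]; ring_nf; rfl⟩
    have hGi : ∀ i : ℕ, i ≤ k → min (G 0) (G k) ≤ G i := by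
      intro i hi
      exact hGconc.min_le_of_mem_Icc ⟨le_rfl, hT₁0.le⟩ ⟨by positivity, hkT⟩
        ⟨by positivity, by exact_mod_cast hi⟩
    rw [← hG0]
    set j := ⌊T⌋₊ with hj
    have hjT : (j : ℝ) ≤ T := Nat.floor_le hT0
    have hTj : T < j + 1 := Nat.lt_floor_add_one T
    have hjk : j ≤ k := by
      have : (j : ℝ) < k + 1 := by linarith
      exact Nat.lt_succ_iff.1 (by exact_mod_cast this)
    set e := min ((j : ℝ) + 1) T₁ with he
    -- On [j, j + 1] the hub cost is replaced by its one-branch formula, which is concave on all of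
    -- [j, T₁].
    set F : ℝ → ℝ := fun t => (δ - r * t / c) ^ ((2 : ℝ) / r) / 2 +
      (j + (t - j) ^ ((1 : ℝ) / ((r : ℝ) - 1))) / c with hF
    have hFψ : ∀ t, (j : ℝ) ≤ t → t ≤ j + 1 → F t =
        (δ - r * t / c) ^ ((2 : ℝ) / r) / 2 + hubCost r t / c := by
      intro t h1 h2
      have h3 : t = j + (t - j) := by ring
      rw [hF]
      simp only
      congr 2
      conv_rhs => rw [h3]
      rw [hubCost_add_natCast, hubCost_of_mem_Icc hr (by linarith) (by linarith)]
    have hFconc : ConcaveOn ℝ (Set.Icc (j : ℝ) T₁) F := by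
      refine (concaveOn_clique_add_hubs hr δ hc j).add ⟨convex_Icc _ _, ?_⟩
      intro x hx y hy p q hp hq hpq
      have h := (Real.concaveOn_rpow (one_div_sub_one_pos hr).le
        (by linarith [one_div_sub_one_le hr])).2
        (show x - j ∈ Set.Ici (0 : ℝ) from sub_nonneg.2 hx.1)
        (show y - j ∈ Set.Ici (0 : ℝ) from sub_nonneg.2 hy.1) hp hq hpq
      simp only [smul_eq_mul] at h ⊢
      have h2 : p * (x - j) + q * (y - j) = p * x + q * y - j := by
        linear_combination (-(j : ℝ)) * hpq
      rw [h2] at h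
      rw [← mul_div_assoc, ← mul_div_assoc, ← add_div]
      refine div_le_div_of_nonneg_right ?_ hc.le
      have h3 : (j : ℝ) = p * j + q * j := by linear_combination (-(j : ℝ)) * hpq
      nlinarith
    have hje : (j : ℝ) ≤ T₁ := hjT.trans hTT
    have hmin := hFconc.min_le_of_mem_Icc (x := (j : ℝ)) (y := e) (z := T)
      ⟨le_rfl, hje⟩ ⟨le_min (by linarith) hje, min_le_right _ _⟩
      ⟨hjT, le_min hTj.le hTT⟩
    rw [← hFψ T hjT hTj.le]
    refine le_trans (le_min ?_ ?_) hmin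
    · rw [hFψ j le_rfl (by linarith), hubCost_natCast hr]
      refine le_trans ?_ (hGi j hjk)
      exact min_le_min le_rfl (min_le_right _ _)
    · rw [hFψ e (le_min (by linarith) hje) (min_le_left _ _)]
      rcases hjk.eq_or_lt with h | h
      · have h2 : e = T₁ := by rw [he, h]; exact min_eq_right hTk.le
        rw [h2, hrT, sub_self, Real.zero_rpow (two_div_pos hr).ne', zero_div, zero_add]
        exact (min_le_right _ _).trans (min_le_left _ _)
      · have h2 : e = ((j + 1 : ℕ) : ℝ) := by
          rw [he, Nat.cast_add, Nat.cast_one]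
          refine min_eq_left ?_
          have : ((j + 1 : ℕ) : ℝ) ≤ k := by exact_mod_cast h
          push_cast at this
          linarith
        rw [h2, hubCost_natCast hr]
        refine le_trans ?_ (hGi (j + 1) h)
        exact min_le_min le_rfl (min_le_right _ _)

/-- For small c no full hub fits, so the mixed candidate coincides with the clique. The pure hub
candidate is at least (δc/r)^(1/2)/c because 1/(r-1) ≤ 1/2, and this diverges. -/
lemma eventually_le_phiCost_of_tendsto_zero {r : ℕ} (hr : 3 ≤ r) {δ : ℝ} (hδ : 0 < δ)
    {u : ℕ → ℝ} (hu0 : ∀ᶠ n in atTop, 0 < u n) (hu : Tendsto u atTop (𝓝 0)) :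
    ∀ᶠ n in atTop, δ ^ ((2 : ℝ) / r) / 2 ≤ phiCost r δ (u n) := by
  have hr0 : (0 : ℝ) < r := by
    have : 0 < r := by omega
    exact_mod_cast this
  set A := δ ^ ((2 : ℝ) / r) / 2 with hA
  have hA0 : 0 < A := by positivity
  have h1 : ∀ᶠ n in atTop, u n < r / δ := hu.eventually (gt_mem_nhds (by positivity))
  have h2 : ∀ᶠ n in atTop, u n < δ / r / A ^ 2 := hu.eventually (gt_mem_nhds (by positivity))
  filter_upwards [hu0, h1, h2] with n h0 h1 h2
  rw [phiCost_eq_min hr hδ h0]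
  have hT0 : 0 ≤ δ * u n / r := by positivity
  have hT1 : δ * u n / r < 1 := by
    rw [div_lt_one hr0]
    rw [lt_div_iff₀ hδ] at h1
    linarith
  rw [Int.fract_eq_self.2 ⟨hT0, hT1⟩, Int.floor_eq_zero_iff.2 ⟨hT0, hT1⟩]
  refine le_min le_rfl (le_min ?_ ?_)
  · rw [Int.cast_zero, zero_add, le_div_iff₀ h0]
    have h3 : (δ * u n / r) ^ ((1 : ℝ) / 2) ≤ (δ * u n / r) ^ ((1 : ℝ) / ((r : ℝ) - 1)) :=
      Real.rpow_le_rpow_of_exponent_ge (by positivity) hT1.le (one_div_sub_one_le hr)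
    refine le_trans ?_ h3
    rw [← Real.sqrt_eq_rpow]
    refine Real.le_sqrt_of_sq_le ?_
    rw [lt_div_iff₀ (by positivity)] at h2
    have h4 := mul_le_mul_of_nonneg_left h2.le h0.le
    calc (A * u n) ^ 2 = u n * (u n * A ^ 2) := by ring
      _ ≤ u n * (δ / r) := h4
      _ = δ * u n / r := by ring
  · have h3 : (r : ℝ) * (δ * u n / r) / u n = δ := by field_simp
    rw [h3]
    simp [hA]

/-- Since `hubCost` dominates the identity and (1-x)^(2/r) ≥ 1-x, ψ is at least the convex
combination of the clique cost and δ/r. -/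
lemma min_le_phiCost {r : ℕ} (hr : 3 ≤ r) {δ c : ℝ} (hδ : 0 < δ) (hc : 0 < c) :
    min (δ ^ ((2 : ℝ) / r) / 2) (δ / r) ≤ phiCost r δ c := by
  refine le_phiCost fun x hx => ?_
  rw [psiCost_eq]
  have hx1 : 0 ≤ 1 - x := by linarith [hx.2]
  have h1 : x * δ / r ≤ hubCost r (x * δ * c / r) / c := by
    rw [le_div_iff₀ hc]
    refine le_trans (le_of_eq ?_) (le_hubCost hr _)
    ring
  have h2 : (1 - x) * δ ^ ((2 : ℝ) / r) ≤ (δ * (1 - x)) ^ ((2 : ℝ) / r) := by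
    rw [Real.mul_rpow hδ.le hx1, mul_comm]
    refine mul_le_mul_of_nonneg_left ?_ (by positivity)
    exact Real.self_le_rpow_of_le_one hx1 (by linarith [hx.1]) (two_div_le_one hr)
  have h3 := mul_le_mul_of_nonneg_left (min_le_left (δ ^ ((2 : ℝ) / r) / 2) (δ / r)) hx1
  have h4 := mul_le_mul_of_nonneg_left (min_le_right (δ ^ ((2 : ℝ) / r) / 2) (δ / r)) hx.1
  have h5 : x * (δ / r) = x * δ / r := by ring
  rw [h5] at h4
  linarith

lemma psiCost_one_le {r : ℕ} (hr : 3 ≤ r) {δ c : ℝ} (hc : 0 < c) :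
    psiCost r δ c 1 ≤ δ / r + 1 / c := by
  rw [psiCost_one hr, div_le_iff₀ hc]
  refine (hubCost_le hr _).trans (le_of_eq ?_)
  field_simp

/-! ### The structure of seeds -/

/-- Splitting the tail deviation between a hub part `z` and a clique part `y`. -/
lemma phiCost_le_of_add_ge {r : ℕ} (hr : 3 ≤ r) {δ c y z ε : ℝ} (hδ : 0 < δ) (hc : 0 < c)
    (hy : 0 ≤ y) (hz : 0 ≤ z) (hε : 0 ≤ ε) (h : δ - ε ≤ z + y) :
    phiCost r δ c ≤ y ^ ((2 : ℝ) / r) / 2 + hubCost r (z * c / r) / c +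
      ε ^ ((2 : ℝ) / r) / 2 := by
  have hr0 : (0 : ℝ) < r := by
    have : 0 < r := by omega
    exact_mod_cast this
  have hsub := Real.rpow_add_le_add_rpow hy hε (two_div_pos hr).le (two_div_le_one hr)
  -- For z ≤ δ take x = z/δ and use subadditivity of t^(2/r) to absorb ε. For z ≥ δ hubs alone
  -- suffice, so x = 1.
  rcases le_total z δ with hzδ | hzδ
  · have hx : z / δ ∈ Set.Icc (0 : ℝ) 1 := ⟨by positivity, (div_le_one hδ).2 hzδ⟩
    refine (phiCost_le hr hδ hc hx).trans ?_
    rw [psiCost_eq]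
    have h1 : z / δ * δ * c / r = z * c / r := by field_simp
    have h2 : δ * (1 - z / δ) = δ - z := by field_simp
    rw [h1, h2]
    have h3 : (δ - z) ^ ((2 : ℝ) / r) ≤ (y + ε) ^ ((2 : ℝ) / r) :=
      Real.rpow_le_rpow (by linarith) (by linarith) (two_div_pos hr).le
    linarith
  · refine (phiCost_le hr hδ hc (x := 1) (by simp)).trans ?_
    rw [psiCost_one hr]
    have h1 : hubCost r (δ * c / r) / c ≤ hubCost r (z * c / r) / c := by
      refine div_le_div_of_nonneg_right (hubCost_mono hr ?_) hc.le
      gcongr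
    have h2 : 0 ≤ y ^ ((2 : ℝ) / r) := by positivity
    have h3 : 0 ≤ ε ^ ((2 : ℝ) / r) := by positivity
    linarith

/-- Converts the edge scale Q = n²p^s to the clique scale: Q^(r/2) is asymptotically r!·E[X]. -/
lemma rpow_half_eq {n s : ℕ} {p : ℝ} (hp : 0 < p) :
    ((n : ℝ) ^ 2 * p ^ s) ^ (((s + 1 : ℕ) : ℝ) / 2) =
      (n : ℝ) ^ (s + 1) * p ^ (s + 1).choose 2 := by
  rw [Real.mul_rpow (by positivity) (by positivity), ← Real.rpow_natCast (n : ℝ) 2,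
    ← Real.rpow_mul (by positivity), ← Real.rpow_natCast p s, ← Real.rpow_mul hp.le]
  have h1 : ((2 : ℕ) : ℝ) * (((s + 1 : ℕ) : ℝ) / 2) = ((s + 1 : ℕ) : ℝ) := by push_cast; ring
  have h2 : (s : ℝ) * (((s + 1 : ℕ) : ℝ) / 2) = (((s + 1).choose 2 : ℕ) : ℝ) := by
    rw [Nat.cast_choose_two]
    push_cast
    ring
  rw [h1, h2, Real.rpow_natCast, Real.rpow_natCast]

open Classical in
/-- The vertices of degree at least `D`. -/
def hubs {V : Type*} [Fintype V] (U : Finset (Sym2 V)) (D : ℝ) : Finset V :=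
  Finset.univ.filter fun v => D ≤ (nbrs U v).card

lemma mem_hubs {V : Type*} [Fintype V] {U : Finset (Sym2 V)} {D : ℝ} {v : V} :
    v ∈ hubs U D ↔ D ≤ (nbrs U v).card := by
  classical
  rw [hubs, Finset.mem_filter]
  simp

/-- Below the threshold, d^s ≤ D^(s-1) d, and the degrees sum to at most 2|U|. -/
lemma sum_pow_card_nbrs_le {V : Type*} [Fintype V] {s : ℕ} (hs : 1 ≤ s) (U : Finset (Sym2 V))
    {D : ℝ} (hD : 0 ≤ D) :
    ∑ v, ((nbrs U v).card : ℝ) ^ s ≤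
      ∑ v ∈ hubs U D, ((nbrs U v).card : ℝ) ^ s + D ^ (s - 1) * (2 * U.card) := by
  classical
  rw [← Finset.sum_add_sum_compl (hubs U D)]
  refine add_le_add le_rfl ?_
  have h1 : ∀ v ∈ (hubs U D)ᶜ, ((nbrs U v).card : ℝ) ^ s ≤ D ^ (s - 1) * (nbrs U v).card := by
    intro v hv
    rw [Finset.mem_compl, mem_hubs, not_le] at hv
    have h2 : ((nbrs U v).card : ℝ) ^ s = ((nbrs U v).card : ℝ) ^ (s - 1) * (nbrs U v).card := by
      rw [← pow_succ]; congr 1; omega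
    rw [h2]
    gcongr
  refine (Finset.sum_le_sum h1).trans ?_
  rw [← Finset.mul_sum]
  have h3 : (∑ v ∈ (hubs U D)ᶜ, ((nbrs U v).card : ℝ)) ≤ 2 * U.card := by
    exact_mod_cast sum_card_nbrs_le U _
  gcongr

/-- Using the edges at the hubs rather than all of U lets the number of hubs be bounded by |A|
alone, as `hubFamily` requires. -/
lemma card_hubs_mul_le {V : Type*} [Fintype V] (U : Finset (Sym2 V)) (D : ℝ) :
    ((hubs U D).card : ℝ) * D ≤ 2 * (touching U (hubs U D)).card := by
  calc ((hubs U D).card : ℝ) * D = ∑ v ∈ hubs U D, D := by rw [Finset.sum_const, nsmul_eq_mul]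
    _ ≤ ∑ v ∈ hubs U D, ((nbrs U v).card : ℝ) :=
        Finset.sum_le_sum fun v hv => mem_hubs.1 hv
    _ = ∑ v ∈ hubs U D, ((nbrs (touching U (hubs U D)) v).card : ℝ) :=
        Finset.sum_congr rfl fun v hv => by rw [nbrs_touching U hv]
    _ ≤ 2 * (touching U (hubs U D)).card := by
        exact_mod_cast sum_card_nbrs_le (touching U (hubs U D)) (hubs U D)

lemma card_hubs_le {n : ℕ} (hn : 0 < n) {Λ Q : ℝ} (hΛ : 1 ≤ Λ) (U : Finset (Sym2 (Fin n)))
    (hU : 2 * (U.card : ℝ) ≤ Λ * Q) :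
    ((hubs U (n / Λ ^ 2)).card : ℝ) ≤ Λ ^ 3 * Q / n := by
  have hn' : (0 : ℝ) < n := by exact_mod_cast hn
  have hΛ0 : 0 < Λ := by linarith
  have h3 := card_hubs_mul_le U (n / Λ ^ 2)
  have h4 : ((touching U (hubs U (n / Λ ^ 2))).card : ℝ) ≤ U.card := by
    exact_mod_cast Finset.card_le_card (touching_subset U _)
  rw [le_div_iff₀ hn']
  have h5 : ((hubs U (n / Λ ^ 2)).card : ℝ) * (n / Λ ^ 2) ≤ Λ * Q := by linarith
  rw [← mul_div_assoc, div_le_iff₀ (by positivity)] at h5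
  linarith [show Λ * Q * Λ ^ 2 = Λ ^ 3 * Q by ring]

/-- The edges inside the hub set, which the degree sum counts twice, are negligible on the scale Q.
-/
lemma card_hubs_sq_le {n s : ℕ} (hn : 0 < n) (hs : 1 ≤ s) {p Λ : ℝ} (hp : 0 < p) (hp1 : p ≤ 1)
    (hΛ : 1 ≤ Λ) (U : Finset (Sym2 (Fin n)))
    (hU : 2 * (U.card : ℝ) ≤ Λ * ((n : ℝ) ^ 2 * p ^ s)) :
    ((hubs U (n / Λ ^ 2)).card : ℝ) ^ 2 ≤ Λ ^ 6 * p * ((n : ℝ) ^ 2 * p ^ s) := by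
  have hn' : (0 : ℝ) < n := by exact_mod_cast hn
  have hΛ0 : 0 < Λ := by linarith
  have h := card_hubs_le hn hΛ U hU
  calc ((hubs U (n / Λ ^ 2)).card : ℝ) ^ 2 ≤ (Λ ^ 3 * ((n : ℝ) ^ 2 * p ^ s) / n) ^ 2 := by gcongr
    _ = Λ ^ 6 * p ^ s * ((n : ℝ) ^ 2 * p ^ s) := by field_simp
    _ ≤ Λ ^ 6 * p * ((n : ℝ) ^ 2 * p ^ s) := by
      gcongr
      exact pow_le_of_le_one hp.le hp1 (by omega)

/-- This inverts `homCount_complete_le`: normalised clique mass y needs at least y^(2/r)Q/2 edges,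
the clique term of ψ. -/
lemma rpow_two_div_mul_le_card {n s : ℕ} (hn : 0 < n) (hs : 2 ≤ s) {p : ℝ} (hp : 0 < p)
    (B : Finset (Sym2 (Fin n))) :
    ((homCount (pairsIn (Finset.univ : Finset (Fin (s + 1)))) B : ℝ) /
      ((n : ℝ) ^ (s + 1) * p ^ (s + 1).choose 2)) ^ ((2 : ℝ) / (s + 1 : ℕ)) *
      ((n : ℝ) ^ 2 * p ^ s) ≤ 2 * B.card := by
  have hn' : (0 : ℝ) < n := by exact_mod_cast hn
  have : Nonempty (Fin n) := ⟨⟨0, hn⟩⟩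
  have hr : 3 ≤ s + 1 := by omega
  rw [← rpow_half_eq hp]
  set Q := (n : ℝ) ^ 2 * p ^ s with hQ
  have hQ0 : 0 < Q := by positivity
  rw [← le_div_iff₀ hQ0]
  have h3 : (homCount (pairsIn (Finset.univ : Finset (Fin (s + 1)))) B : ℝ) /
      Q ^ (((s + 1 : ℕ) : ℝ) / 2) ≤ (2 * (B.card : ℝ) / Q) ^ (((s + 1 : ℕ) : ℝ) / 2) := by
    rw [Real.div_rpow (by positivity) hQ0.le]
    exact div_le_div_of_nonneg_right (homCount_complete_le (by omega) B) (by positivity)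
  have h4 := Real.rpow_le_rpow (div_nonneg (Nat.cast_nonneg _) (by positivity)) h3
    (two_div_pos hr).le
  rw [← Real.rpow_mul (by positivity)] at h4
  have h5 : ((s + 1 : ℕ) : ℝ) / 2 * (2 / ((s + 1 : ℕ) : ℝ)) = 1 := by
    have : ((s + 1 : ℕ) : ℝ) ≠ 0 := by positivity
    field_simp
  rwa [h5, Real.rpow_one] at h4

/-- The stars centred outside the hubs are negligible. -/
lemma sum_pow_card_nbrs_div_le {n s : ℕ} (hn : 0 < n) (hs : 2 ≤ s) {p Λ : ℝ} (hp : 0 < p)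
    (hΛ : 1 ≤ Λ) (U : Finset (Sym2 (Fin n)))
    (hU : 2 * (U.card : ℝ) ≤ Λ * ((n : ℝ) ^ 2 * p ^ s)) :
    (∑ v, ((nbrs U v).card : ℝ) ^ s) / ((n : ℝ) ^ (s + 1) * p ^ s) ≤
      (∑ v ∈ hubs U (n / Λ ^ 2), ((nbrs U v).card : ℝ) ^ s) / ((n : ℝ) ^ (s + 1) * p ^ s) +
        1 / Λ := by
  have hn' : (0 : ℝ) < n := by exact_mod_cast hn
  have hΛ0 : 0 < Λ := by linarith
  have h := sum_pow_card_nbrs_le (by omega : 1 ≤ s) U (D := n / Λ ^ 2) (by positivity)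
  rw [div_add' _ _ _ (by positivity)]
  refine div_le_div_of_nonneg_right (h.trans ?_) (by positivity)
  rw [add_le_add_iff_left]
  -- The condition s ≥ 2 enters here: Λ·(1/Λ²)^(s-1) ≤ 1/Λ.
  obtain ⟨m, rfl⟩ : ∃ m, s = m + 2 := ⟨s - 2, by omega⟩
  have h1 : m + 2 - 1 = m + 1 := by omega
  rw [h1]
  calc ((n : ℝ) / Λ ^ 2) ^ (m + 1) * (2 * U.card) ≤
      ((n : ℝ) / Λ ^ 2) ^ (m + 1) * (Λ * ((n : ℝ) ^ 2 * p ^ (m + 2))) := by gcongr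
    _ = 1 / Λ * ((n : ℝ) ^ (m + 2 + 1) * p ^ (m + 2)) * (1 / Λ ^ 2) ^ m := by
        rw [div_pow, div_pow]
        field_simp
        ring
    _ ≤ 1 / Λ * ((n : ℝ) ^ (m + 2 + 1) * p ^ (m + 2)) * 1 := by
        gcongr
        refine pow_le_one₀ (by positivity) ?_
        rw [div_le_one (by positivity)]
        exact one_le_pow₀ hΛ
    _ = _ := mul_one _

/-- The cliques meeting the hubs are negligible. -/
lemma homCount_div_le {n s : ℕ} (hn : 0 < n) (hs : 2 ≤ s) {p Λ : ℝ} (hp : 0 < p) (hp1 : p ≤ 1)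
    (hΛ : 1 ≤ Λ) (U : Finset (Sym2 (Fin n)))
    (hU : 2 * (U.card : ℝ) ≤ Λ * ((n : ℝ) ^ 2 * p ^ s)) :
    (homCount (pairsIn (Finset.univ : Finset (Fin (s + 1)))) U : ℝ) /
        ((n : ℝ) ^ (s + 1) * p ^ (s + 1).choose 2) ≤
      (homCount (pairsIn (Finset.univ : Finset (Fin (s + 1))))
        (U \ touching U (hubs U (n / Λ ^ 2))) : ℝ) /
          ((n : ℝ) ^ (s + 1) * p ^ (s + 1).choose 2) + (s + 1) * (Λ ^ (s + 4) * p) := by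
  have hn' : (0 : ℝ) < n := by exact_mod_cast hn
  have hΛ0 : 0 < Λ := by linarith
  have : Nonempty (Fin n) := ⟨⟨0, hn⟩⟩
  set Q := (n : ℝ) ^ 2 * p ^ s with hQ
  have hQ0 : 0 < Q := by positivity
  set H := hubs U (n / Λ ^ 2) with hH
  have h1 : (homCount (pairsIn (Finset.univ : Finset (Fin (s + 1)))) U : ℝ) ≤
      homCount (pairsIn (Finset.univ : Finset (Fin (s + 1)))) (U \ touching U H) +
        (s + 1) * (H.card * homCount (pairsIn (Finset.univ : Finset (Fin s))) U) := by
    exact_mod_cast homCount_le_sdiff_touching (s := s) U H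
  rw [div_add' _ _ _ (by positivity)]
  refine div_le_div_of_nonneg_right (h1.trans ?_) (by positivity)
  rw [add_le_add_iff_left, mul_assoc]
  refine mul_le_mul_of_nonneg_left ?_ (by positivity)
  have h2 : (H.card : ℝ) ≤ Λ ^ 3 * Q / n := card_hubs_le hn hΛ U hU
  have h3 : (homCount (pairsIn (Finset.univ : Finset (Fin s))) U : ℝ) ≤
      Λ ^ s * Q ^ ((s : ℝ) / 2) := by
    refine (homCount_complete_le hs U).trans ?_
    have h4 : (2 * (U.card : ℝ)) ^ ((s : ℝ) / 2) ≤ (Λ * Q) ^ ((s : ℝ) / 2) :=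
      Real.rpow_le_rpow (by positivity) hU (by positivity)
    refine h4.trans ?_
    rw [Real.mul_rpow hΛ0.le hQ0.le]
    gcongr
    rw [← Real.rpow_natCast Λ s]
    refine Real.rpow_le_rpow_of_exponent_le hΛ ?_
    have : (0 : ℝ) ≤ s := by positivity
    linarith
  -- There are O(Q/n) hubs and O(Q^(s/2)) copies of K_s, up to powers of Λ. Since Q^(1/2) ≤ np, the
  -- product is a factor p below the clique scale.
  have h6 : Q * Q ^ ((s : ℝ) / 2) ≤ n * ((n : ℝ) ^ (s + 1) * p ^ (s + 1).choose 2 * p) := by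
    rw [← rpow_half_eq hp, ← hQ]
    have h7 : Q * Q ^ ((s : ℝ) / 2) = Q ^ ((1 : ℝ) / 2) * Q ^ (((s + 1 : ℕ) : ℝ) / 2) := by
      rw [← Real.rpow_one_add' hQ0.le (by positivity), ← Real.rpow_add hQ0]
      congr 1
      push_cast
      ring
    have h8 : Q ^ ((1 : ℝ) / 2) ≤ n * p := by
      rw [← Real.sqrt_eq_rpow]
      refine Real.sqrt_le_iff.2 ⟨by positivity, ?_⟩
      rw [mul_pow, hQ]
      exact mul_le_mul_of_nonneg_left (pow_le_pow_of_le_one hp.le hp1 hs) (by positivity)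
    rw [h7]
    calc _ ≤ n * p * Q ^ (((s + 1 : ℕ) : ℝ) / 2) := by gcongr
      _ = _ := by ring
  calc (H.card : ℝ) * homCount (pairsIn (Finset.univ : Finset (Fin s))) U ≤
      (Λ ^ 3 * Q / n) * (Λ ^ s * Q ^ ((s : ℝ) / 2)) := by gcongr
    _ = Λ ^ (s + 3) / n * (Q * Q ^ ((s : ℝ) / 2)) := by rw [pow_add]; ring
    _ ≤ Λ ^ (s + 3) / n * (n * ((n : ℝ) ^ (s + 1) * p ^ (s + 1).choose 2 * p)) := by gcongr
    _ = Λ ^ (s + 3) * p * ((n : ℝ) ^ (s + 1) * p ^ (s + 1).choose 2) := by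
        field_simp
    _ ≤ Λ ^ (s + 4) * p * ((n : ℝ) ^ (s + 1) * p ^ (s + 1).choose 2) := by
        have := pow_le_pow_right₀ hΛ (by omega : s + 3 ≤ s + 4)
        gcongr

lemma card_nbrs_le {n : ℕ} (U : Finset (Sym2 (Fin n))) (v : Fin n) : (nbrs U v).card ≤ n := by
  simpa using Finset.card_le_univ (nbrs U v)

/-- The number of edges at the hubs. -/
lemma hubCost_le_touching {n s : ℕ} (hn : 0 < n) (hs : 2 ≤ s) (U : Finset (Sym2 (Fin n)))
    (H : Finset (Fin n)) :
    (n : ℝ) * hubCost (s + 1) ((∑ v ∈ H, ((nbrs U v).card : ℝ) ^ s) / (n : ℝ) ^ s) ≤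
      (touching U H).card + (H.card : ℝ) ^ 2 := by
  have hn' : (0 : ℝ) < n := by exact_mod_cast hn
  have h := hubCost_sum_pow_le hs H (fun v => ((nbrs U v).card : ℝ) / n)
    (fun v _ => by positivity)
    (fun v _ => by
      rw [div_le_one hn']
      exact_mod_cast card_nbrs_le U v)
  simp only [div_pow] at h
  rw [← Finset.sum_div, ← Finset.sum_div] at h
  calc _ ≤ (n : ℝ) * ((∑ v ∈ H, ((nbrs U v).card : ℝ)) / n) := by gcongr
    _ = ∑ v ∈ H, ((nbrs U v).card : ℝ) := mul_div_cancel₀ _ hn'.ne'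
    _ ≤ _ := by exact_mod_cast sum_card_nbrs_le_touching U H

/-- `condMean_excess_le` divided by n^r p^(r choose 2). The falling factorial appears because
r!·E[X] contains it instead of n^r. -/
lemma le_stars_add_cliques_of_seed {n s : ℕ} (hn : 0 < n) (hs : 2 ≤ s) {p Λ δ ε : ℝ}
    (hp : 0 < p) (hp1 : p ≤ 1) (hΛ : 1 ≤ Λ) (U : Finset (Sym2 (Fin n)))
    (hU : 2 * (U.card : ℝ) ≤ Λ * ((n : ℝ) ^ 2 * p ^ s))
    (hseed : (1 + δ - ε) * (n.choose (s + 1) * p ^ (s + 1).choose 2) < condMean (s + 1) n p U) :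
    (δ - ε) * n.descFactorial (s + 1) / (n : ℝ) ^ (s + 1) ≤
      (s + 1) * ((∑ v, ((nbrs U v).card : ℝ) ^ s) / ((n : ℝ) ^ (s + 1) * p ^ s)) +
        (homCount (pairsIn (Finset.univ : Finset (Fin (s + 1)))) U : ℝ) /
          ((n : ℝ) ^ (s + 1) * p ^ (s + 1).choose 2) +
        2 ^ (s + 1).choose 2 * (Λ ^ (s + 1) * p) := by
  have hn' : (0 : ℝ) < n := by exact_mod_cast hn
  have h1 := condMean_excess_le hn (by omega : 0 < s) hp hp1 hΛ U
    (by rw [mul_assoc, mul_comm (p ^ s)]; exact hU)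
  have h2 : ((s + 1).factorial : ℝ) * n.choose (s + 1) = n.descFactorial (s + 1) := by
    rw [Nat.descFactorial_eq_factorial_mul_choose, Nat.cast_mul]
  have h3 : (δ - ε) * n.descFactorial (s + 1) * p ^ (s + 1).choose 2 ≤
      (s + 1).factorial *
        (condMean (s + 1) n p U - n.choose (s + 1) * p ^ (s + 1).choose 2) := by
    rw [← h2]
    have h4 : (0 : ℝ) < (s + 1).factorial := by exact_mod_cast Nat.factorial_pos _
    have h5 := mul_le_mul_of_nonneg_left hseed.le h4.le
    linarith
  have h4 := h3.trans h1
  rw [mul_comm (p ^ (s + 1).choose 2)] at h4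
  have h5 := le_of_mul_le_mul_right h4 (by positivity)
  rw [div_le_iff₀ (by positivity)]
  refine h5.trans (le_of_eq ?_)
  rw [inv_pow, inv_pow]
  field_simp

/-- A sparse graph that raises the expected clique count substantially contains a set of edges
at hubs and a disjoint clique-core whose total number of edges is at least the optimal cost. -/
lemma exists_hub_core_of_seed {n s : ℕ} (hn : 0 < n) (hs : 2 ≤ s) {p Λ δ ε d : ℝ} (hp : 0 < p)
    (hp1 : p ≤ 1) (hΛ : 1 ≤ Λ) (hδ : 0 < δ) (hε : 0 < ε)
    (hdesc : δ - 2 * ε ≤ (δ - ε) * n.descFactorial (s + 1) / (n : ℝ) ^ (s + 1))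
    (herr : (s + 1) / Λ + (s + 1 + 2 ^ (s + 1).choose 2) * (Λ ^ (s + 6) * p) ≤ ε)
    (hd : ((s + 1 : ℕ) : ℝ) ^ 2 * d ^ (s - 1) ≤
      ε * ((n : ℝ) ^ (s + 1) * p ^ (s + 1).choose 2) / (Λ * ((n : ℝ) ^ 2 * p ^ s)))
    (U : Finset (Sym2 (Fin n)))
    (hU : 2 * (U.card : ℝ) ≤ Λ * ((n : ℝ) ^ 2 * p ^ s))
    (hseed : (1 + δ - ε) * (n.choose (s + 1) * p ^ (s + 1).choose 2) < condMean (s + 1) n p U) :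
    ∃ A B : Finset (Sym2 (Fin n)), A ⊆ U ∧ B ⊆ U ∧ Disjoint A B ∧
      (∃ H : Finset (Fin n), (H.card : ℝ) * n ≤ 2 * A.card * Λ ^ 2 ∧
        A ⊆ touching Finset.univ H) ∧
      ((covered B).card : ℝ) * d ≤ 2 * B.card ∧
      (phiCost (s + 1) δ (n * p ^ s) - (4 * ε) ^ ((2 : ℝ) / (s + 1 : ℕ)) / 2 - Λ ^ 6 * p) *
        ((n : ℝ) ^ 2 * p ^ s) ≤ A.card + B.card := by
  classical
  have hr : 3 ≤ s + 1 := by omega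
  have hn' : (0 : ℝ) < n := by exact_mod_cast hn
  have hΛ0 : 0 < Λ := by linarith
  have : Nonempty (Fin n) := ⟨⟨0, hn⟩⟩
  set Q := (n : ℝ) ^ 2 * p ^ s with hQ
  have hQ0 : 0 < Q := by positivity
  set P := (n : ℝ) ^ (s + 1) * p ^ (s + 1).choose 2 with hP
  have hP0 : 0 < P := by positivity
  set H := hubs U (n / Λ ^ 2) with hH
  set A := touching U H with hA
  set E := pairsIn (Finset.univ : Finset (Fin (s + 1))) with hE
  -- Pruning at most ΛQ edges at this rate loses at most εP cliques.
  set l := ε * P / (Λ * Q) with hl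
  obtain ⟨B, hBsub, hB1, hB2⟩ := exists_core E (U \ A) l (by positivity)
  have hBU : B ⊆ U := hBsub.trans Finset.sdiff_subset
  set z := (s + 1) * ((∑ v ∈ H, ((nbrs U v).card : ℝ) ^ s) / ((n : ℝ) ^ (s + 1) * p ^ s)) with hz
  set y := (homCount E B : ℝ) / P with hy
  have hz0 : 0 ≤ z := mul_nonneg (by positivity)
    (div_nonneg (Finset.sum_nonneg fun v _ => by positivity) (by positivity))
  have hy0 : 0 ≤ y := div_nonneg (Nat.cast_nonneg _) hP0.le
  -- Of the loss 4ε, 2ε comes from the seed threshold and the falling factorial, ε from the errors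
  -- in `herr`, and ε from passing to the core.
  have hzy : δ - 4 * ε ≤ z + y := by
    have h6 := le_stars_add_cliques_of_seed hn hs hp hp1 hΛ U hU hseed
    have h7 := sum_pow_card_nbrs_div_le hn hs hp hΛ U hU
    have h8 := homCount_div_le hn hs hp hp1 hΛ U hU
    have h9 : (homCount E (U \ A) : ℝ) / P ≤ y + ε := by
      rw [hy, div_add' _ _ _ hP0.ne']
      refine div_le_div_of_nonneg_right (hB1.trans ?_) hP0.le
      rw [add_le_add_iff_left]
      have h10 : ((U \ A).card : ℝ) ≤ U.card := by
        exact_mod_cast Finset.card_le_card Finset.sdiff_subset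
      have h11 : ((U \ A).card : ℝ) ≤ Λ * Q := by
        have : (0 : ℝ) ≤ U.card := by positivity
        linarith
      calc l * ((U \ A).card : ℝ) ≤ l * (Λ * Q) := by gcongr
        _ = ε * P := by rw [hl]; field_simp
    have h12 := mul_le_mul_of_nonneg_left h7 (show (0 : ℝ) ≤ s + 1 by positivity)
    rw [mul_add, ← hH, ← hz, mul_one_div] at h12
    have h13 : Λ ^ (s + 1) * p ≤ Λ ^ (s + 6) * p :=
      mul_le_mul_of_nonneg_right (pow_le_pow_right₀ hΛ (by omega)) hp.le
    have h14 : Λ ^ (s + 4) * p ≤ Λ ^ (s + 6) * p :=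
      mul_le_mul_of_nonneg_right (pow_le_pow_right₀ hΛ (by omega)) hp.le
    have h15 := mul_le_mul_of_nonneg_left h13
      (show (0 : ℝ) ≤ 2 ^ (s + 1).choose 2 by positivity)
    have h16 := mul_le_mul_of_nonneg_left h14 (show (0 : ℝ) ≤ s + 1 by positivity)
    linarith
  refine ⟨A, B, touching_subset U H, hBU, ?_, ⟨H, ?_, ?_⟩, ?_, ?_⟩
  · exact Finset.disjoint_of_subset_right hBsub Finset.disjoint_sdiff
  · have h1 := card_hubs_mul_le U (n / Λ ^ 2)
    rw [← hH, ← hA, ← mul_div_assoc, div_le_iff₀ (by positivity)] at h1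
    exact h1
  · intro e he
    exact mem_touching.2 ⟨Finset.mem_univ _, (mem_touching.1 he).2⟩
  · exact card_covered_mul_le hs B d l hd hB2
  · have hc : 0 < n * p ^ s := by positivity
    have h1 := phiCost_le_of_add_ge hr hδ hc hy0 hz0 (by positivity : 0 ≤ 4 * ε) hzy
    have h2 : y ^ ((2 : ℝ) / (s + 1 : ℕ)) * Q ≤ 2 * B.card := rpow_two_div_mul_le_card hn hs hp B
    -- The normalisation of z makes z·np^s/r exactly the sum of s-th powers of the relative degrees
    -- deg/n.
    have h6 : hubCost (s + 1) (z * (n * p ^ s) / (s + 1 : ℕ)) / (n * p ^ s) * Q ≤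
        A.card + (H.card : ℝ) ^ 2 := by
      have h7 := hubCost_le_touching hn hs U H
      have h8 : z * (n * p ^ s) / (s + 1 : ℕ) =
          (∑ v ∈ H, ((nbrs U v).card : ℝ) ^ s) / (n : ℝ) ^ s := by
        rw [hz]
        generalize ∑ v ∈ H, ((nbrs U v).card : ℝ) ^ s = S
        clear * - hn' hp
        push_cast
        field_simp
        ring
      rw [h8, hQ]
      refine le_trans (le_of_eq ?_) h7
      generalize hubCost (s + 1) ((∑ v ∈ H, ((nbrs U v).card : ℝ) ^ s) / (n : ℝ) ^ s) = S
      clear * - hn' hp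
      field_simp
    have h9 : (H.card : ℝ) ^ 2 ≤ Λ ^ 6 * p * Q :=
      card_hubs_sq_le hn (by omega) hp hp1 hΛ U hU
    have h11 := mul_le_mul_of_nonneg_right h1 hQ0.le
    rw [add_mul, add_mul] at h11
    have h12 : y ^ ((2 : ℝ) / (s + 1 : ℕ)) / 2 * Q ≤ B.card := by linarith
    rw [sub_mul, sub_mul]
    linarith

/-! ### Entropy estimates and the union bound -/

lemma pow_le_exp_mul_log {n : ℕ} (K : ℕ) {x : ℝ} (hK : (K : ℝ) ≤ x) :
    ((n : ℝ) + 1) ^ K ≤ Real.exp (x * Real.log (n + 1)) := by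
  have h1 : (0 : ℝ) < (n : ℝ) + 1 := by positivity
  have h2 : ((n : ℝ) + 1) ^ K = Real.exp (K * Real.log (n + 1)) := by
    rw [Real.exp_nat_mul, Real.exp_log h1]
  rw [h2]
  refine Real.exp_le_exp.2 (mul_le_mul_of_nonneg_right hK (Real.log_nonneg ?_))
  have : (0 : ℝ) ≤ n := by positivity
  linarith

lemma exp_one_mul_pow_le {T m : ℕ} {y : ℝ} (hy : 0 < y) (hT : (T : ℝ) ≤ m * y) :
    (Real.exp 1 * T / m) ^ m ≤ Real.exp (m * (1 + Real.log y)) := by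
  rcases Nat.eq_zero_or_pos m with rfl | hm
  · simp
  · have hm' : (0 : ℝ) < m := by exact_mod_cast hm
    rw [Real.exp_nat_mul, Real.exp_add, Real.exp_log hy]
    refine pow_le_pow_left₀ (by positivity) ?_ m
    rw [div_le_iff₀ hm', mul_assoc]
    refine mul_le_mul_of_nonneg_left ?_ (Real.exp_pos 1).le
    linarith

open Classical in
/-- The edge sets all of whose edges meet a small set of vertices. -/
def hubFamily (n : ℕ) (R : ℝ) : Finset (Finset (Sym2 (Fin n))) :=
  Finset.univ.filter fun A => ∃ H : Finset (Fin n), (H.card : ℝ) * n ≤ 2 * A.card * R ∧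
    A ⊆ touching Finset.univ H

open Classical in
/-- The edge sets with few edges and even fewer covered vertices. -/
def coreFamily (n : ℕ) (M d : ℝ) : Finset (Finset (Sym2 (Fin n))) :=
  Finset.univ.filter fun B => Loopless B ∧ (B.card : ℝ) ≤ M ∧
    ((covered B).card : ℝ) * d ≤ 2 * B.card

lemma mem_hubFamily {n : ℕ} {R : ℝ} {A : Finset (Sym2 (Fin n))} :
    A ∈ hubFamily n R ↔ ∃ H : Finset (Fin n), (H.card : ℝ) * n ≤ 2 * A.card * R ∧
      A ⊆ touching Finset.univ H := by
  classical
  rw [hubFamily, Finset.mem_filter]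
  simp

lemma mem_coreFamily {n : ℕ} {M d : ℝ} {B : Finset (Sym2 (Fin n))} :
    B ∈ coreFamily n M d ↔ Loopless B ∧ (B.card : ℝ) ≤ M ∧
      ((covered B).card : ℝ) * d ≤ 2 * B.card := by
  classical
  rw [coreFamily, Finset.mem_filter]
  simp

/-- There are at most K ≤ 2mR/n hubs to choose, then m edges among at most Kn ≤ 2mR pairs. The
second choice costs only 1 + log(2R) per edge. -/
lemma card_hubFamily_le {n : ℕ} (hn : 0 < n) {R : ℝ} (hR : 0 < R) (m : ℕ) :
    (((hubFamily n R).filter fun A => A.card = m).card : ℝ) ≤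
      Real.exp (m * (2 * R * Real.log (n + 1) / n + (1 + Real.log (2 * R)))) := by
  classical
  have hn' : (0 : ℝ) < n := by exact_mod_cast hn
  set K := ⌊2 * m * R / n⌋₊ with hK
  have hKle : (K : ℝ) ≤ 2 * m * R / n := Nat.floor_le (by positivity)
  have h := card_confined_le (V := Fin n) (fun H => touching Finset.univ H) K (K * n) m
    (fun H hH => by
      refine (card_touching_univ_le H).trans ?_
      rw [Fintype.card_fin]
      exact Nat.mul_le_mul_right _ hH)
  have hsub : ((hubFamily n R).filter fun A => A.card = m).card ≤
      (confined (fun H : Finset (Fin n) => touching Finset.univ H) K m).card := by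
    refine Finset.card_le_card fun A hA => ?_
    obtain ⟨h1, h2⟩ := Finset.mem_filter.1 hA
    obtain ⟨H, h3, h4⟩ := mem_hubFamily.1 h1
    refine mem_confined.2 ⟨h2, H, ?_, h4⟩
    rw [hK]
    refine Nat.le_floor ?_
    rw [le_div_iff₀ hn', ← h2]
    exact h3
  have hsub' : (((hubFamily n R).filter fun A => A.card = m).card : ℝ) ≤ _ :=
    Nat.cast_le.2 hsub
  refine hsub'.trans (h.trans ?_)
  rw [Fintype.card_fin, mul_add, Real.exp_add]
  refine mul_le_mul ?_ ?_ (by positivity) (by positivity)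
  · refine (pow_le_exp_mul_log K hKle).trans_eq ?_
    congr 1
    ring
  · refine exp_one_mul_pow_le (by positivity) ?_
    push_cast
    rw [le_div_iff₀ hn'] at hKle
    linarith

/-- A core with m edges covers at most 2m/d vertices, so its edges are chosen among at most 4m²/d² ≤
m·4M/d² pairs. -/
lemma card_coreFamily_le {n : ℕ} {M d : ℝ} (hM : 0 < M) (hd : 0 < d) (m : ℕ) :
    (((coreFamily n M d).filter fun A => A.card = m).card : ℝ) ≤
      Real.exp (m * (2 * Real.log (n + 1) / d + (1 + Real.log (4 * M / d ^ 2)))) := by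
  classical
  set K := ⌊2 * m / d⌋₊ with hK
  have hKle : (K : ℝ) ≤ 2 * m / d := Nat.floor_le (by positivity)
  by_cases hmM : (m : ℝ) ≤ M
  swap
  · have : (coreFamily n M d).filter (fun A => A.card = m) = ∅ := by
      refine Finset.filter_eq_empty_iff.2 fun A hA hAm => hmM ?_
      rw [← hAm]
      exact (mem_coreFamily.1 hA).2.1
    rw [this]
    simp only [Finset.card_empty, Nat.cast_zero]
    positivity
  have h := card_confined_le (V := Fin n) (fun H => pairsIn H) K (K ^ 2) m
    (fun H hH => by
      rw [card_pairsIn]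
      refine (Nat.choose_le_pow _ 2).trans ?_
      exact Nat.pow_le_pow_left hH 2)
  have hsub : ((coreFamily n M d).filter fun A => A.card = m).card ≤
      (confined (fun H : Finset (Fin n) => pairsIn H) K m).card := by
    refine Finset.card_le_card fun A hA => ?_
    obtain ⟨h1, h2⟩ := Finset.mem_filter.1 hA
    obtain ⟨h3, _, h4⟩ := mem_coreFamily.1 h1
    refine mem_confined.2 ⟨h2, covered A, ?_, subset_pairsIn_covered A h3⟩
    rw [hK]
    refine Nat.le_floor ?_
    rw [le_div_iff₀ hd, ← h2]
    exact h4
  have hsub' : (((coreFamily n M d).filter fun A => A.card = m).card : ℝ) ≤ _ :=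
    Nat.cast_le.2 hsub
  refine hsub'.trans (h.trans ?_)
  rw [Fintype.card_fin, mul_add, Real.exp_add]
  refine mul_le_mul ?_ ?_ (by positivity) (by positivity)
  · refine (pow_le_exp_mul_log K hKle).trans_eq ?_
    congr 1
    ring
  · refine exp_one_mul_pow_le (by positivity) ?_
    push_cast
    calc (K : ℝ) ^ 2 ≤ (2 * m / d) ^ 2 := by gcongr
      _ = m * (4 * m / d ^ 2) := by ring
      _ ≤ m * (4 * M / d ^ 2) := by gcongr

lemma card_edges_le (n : ℕ) (A : Finset (Sym2 (Fin n))) : A.card ≤ n ^ 2 := by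
  refine (Finset.card_le_univ A).trans ?_
  rw [Sym2.card, Fintype.card_fin, Nat.choose_two_right, Nat.add_sub_cancel]
  refine Nat.div_le_of_le_mul ?_
  nlinarith [Nat.le_self_pow (two_ne_zero) n]

/-- When the entropy per edge is at most L, each cardinality contributes at most 1, and there are at
most n² + 1 cardinalities. -/
lemma sum_pow_card_le {n : ℕ} (F : Finset (Finset (Sym2 (Fin n)))) {x L : ℝ} (hx : x ≤ L)
    (h : ∀ m : ℕ, ((F.filter fun A => A.card = m).card : ℝ) ≤ Real.exp (m * x)) :
    ∑ A ∈ F, Real.exp (-(A.card * L)) ≤ (n : ℝ) ^ 2 + 1 := by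
  classical
  rw [← Finset.sum_fiberwise_of_maps_to (s := F) (t := Finset.range (n ^ 2 + 1))
    (g := fun A => A.card)
    (fun A _ => Finset.mem_range.2 (Nat.lt_succ_of_le (card_edges_le n A)))]
  have h1 : ∀ m ∈ Finset.range (n ^ 2 + 1),
      ∑ A ∈ F with A.card = m, Real.exp (-(A.card * L)) ≤ 1 := by
    intro m _
    rw [Finset.sum_congr rfl (g := fun _ => Real.exp (-(m * L)))
      (fun A hA => by rw [(Finset.mem_filter.1 hA).2]), Finset.sum_const, nsmul_eq_mul]
    calc _ ≤ Real.exp (m * x) * Real.exp (-(m * L)) :=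
          mul_le_mul_of_nonneg_right (h m) (Real.exp_pos _).le
      _ = Real.exp (m * (x - L)) := by rw [← Real.exp_add]; congr 1; ring
      _ ≤ 1 := Real.exp_le_one_iff.2
          (mul_nonpos_of_nonneg_of_nonpos (by positivity) (by linarith))
  refine (Finset.sum_le_sum h1).trans ?_
  simp

/-- The upper bound on the upper tail, for fixed `n`, with all error terms explicit. -/
lemma upperTailProb_le {n s k : ℕ} (hn : 0 < n) (hs : 2 ≤ s) (p : unitInterval)
    {Λ δ ε d η : ℝ} (hp : 0 < (p : ℝ)) (hΛ : 1 ≤ Λ) (hδ : 0 < δ) (hε : 0 < ε)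
    (hεδ : ε ≤ δ) (hd0 : 0 < d) (hη1 : η ≤ 1) (hrn : s + 1 ≤ n)
    (hdesc : δ - 2 * ε ≤ (δ - ε) * n.descFactorial (s + 1) / (n : ℝ) ^ (s + 1))
    (herr : (s + 1) / Λ + (s + 1 + 2 ^ (s + 1).choose 2) * (Λ ^ (s + 6) * p) ≤ ε)
    (hd : ((s + 1 : ℕ) : ℝ) ^ 2 * d ^ (s - 1) ≤
      ε * ((n : ℝ) ^ (s + 1) * (p : ℝ) ^ (s + 1).choose 2) / (Λ * ((n : ℝ) ^ 2 * (p : ℝ) ^ s)))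
    (hhub : 2 * Λ ^ 2 * Real.log (n + 1) / n + (1 + Real.log (2 * Λ ^ 2)) ≤
      η * Real.log (1 / p))
    (hcore : 2 * Real.log (n + 1) / d +
      (1 + Real.log (4 * (Λ * ((n : ℝ) ^ 2 * (p : ℝ) ^ s)) / d ^ 2)) ≤ η * Real.log (1 / p))
    (hk : (s + 1).choose 2 * (k : ℝ) ≤ Λ * ((n : ℝ) ^ 2 * (p : ℝ) ^ s) / 2) :
    upperTailProb (s + 1) n p δ ≤ ((1 + δ - ε) / (1 + δ)) ^ k +
      ((n : ℝ) ^ 2 + 1) ^ 2 * Real.exp (-((1 - η) *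
        ((phiCost (s + 1) δ (n * (p : ℝ) ^ s) - (4 * ε) ^ ((2 : ℝ) / (s + 1 : ℕ)) / 2 -
          Λ ^ 6 * p) * ((n : ℝ) ^ 2 * (p : ℝ) ^ s)) * Real.log (1 / p))) := by
  classical
  have hn' : (0 : ℝ) < n := by exact_mod_cast hn
  have hp1 : (p : ℝ) ≤ 1 := p.2.2
  set L := Real.log (1 / (p : ℝ)) with hL
  have hL0 : 0 ≤ L := Real.log_nonneg (by rw [le_div_iff₀ hp]; linarith)
  have hpL : ∀ m : ℕ, (p : ℝ) ^ m = Real.exp (-(m * L)) := by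
    intro m
    rw [hL, one_div, Real.log_inv, mul_neg, neg_neg, Real.exp_nat_mul, Real.exp_log hp]
  set Q := (n : ℝ) ^ 2 * (p : ℝ) ^ s with hQ
  have hQ0 : 0 < Q := by positivity
  have hΛ0 : 0 < Λ := by linarith
  set ms := (phiCost (s + 1) δ (n * (p : ℝ) ^ s) - (4 * ε) ^ ((2 : ℝ) / (s + 1 : ℕ)) / 2 -
          Λ ^ 6 * p) * Q with hms
  have hmean : 0 < meanCliques (s + 1) n p := by
    rw [meanCliques_eq]
    have : 0 < n.choose (s + 1) := Nat.choose_pos hrn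
    positivity
  set M := ⌊Λ * Q / 2⌋₊ with hM
  set FA := hubFamily n (Λ ^ 2) with hFA
  set FB := coreFamily n (Λ * Q) d with hFB
  set T := (FA ×ˢ FB).filter fun q => Disjoint q.1 q.2 ∧ Loopless (q.1 ∪ q.2) ∧
    ms ≤ (q.1.card : ℝ) + q.2.card with hT
  have hratio : (1 + δ - ε) * meanCliques (s + 1) n p / ((1 + δ) * meanCliques (s + 1) n p) =
      (1 + δ - ε) / (1 + δ) := mul_div_mul_right _ _ hmean.ne'
  have h := upperTail_le_of_seeds (s + 1) n p ((1 + δ - ε) * meanCliques (s + 1) n p)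
    ((1 + δ) * meanCliques (s + 1) n p) (mul_nonneg (by linarith) hmean.le)
    (mul_pos (by linarith) hmean) M k
    (by
      rw [hM]
      refine Nat.le_floor ?_
      push_cast
      exact hk)
    (T.image fun q => q.1 ∪ q.2)
    (by
      intro w hw
      obtain ⟨q, hq, rfl⟩ := Finset.mem_image.1 hw
      exact (Finset.mem_filter.1 hq).2.2.1)
    (by
      intro U hUl hUM hUs
      rw [meanCliques_eq] at hUs
      have hU : (U.card : ℝ) ≤ Λ * Q / 2 :=
        (Nat.le_floor_iff (by positivity)).1 hUM
      obtain ⟨A, B, hA, hB, hAB, hHub, hcov, hsize⟩ := exists_hub_core_of_seed hn hs hp hp1 hΛ hδ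
        hε hdesc herr hd U (by linarith) hUs
      have hBl : Loopless B := fun e he => hUl e (hB he)
      have hBM : (B.card : ℝ) ≤ Λ * Q := by
        have h1 : (B.card : ℝ) ≤ U.card := by exact_mod_cast Finset.card_le_card hB
        have h2 : 0 ≤ Λ * Q := by positivity
        linarith
      refine ⟨A ∪ B, Finset.mem_image.2 ⟨(A, B), Finset.mem_filter.2 ⟨Finset.mem_product.2
        ⟨mem_hubFamily.2 hHub, mem_coreFamily.2 ⟨hBl, hBM, hcov⟩⟩, hAB, ?_, hsize⟩, rfl⟩,
        Finset.union_subset hA hB⟩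
      exact fun e he => hUl e (Finset.union_subset hA hB he))
  rw [hratio] at h
  refine (show upperTailProb (s + 1) n p δ ≤ _ from h).trans (add_le_add le_rfl ?_)
  refine (Finset.sum_image_le_of_nonneg (fun w _ => by positivity)).trans ?_
  -- A fraction 1 - η of the exponent is bounded through the minimum size `ms`. The remaining
  -- fraction η pays for the entropy of each part.
  have h1 : ∀ q ∈ T, (p : ℝ) ^ (q.1 ∪ q.2).card ≤ Real.exp (-((1 - η) * ms * L)) *
      (Real.exp (-(q.1.card * (η * L))) * Real.exp (-(q.2.card * (η * L)))) := by
    intro q hq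
    obtain ⟨_, hdis, _, hsz⟩ := Finset.mem_filter.1 hq
    rw [hpL, Finset.card_union_of_disjoint hdis, ← Real.exp_add, ← Real.exp_add]
    refine Real.exp_le_exp.2 ?_
    push_cast
    have h2 : (1 - η) * L * ms ≤ (1 - η) * L * ((q.1.card : ℝ) + q.2.card) :=
      mul_le_mul_of_nonneg_left hsz (mul_nonneg (by linarith) hL0)
    nlinarith
  refine (Finset.sum_le_sum h1).trans ?_
  rw [← Finset.mul_sum, mul_comm]
  refine mul_le_mul_of_nonneg_right ?_ (Real.exp_pos _).le
  -- With the size constraint spent, it can be dropped so that the double sum factorises.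
  refine (Finset.sum_le_sum_of_subset_of_nonneg (Finset.filter_subset _ _)
    (fun q _ _ => by positivity)).trans ?_
  rw [Finset.sum_product]
  dsimp only
  rw [← Finset.sum_mul_sum, sq ((n : ℝ) ^ 2 + 1)]
  refine mul_le_mul ?_ ?_ (Finset.sum_nonneg fun q _ => by positivity) (by positivity)
  · exact sum_pow_card_le FA hhub (card_hubFamily_le hn (by positivity))
  · exact sum_pow_card_le FB hcore (card_coreFamily_le (by positivity) hd0)

/-! ### Planted cliques and hubs -/

/-- A clique on `Q` together with, for every `i ∈ H`, a star from `i` to `N i`. -/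
def plantedEdges {V : Type*} [DecidableEq V] (Q H : Finset V) (N : V → Finset V) :
    Finset (Sym2 V) :=
  pairsIn Q ∪ (H.sigma N).image fun q => s(q.1, q.2)

lemma loopless_plantedEdges {V : Type*} [DecidableEq V] {Q H : Finset V} {N : V → Finset V}
    (hN : ∀ i ∈ H, Disjoint (N i) H) : Loopless (plantedEdges Q H N) := by
  refine (loopless_pairsIn Q).union fun e he => ?_
  obtain ⟨⟨i, j⟩, hij, rfl⟩ := Finset.mem_image.1 he
  obtain ⟨hi, hj⟩ := Finset.mem_sigma.1 hij
  intro h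
  have h2 : i = j := by simpa using h
  exact Finset.disjoint_left.1 (hN i hi) hj (by simpa [← h2] using hi)

lemma card_plantedEdges_le {V : Type*} [DecidableEq V] (Q H : Finset V) (N : V → Finset V) :
    (plantedEdges Q H N).card ≤ Q.card.choose 2 + ∑ i ∈ H, (N i).card := by
  refine (Finset.card_union_le _ _).trans (add_le_add (card_pairsIn Q).le ?_)
  exact Finset.card_image_le.trans (Finset.card_sigma _ _).le

lemma card_sdiff_plantedEdges_le {V : Type*} [DecidableEq V] {s : ℕ} {Q H : Finset V}
    {N : V → Finset V} {i : V} (hi : i ∈ H) {S : Finset V} (hS : S ⊆ N i) (hSc : S.card = s)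
    (hiS : i ∉ S) :
    (pairsIn (insert i S) \ plantedEdges Q H N).card ≤ (s + 1).choose 2 - s := by
  have h1 : (S.image fun j => s(i, j)) ⊆ pairsIn (insert i S) := by
    intro e he
    obtain ⟨j, hj, rfl⟩ := Finset.mem_image.1 he
    exact mk_mem_pairsIn.2 ⟨Finset.mem_insert_self _ _, Finset.mem_insert_of_mem hj,
      fun h => hiS (h ▸ hj)⟩
  have h2 : (S.image fun j => s(i, j)).card = s := by
    rw [Finset.card_image_of_injective _ (fun j j' h => Sym2.congr_right.1 h), hSc]
  have h3 : pairsIn (insert i S) \ plantedEdges Q H N ⊆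
      pairsIn (insert i S) \ (S.image fun j => s(i, j)) := by
    refine Finset.sdiff_subset_sdiff le_rfl fun e he => ?_
    obtain ⟨j, hj, rfl⟩ := Finset.mem_image.1 he
    exact Finset.mem_union_right _ (Finset.mem_image.2
      ⟨⟨i, j⟩, Finset.mem_sigma.2 ⟨hi, hS hj⟩, rfl⟩)
  refine (Finset.card_le_card h3).trans_eq ?_
  rw [Finset.card_sdiff_of_subset h1, h2, card_pairsIn, Finset.card_insert_of_notMem hiS, hSc]

/-- The gain in the conditional expectation from planting a clique and disjoint hubs. -/
lemma le_condMean_plantedEdges {n s : ℕ} {p : ℝ} (hp : 0 < p) (hp1 : p ≤ 1)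
    {Q H : Finset (Fin n)} {N : Fin n → Finset (Fin n)} (hQ : Disjoint Q H)
    (hN : ∀ i ∈ H, Disjoint (N i) H) :
    n.choose (s + 1) * p ^ (s + 1).choose 2 +
      ((Q.card.choose (s + 1) : ℝ) * (1 - p ^ (s + 1).choose 2) +
        (∑ i ∈ H, ((N i).card.choose s : ℝ)) *
          (p ^ ((s + 1).choose 2 - s) - p ^ (s + 1).choose 2)) ≤
      condMean (s + 1) n p (plantedEdges Q H N) := by
  set U := plantedEdges Q H N with hU
  set f : Finset (Fin n) → ℝ := fun S => p ^ (pairsIn S \ U).card - p ^ (s + 1).choose 2 with hf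
  have h0 : condMean (s + 1) n p U = n.choose (s + 1) * p ^ (s + 1).choose 2 +
      ∑ S ∈ (Finset.univ : Finset (Fin n)).powersetCard (s + 1), f S := by
    rw [hf, Finset.sum_sub_distrib, condMean]
    simp
  have hfnn : ∀ S ∈ (Finset.univ : Finset (Fin n)).powersetCard (s + 1), 0 ≤ f S := by
    intro S hS
    rw [hf]
    simp only [sub_nonneg]
    refine pow_le_pow_of_le_one hp.le hp1 ?_
    refine (Finset.card_le_card Finset.sdiff_subset).trans ?_
    rw [card_pairsIn, Finset.mem_powersetCard_univ.1 hS]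
  rw [h0, add_le_add_iff_left]
  set 𝒬 := Q.powersetCard (s + 1) with h𝒬
  set 𝒢 : Fin n → Finset (Finset (Fin n)) := fun i => ((N i).powersetCard s).image (insert i)
    with h𝒢
  have hmemG : ∀ i ∈ H, ∀ S ∈ 𝒢 i, ∃ T ⊆ N i, T.card = s ∧ i ∉ T ∧ S = insert i T := by
    intro i hi S hS
    obtain ⟨T, hT, rfl⟩ := Finset.mem_image.1 hS
    obtain ⟨h1, h2⟩ := Finset.mem_powersetCard.1 hT
    exact ⟨T, h1, h2, fun h => Finset.disjoint_left.1 (hN i hi) (h1 h) hi, rfl⟩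
  -- A set in `𝒢 i` meets H in i only, so different hubs yield different cliques, none of them
  -- inside Q.
  have hpd : (H : Set (Fin n)).PairwiseDisjoint 𝒢 := by
    intro i hi j hj hij
    rw [Function.onFun, Finset.disjoint_left]
    intro S hSi hSj
    obtain ⟨T, hT, _, _, rfl⟩ := hmemG i hi S hSi
    obtain ⟨T', hT', _, _, h⟩ := hmemG j hj _ hSj
    have h1 : j ∈ insert i T := h ▸ Finset.mem_insert_self j T'
    rcases Finset.mem_insert.1 h1 with h2 | h2
    · exact hij h2.symm
    · exact Finset.disjoint_left.1 (hN i hi) (hT h2) hj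
  have hdisj : Disjoint 𝒬 (H.biUnion 𝒢) := by
    rw [Finset.disjoint_left]
    intro S hS hS'
    obtain ⟨i, hi, hSi⟩ := Finset.mem_biUnion.1 hS'
    obtain ⟨T, _, _, _, rfl⟩ := hmemG i hi S hSi
    exact Finset.disjoint_left.1 hQ
      ((Finset.mem_powersetCard.1 hS).1 (Finset.mem_insert_self i T)) hi
  have hsub : 𝒬 ∪ H.biUnion 𝒢 ⊆ (Finset.univ : Finset (Fin n)).powersetCard (s + 1) := by
    intro S hS
    rw [Finset.mem_powersetCard_univ]
    rcases Finset.mem_union.1 hS with h | h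
    · exact (Finset.mem_powersetCard.1 h).2
    · obtain ⟨i, hi, hSi⟩ := Finset.mem_biUnion.1 h
      obtain ⟨T, _, hT, hiT, rfl⟩ := hmemG i hi S hSi
      rw [Finset.card_insert_of_notMem hiT, hT]
  refine le_trans ?_ (Finset.sum_le_sum_of_subset_of_nonneg hsub fun S hS _ => hfnn S hS)
  rw [Finset.sum_union hdisj, Finset.sum_biUnion hpd]
  refine add_le_add ?_ ?_
  · rw [Finset.sum_congr rfl (g := fun _ => 1 - p ^ (s + 1).choose 2)]
    · rw [Finset.sum_const, h𝒬, Finset.card_powersetCard, nsmul_eq_mul]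
    · intro S hS
      have h1 : pairsIn S \ U = ∅ := by
        rw [Finset.sdiff_eq_empty_iff_subset]
        intro e
        induction e using Sym2.ind with
        | _ a b =>
          intro he
          obtain ⟨ha, hb, hab⟩ := mk_mem_pairsIn.1 he
          have hSQ := (Finset.mem_powersetCard.1 hS).1
          exact Finset.mem_union_left _ (mk_mem_pairsIn.2 ⟨hSQ ha, hSQ hb, hab⟩)
      simp only [hf, h1, Finset.card_empty, pow_zero]
  · rw [Finset.sum_mul]
    refine Finset.sum_le_sum fun i hi => ?_
    have hcard : (𝒢 i).card = (N i).card.choose s := by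
      rw [h𝒢]
      simp only
      rw [Finset.card_image_of_injOn, Finset.card_powersetCard]
      intro T hT T' hT' h
      have h1 : i ∉ T := fun hh => Finset.disjoint_left.1 (hN i hi)
        ((Finset.mem_powersetCard.1 (Finset.mem_coe.1 hT)).1 hh) hi
      have h2 : i ∉ T' := fun hh => Finset.disjoint_left.1 (hN i hi)
        ((Finset.mem_powersetCard.1 (Finset.mem_coe.1 hT')).1 hh) hi
      rw [← Finset.erase_insert h1, ← Finset.erase_insert h2]
      exact congrArg (fun X => X.erase i) h
    rw [← hcard, ← nsmul_eq_mul, ← Finset.sum_const]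
    refine Finset.sum_le_sum fun S hS => ?_
    obtain ⟨T, hT, hTc, hiT, rfl⟩ := hmemG i hi S hS
    simp only [hf]
    rw [sub_le_sub_iff_right]
    exact pow_le_pow_of_le_one hp.le hp1 (card_sdiff_plantedEdges_le hi hT hTc hiT)

lemma card_filter_lt_lt {n a b : ℕ} (h : a + b ≤ n) :
    ((Finset.univ : Finset (Fin n)).filter fun j => a ≤ j.1 ∧ j.1 < a + b).card = b := by
  have h1 : ((Finset.univ : Finset (Fin n)).filter fun j => a ≤ j.1 ∧ j.1 < a + b).map
      Fin.valEmbedding = Finset.Ico a (a + b) := by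
    ext x
    simp only [Finset.mem_map, Finset.mem_filter, Finset.mem_univ, true_and,
      Fin.valEmbedding_apply, Finset.mem_Ico]
    constructor
    · rintro ⟨j, hj, rfl⟩; exact hj
    · rintro ⟨h2, h3⟩; exact ⟨⟨x, by omega⟩, ⟨h2, h3⟩, rfl⟩
  rw [← Finset.card_map, h1, Nat.card_Ico]
  omega

/-- A planted clique of size `a`, together with `k` full hubs and one hub of degree `d`. -/
lemma exists_planted {n s a k d : ℕ} {p : ℝ} (hp : 0 < p) (hp1 : p ≤ 1)
    (ha : k + 1 + a ≤ n) (hd : k + 1 + d ≤ n) :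
    ∃ U : Finset (Sym2 (Fin n)), Loopless U ∧ U.card ≤ a.choose 2 + (k * n + d) ∧
      n.choose (s + 1) * p ^ (s + 1).choose 2 +
        ((a.choose (s + 1) : ℝ) * (1 - p ^ (s + 1).choose 2) +
          (k * ((n - (k + 1)).choose s : ℝ) + (d.choose s : ℝ)) *
            (p ^ ((s + 1).choose 2 - s) - p ^ (s + 1).choose 2)) ≤
        condMean (s + 1) n p U := by
  classical
  -- Vertices 0, …, k-1 are the full hubs and k is the partial one. The clique and all
  -- neighbourhoods are initial segments of the rest and may overlap.
  set Q : Finset (Fin n) := Finset.univ.filter fun j => k + 1 ≤ j.1 ∧ j.1 < k + 1 + a with hQ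
  set F : Finset (Fin n) := Finset.univ.filter fun j => 0 ≤ j.1 ∧ j.1 < 0 + k with hF
  set v : Fin n := ⟨k, by omega⟩ with hv
  set H : Finset (Fin n) := insert v F with hH
  set N : Fin n → Finset (Fin n) := fun i =>
    Finset.univ.filter fun j => k + 1 ≤ j.1 ∧
      j.1 < k + 1 + (if i = v then d else n - (k + 1)) with hN
  have hvF : v ∉ F := by simp [hF, hv]
  have hHlt : ∀ i ∈ H, i.1 < k + 1 := by
    intro i hi
    rcases Finset.mem_insert.1 hi with rfl | h
    · simp [hv]
    · have := (Finset.mem_filter.1 h).2.2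
      omega
  have hQH : Disjoint Q H := by
    rw [Finset.disjoint_left]
    intro i hi hi'
    have := (Finset.mem_filter.1 hi).2.1
    have := hHlt i hi'
    omega
  have hNH : ∀ i ∈ H, Disjoint (N i) H := by
    intro i _
    rw [Finset.disjoint_left]
    intro j hj hj'
    have := (Finset.mem_filter.1 hj).2.1
    have := hHlt j hj'
    omega
  have hQc : Q.card = a := card_filter_lt_lt ha
  have hFc : F.card = k := card_filter_lt_lt (by omega)
  have hNc : ∀ i, (N i).card = if i = v then d else n - (k + 1) := by
    intro i
    refine card_filter_lt_lt ?_
    split_ifs <;> omega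
  have hne : ∀ i ∈ F, i ≠ v := fun i hi h => hvF (h ▸ hi)
  refine ⟨plantedEdges Q H N, loopless_plantedEdges hNH, ?_, ?_⟩
  · refine (card_plantedEdges_le Q H N).trans ?_
    rw [hQc, hH, Finset.sum_insert hvF, hNc, if_pos rfl,
      Finset.sum_congr rfl (g := fun _ => n - (k + 1))
        (fun i hi => by rw [hNc, if_neg (hne i hi)]), Finset.sum_const, hFc, smul_eq_mul,
      add_comm d]
    have : k * (n - (k + 1)) ≤ k * n := Nat.mul_le_mul_left _ (Nat.sub_le _ _)
    omega
  · have h := le_condMean_plantedEdges (s := s) hp hp1 hQH hNH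
    rw [hQc, hH, Finset.sum_insert hvF, hNc, if_pos rfl,
      Finset.sum_congr rfl (g := fun _ => ((n - (k + 1)).choose s : ℝ))
        (fun i hi => by rw [hNc, if_neg (hne i hi)]), Finset.sum_const, hFc, nsmul_eq_mul,
      add_comm (d.choose s : ℝ)] at h
    exact h

/-- A falling factorial is at least the s-th power of its smallest factor. The mean value bound
makes the error linear in the slack w. -/
lemma pow_sub_le_factorial_mul_choose (N s : ℕ) {u w n : ℝ} (hu : 0 ≤ u) (hun : u ≤ n)
    (hw : 0 ≤ w) (h : u - w ≤ (N + 1 - s : ℕ)) :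
    u ^ s - s * w * n ^ (s - 1) ≤ s.factorial * N.choose s := by
  have h1 : (((N + 1 - s : ℕ) : ℝ)) ^ s ≤ s.factorial * N.choose s := by
    have := Nat.pow_sub_le_descFactorial N s
    rw [Nat.descFactorial_eq_factorial_mul_choose] at this
    exact_mod_cast this
  refine le_trans ?_ h1
  set m : ℝ := ((N + 1 - s : ℕ) : ℝ) with hm
  have hm0 : 0 ≤ m := Nat.cast_nonneg _
  rcases le_total u m with hum | hum
  · have h2 : u ^ s ≤ m ^ s := pow_le_pow_left₀ hu hum s
    have h3 : 0 ≤ s * w * n ^ (s - 1) := by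
      have : 0 ≤ n := hu.trans hun
      positivity
    linarith
  · have h2 := abs_pow_sub_pow_le u m s
    rw [abs_of_nonneg (sub_nonneg.2 (pow_le_pow_left₀ hm0 hum s)),
      abs_of_nonneg (sub_nonneg.2 hum), abs_of_nonneg hu, abs_of_nonneg hm0, max_eq_left hum] at h2
    have h3 : (u - m) * s * u ^ (s - 1) ≤ w * s * n ^ (s - 1) := by
      gcongr
      linarith
    linarith

/-! ### Asymptotics in the sparse regime -/

/-- The square root `n p^(s/2)` of the order `n² p^s` of the number of edges planted by the optimal
strategies. -/
def edgeScale (s : ℕ) (p : ℕ → unitInterval) (n : ℕ) : ℝ :=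
  n * (p n : ℝ) ^ ((s : ℝ) / 2)

/-- The range of densities `n⁻¹ (log n)^(1/(s-1)) ≪ p^(s/2) ≪ 1`. -/
structure IsSparseRegime (s : ℕ) (p : ℕ → unitInterval) : Prop where
  pos : ∀ᶠ n in atTop, 0 < (p n : ℝ)
  tendsto_zero : Tendsto (fun n => (p n : ℝ)) atTop (𝓝 0)
  tendsto_log_div : Tendsto (fun n : ℕ => Real.log n / edgeScale s p n ^ (s - 1)) atTop (𝓝 0)

lemma edgeScale_sq (s : ℕ) (p : ℕ → unitInterval) (n : ℕ) :
    edgeScale s p n ^ 2 = (n : ℝ) ^ 2 * (p n : ℝ) ^ s := by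
  have h : ((p n : ℝ) ^ ((s : ℝ) / 2)) ^ 2 = (p n : ℝ) ^ s := by
    rw [← Real.rpow_natCast, ← Real.rpow_mul (p n).2.1]
    push_cast
    rw [div_mul_cancel₀ _ (two_ne_zero), Real.rpow_natCast]
  rw [edgeScale, mul_pow, h]

lemma edgeScale_nonneg (s : ℕ) (p : ℕ → unitInterval) (n : ℕ) : 0 ≤ edgeScale s p n :=
  mul_nonneg n.cast_nonneg (Real.rpow_nonneg (p n).2.1 _)

/-- Raising the first hypothesis to the power s - 1 removes the root of the logarithm. Positivity of
p is forced, since the left side of that hypothesis is positive for n ≥ 2. -/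
lemma isSparseRegime_of_isLittleO {r s : ℕ} (hrs : r = s + 1) (hs : 2 ≤ s) {p : ℕ → unitInterval}
    (h₁ : (fun n : ℕ => (n : ℝ)⁻¹ * Real.log n ^ ((1 : ℝ) / ((r : ℝ) - 2)))
        =o[atTop] (fun n : ℕ => (p n : ℝ) ^ (((r : ℝ) - 1) / 2)))
    (h₂ : Tendsto (fun n : ℕ => (p n : ℝ) ^ (((r : ℝ) - 1) / 2)) atTop (𝓝 0)) :
    IsSparseRegime s p := by
  subst hrs
  have e1 : ((s + 1 : ℕ) : ℝ) - 1 = s := by push_cast; ring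
  have e2 : ((s + 1 : ℕ) : ℝ) - 2 = ((s - 1 : ℕ) : ℝ) := by
    rw [Nat.cast_sub (by omega)]; push_cast; ring
  rw [e1] at h₁ h₂
  rw [e2] at h₁
  have hs1 : (0 : ℝ) < (s - 1 : ℕ) := by exact_mod_cast (by omega : 0 < s - 1)
  have hs0 : (0 : ℝ) < (s : ℝ) / 2 := by have : (0 : ℝ) < s := by exact_mod_cast (by omega : 0 < s)
                                         positivity
  have hpos : ∀ᶠ n in atTop, 0 < (p n : ℝ) := by
    filter_upwards [h₁.bound one_pos, eventually_ge_atTop 2] with n hn hn2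
    refine lt_of_le_of_ne (p n).2.1 fun h0 => ?_
    rw [← h0, Real.zero_rpow hs0.ne', norm_zero, mul_zero] at hn
    have hl : 0 < Real.log n := Real.log_pos (by exact_mod_cast hn2)
    have hn0 : (0 : ℝ) < n := by positivity
    have : 0 < (n : ℝ)⁻¹ * Real.log n ^ ((1 : ℝ) / (s - 1 : ℕ)) := by positivity
    exact absurd (norm_le_zero_iff.1 hn) this.ne'
  refine ⟨hpos, ?_, ?_⟩
  · have h := h₂.rpow_const (p := 2 / (s : ℝ)) (Or.inr (by positivity))
    rw [Real.zero_rpow (by have : (0 : ℝ) < s := by linarith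
                           positivity)] at h
    refine h.congr fun n => ?_
    rw [← Real.rpow_mul (p n).2.1]
    have : (s : ℝ) / 2 * (2 / s) = 1 := by
      have : (0 : ℝ) < s := by linarith
      field_simp
    rw [this, Real.rpow_one]
  · have h := (h₁.tendsto_div_nhds_zero).pow (s - 1)
    rw [zero_pow (by omega)] at h
    refine h.congr' ?_
    filter_upwards [hpos, eventually_ge_atTop 2] with n hp hn2
    have hl : 0 < Real.log n := Real.log_pos (by exact_mod_cast hn2)
    have hn0 : (0 : ℝ) < n := by positivity
    have : (Real.log n ^ ((1 : ℝ) / (s - 1 : ℕ))) ^ (s - 1) = Real.log n := by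
      rw [← Real.rpow_natCast, ← Real.rpow_mul hl.le, one_div_mul_cancel hs1.ne', Real.rpow_one]
    rw [div_pow, mul_pow, this, edgeScale, mul_pow, inv_pow]
    field_simp

namespace IsSparseRegime

variable {s : ℕ} {p : ℕ → unitInterval}

lemma tendsto_log_inv (h : IsSparseRegime s p) :
    Tendsto (fun n => Real.log (1 / (p n : ℝ))) atTop atTop := by
  refine Real.tendsto_log_atTop.comp ?_
  simp only [one_div]
  exact tendsto_inv_nhdsGT_zero.comp (tendsto_nhdsWithin_iff.2 ⟨h.tendsto_zero, h.pos⟩)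

lemma tendsto_pow_mul (h : IsSparseRegime s p) (k : ℕ) :
    Tendsto (fun n => Real.log (1 / (p n : ℝ)) ^ k * (p n : ℝ)) atTop (𝓝 0) := by
  refine ((Real.tendsto_pow_mul_exp_neg_atTop_nhds_zero k).comp h.tendsto_log_inv).congr' ?_
  filter_upwards [h.pos] with n hp
  simp [Real.exp_log hp]

lemma tendsto_edgeScale_pow (h : IsSparseRegime s p) :
    Tendsto (fun n => edgeScale s p n ^ (s - 1)) atTop atTop := by
  refine tendsto_atTop_mono' _ ?_ (Real.tendsto_log_atTop.comp tendsto_natCast_atTop_atTop)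
  filter_upwards [h.pos, h.tendsto_log_div.eventually_le_const one_pos, eventually_ge_atTop 1]
    with n hp hn h1
  have hn0 : (0 : ℝ) < n := by positivity
  have : 0 < edgeScale s p n := mul_pos hn0 (Real.rpow_pos_of_pos hp _)
  rwa [div_le_one (by positivity)] at hn

lemma tendsto_edgeScale (h : IsSparseRegime s p) :
    Tendsto (edgeScale s p) atTop atTop := by
  refine tendsto_atTop.2 fun b => ?_
  filter_upwards [h.tendsto_edgeScale_pow.eventually_gt_atTop (|b| ^ (s - 1))] with n hn
  exact (le_abs_self b).trans (lt_of_pow_lt_pow_left₀ _ (edgeScale_nonneg s p n) hn).le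

/-- Splits log n into a part negligible against the edge scale and a multiple of log(1/p), the unit
in which entropy is measured. -/
lemma log_eq (h : IsSparseRegime s p) : ∀ᶠ n : ℕ in atTop,
    Real.log n = Real.log (edgeScale s p n) + s / 2 * Real.log (1 / (p n : ℝ)) := by
  filter_upwards [h.pos, eventually_ge_atTop 1] with n hp h1
  have hn0 : (0 : ℝ) < n := by positivity
  rw [edgeScale, Real.log_mul hn0.ne' (Real.rpow_pos_of_pos hp _).ne', Real.log_rpow hp, one_div,
    Real.log_inv]
  ring

lemma log_inv_le (h : IsSparseRegime s p) (hs : 2 ≤ s) : ∀ᶠ n : ℕ in atTop,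
    Real.log (1 / (p n : ℝ)) ≤ Real.log n := by
  filter_upwards [h.log_eq, h.tendsto_edgeScale.eventually_ge_atTop 1,
    h.tendsto_log_inv.eventually_ge_atTop 0] with n hn hq hL
  have h1 : (1 : ℝ) ≤ s / 2 := by
    have : (2 : ℝ) ≤ s := by exact_mod_cast hs
    linarith
  nlinarith [Real.log_nonneg hq]

lemma tendsto_log_sq_div : Tendsto (fun n : ℕ => Real.log n ^ 2 / n) atTop (𝓝 0) :=
  (Real.isLittleO_pow_log_id_atTop (n := 2)).tendsto_div_nhds_zero.comp tendsto_natCast_atTop_atTop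

lemma log_add_one_le {n : ℕ} (hn : 2 ≤ n) : Real.log (n + 1) ≤ 2 * Real.log n := by
  have h2 : (2 : ℝ) ≤ n := by exact_mod_cast hn
  rw [← Nat.cast_ofNat, ← Real.log_pow]
  exact Real.log_le_log (by positivity) (by nlinarith)

lemma tendsto_log_mul_pow_div {b : ℝ} (hb : 0 < b) (k : ℕ) :
    Tendsto (fun x : ℝ => (1 + Real.log (b * x ^ k)) / x) atTop (𝓝 0) := by
  have h1 : Tendsto (fun x : ℝ => (1 + Real.log b) * x⁻¹ + k * (Real.log x / x)) atTop (𝓝 0) := by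
    have := (tendsto_inv_atTop_zero (𝕜 := ℝ)).const_mul (1 + Real.log b)
    have h2 := (Real.isLittleO_log_id_atTop.tendsto_div_nhds_zero).const_mul (k : ℝ)
    simpa using this.add h2
  refine h1.congr' ?_
  filter_upwards [eventually_gt_atTop 0] with x hx
  rw [Real.log_mul hb.ne' (by positivity), Real.log_pow]
  field_simp
  ring

/-- With Λ = aL the main entropy per edge is of order log L = o(L), and choosing the hubs themselves
costs L²·log n/n, also o(L). -/
lemma eventually_hub_entropy_le (h : IsSparseRegime s p) (hs : 2 ≤ s) {a η : ℝ} (ha : 0 < a)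
    (hη : 0 < η) : ∀ᶠ n : ℕ in atTop,
      2 * (a * Real.log (1 / (p n : ℝ))) ^ 2 * Real.log (n + 1) / n
        + (1 + Real.log (2 * (a * Real.log (1 / (p n : ℝ))) ^ 2))
          ≤ η * Real.log (1 / (p n : ℝ)) := by
  have h1 := ((tendsto_log_mul_pow_div (b := 2 * a ^ 2) (by positivity) 2).comp
    h.tendsto_log_inv).eventually_le_const (half_pos hη)
  have h2 := (tendsto_log_sq_div.const_mul (4 * a ^ 2)).eventually_le_const
    (u := η / 2) (by simpa using half_pos hη)
  filter_upwards [h1, h2, h.log_inv_le hs, h.tendsto_log_inv.eventually_gt_atTop 0,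
    eventually_ge_atTop 2] with n h1 h2 h3 h4 h5
  simp only [Function.comp_apply] at h1
  set L := Real.log (1 / (p n : ℝ))
  rw [div_le_iff₀ h4] at h1
  have hn0 : (0 : ℝ) < n := by positivity
  have hl := log_add_one_le h5
  have : 2 * (a * L) ^ 2 * Real.log (n + 1) / n ≤ (4 * a ^ 2 * (Real.log n ^ 2 / n)) * L := by
    rw [← mul_div_assoc, div_mul_eq_mul_div, div_le_div_iff_of_pos_right hn0]
    calc 2 * (a * L) ^ 2 * Real.log (n + 1) ≤ 2 * (a * L) ^ 2 * (2 * Real.log n) := by gcongr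
      _ = 4 * a ^ 2 * (L * Real.log n) * L := by ring
      _ ≤ 4 * a ^ 2 * (Real.log n * Real.log n) * L := by gcongr
      _ = _ := by ring
  rw [show 2 * (a * L) ^ 2 = 2 * a ^ 2 * L ^ 2 by ring] at this ⊢
  nlinarith [mul_le_mul_of_nonneg_right h2 h4.le]

end IsSparseRegime

lemma edgeScale_pow_succ {s n : ℕ} {p : ℕ → unitInterval} (hp : 0 < (p n : ℝ)) :
    edgeScale s p n ^ (s + 1) = (n : ℝ) ^ (s + 1) * (p n : ℝ) ^ (s + 1).choose 2 := by
  rw [← rpow_half_eq hp, ← edgeScale_sq, ← Real.rpow_natCast _ 2, ← Real.rpow_mul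
    (edgeScale_nonneg s p n), ← Real.rpow_natCast]
  congr 1
  push_cast
  ring

namespace IsSparseRegime

variable {s : ℕ} {p : ℕ → unitInterval}

lemma eventually_edgeScale_pos (h : IsSparseRegime s p) : ∀ᶠ n in atTop, 0 < edgeScale s p n :=
  h.tendsto_edgeScale.eventually_gt_atTop 0

/-- The degree d is dictated by the core construction. Choosing the covered vertices costs (log n)/d
per edge, and with q the edge scale log n = log q + (s/2)L. The first part is small because d ≥
κq/L, the second because d exceeds any constant. -/
lemma eventually_core_entropy_le (h : IsSparseRegime s p) (hs : 2 ≤ s) {a η κ : ℝ} (ha : 0 < a)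
    (hη : 0 < η) (hκ : 0 < κ) : ∀ᶠ n : ℕ in atTop, ∃ d : ℝ, 0 < d ∧
      d ^ (s - 1) = edgeScale s p n ^ (s - 1) * (κ / Real.log (1 / (p n : ℝ))) ∧
      2 * Real.log (n + 1) / d
        + (1 + Real.log (4 * (a * Real.log (1 / (p n : ℝ)) * edgeScale s p n ^ 2) / d ^ 2))
          ≤ η * Real.log (1 / (p n : ℝ)) := by
  have h1 := ((tendsto_log_mul_pow_div (b := 4 * a / κ ^ 2) (by positivity) 3).comp
    h.tendsto_log_inv).eventually_le_const (by positivity : 0 < η / 4)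
  have h2 := ((Real.isLittleO_log_id_atTop.tendsto_div_nhds_zero.comp
    h.tendsto_edgeScale).const_mul (4 / κ)).eventually_le_const
      (u := η / 4) (by simpa using by positivity)
  have h3 := (h.tendsto_log_div).eventually_le_const
    (u := κ * (η / (8 * s)) ^ (s - 1)) (by
      have : 0 < s := by omega
      positivity)
  filter_upwards [h1, h2, h3, h.log_inv_le hs, h.log_eq, h.tendsto_log_inv.eventually_gt_atTop κ,
    eventually_ge_atTop 2, h.tendsto_edgeScale.eventually_ge_atTop 1] with n h1 h2 h3 h4 h5 h6 h7 h8
  simp only [Function.comp_apply, id_eq] at h1 h2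
  set L := Real.log (1 / (p n : ℝ))
  set q := edgeScale s p n
  have hL : 0 < L := hκ.trans h6
  have hq : 0 < q := by linarith
  have hn0 : (0 : ℝ) < n := by positivity
  have hs0 : (0 : ℝ) < s := by exact_mod_cast (by omega : 0 < s)
  have hy : 0 < κ / L := by positivity
  have hy1 : κ / L ≤ 1 := (div_le_one hL).2 h6.le
  have hs1 : (1 : ℝ) ≤ (s - 1 : ℕ) := by exact_mod_cast (by omega : 1 ≤ s - 1)
  have ht1 : ((s - 1 : ℕ) : ℝ)⁻¹ ≤ 1 := inv_le_one_of_one_le₀ hs1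
  set t := (κ / L) ^ ((s - 1 : ℕ) : ℝ)⁻¹ with ht
  have htpow : t ^ (s - 1) = κ / L := Real.rpow_inv_natCast_pow hy.le (by omega)
  have htpos : 0 < t := Real.rpow_pos_of_pos hy _
  have hyt : κ / L ≤ t := by
    simpa using Real.rpow_le_rpow_of_exponent_ge hy hy1 ht1
  have hd0 : 0 < q * t := by positivity
  refine ⟨q * t, hd0, by rw [mul_pow, htpow], ?_⟩
  have hdL : q * κ ≤ q * t * L := by
    rw [mul_assoc]
    gcongr
    exact (div_le_iff₀ hL).1 hyt
  have hvol : Real.log (4 * (a * L * q ^ 2) / (q * t) ^ 2) ≤ Real.log (4 * a / κ ^ 2 * L ^ 3) := by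
    refine Real.log_le_log (by positivity) ?_
    rw [div_le_iff₀ (by positivity), div_mul_eq_mul_div, div_mul_eq_mul_div,
      le_div_iff₀ (by positivity)]
    have := pow_le_pow_left₀ (by positivity) hdL 2
    calc 4 * (a * L * q ^ 2) * κ ^ 2 = 4 * a * L * (q * κ) ^ 2 := by ring
      _ ≤ 4 * a * L * (q * t * L) ^ 2 := by gcongr
      _ = _ := by ring
  have hlogq : 4 * Real.log q / (q * t) ≤ η / 4 * L := by
    rw [div_le_iff₀ hd0]
    have : 4 / κ * (Real.log q / q) * (q * κ) = 4 * Real.log q := by field_simp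
    rw [← this]
    have h0 : 0 ≤ q * κ := by positivity
    nlinarith [mul_le_mul_of_nonneg_right h2 h0]
  -- The decisive use of log n ≪ q^(s-1): since L ≤ log n, d^(s-1) = κq^(s-1)/L becomes arbitrarily
  -- large.
  have hdlarge : 8 * s / η ≤ q * t := by
    refine le_of_pow_le_pow_left₀ (n := s - 1) (by omega) hd0.le ?_
    have hqp : 0 < q ^ (s - 1) := by positivity
    have hlog : Real.log n ≤ κ * (η / (8 * s)) ^ (s - 1) * q ^ (s - 1) := (div_le_iff₀ hqp).1 h3
    have e : (8 * s / η) ^ (s - 1) * (η / (8 * s)) ^ (s - 1) = 1 := by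
      rw [← mul_pow]
      have : 8 * (s : ℝ) / η * (η / (8 * s)) = 1 := by field_simp
      rw [this, one_pow]
    rw [mul_pow, htpow, ← mul_div_assoc, le_div_iff₀ hL]
    calc (8 * s / η) ^ (s - 1) * L ≤ (8 * s / η) ^ (s - 1) * Real.log n := by gcongr
      _ ≤ (8 * s / η) ^ (s - 1) * (κ * (η / (8 * s)) ^ (s - 1) * q ^ (s - 1)) := by gcongr
      _ = ((8 * s / η) ^ (s - 1) * (η / (8 * s)) ^ (s - 1)) * (q ^ (s - 1) * κ) := by ring
      _ = _ := by rw [e, one_mul]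
  have hlogp : 2 * s * L / (q * t) ≤ η / 4 * L := by
    rw [div_le_iff₀ hd0]
    rw [div_le_iff₀ hη] at hdlarge
    nlinarith
  rw [div_le_iff₀ hL] at h1
  have hlog : 2 * Real.log (n + 1) / (q * t) ≤ 4 * Real.log q / (q * t) + 2 * s * L / (q * t) := by
    rw [← add_div]
    gcongr
    linarith [log_add_one_le h7]
  linarith [mul_pos hη hL]

lemma tendsto_edgeScale_sq (h : IsSparseRegime s p) :
    Tendsto (fun n => edgeScale s p n ^ 2) atTop atTop :=
  (tendsto_pow_atTop two_ne_zero).comp h.tendsto_edgeScale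

lemma tendsto_sq_mul_log (h : IsSparseRegime s p) :
    Tendsto (fun n => edgeScale s p n ^ 2 * Real.log (1 / (p n : ℝ))) atTop atTop :=
  h.tendsto_edgeScale_sq.atTop_mul_atTop₀ h.tendsto_log_inv

/-- Polynomial factors in n are therefore invisible at the scale QL of the exponent. -/
lemma eventually_log_le (h : IsSparseRegime s p) {b : ℝ} (hb : 0 < b) :
    ∀ᶠ n : ℕ in atTop,
      Real.log n ≤ b * (edgeScale s p n ^ 2 * Real.log (1 / (p n : ℝ))) := by
  have h2 := (Real.isLittleO_log_id_atTop.tendsto_div_nhds_zero.comp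
    h.tendsto_edgeScale).eventually_le_const (half_pos hb)
  filter_upwards [h2, h.log_eq, h.tendsto_log_inv.eventually_ge_atTop 1,
    h.tendsto_edgeScale.eventually_ge_atTop 1,
    h.tendsto_edgeScale_sq.eventually_ge_atTop (s / b)] with n h2 h3 h4 h5 h6
  simp only [Function.comp_apply, id_eq] at h2
  set L := Real.log (1 / (p n : ℝ))
  set q := edgeScale s p n
  have hq : 0 < q := by linarith
  rw [div_le_iff₀ hq] at h2
  rw [div_le_iff₀ hb] at h6
  rw [h3]
  have a1 : b / 2 * q ≤ b / 2 * (q ^ 2 * L) := by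
    gcongr
    nlinarith
  nlinarith

lemma tendsto_descFactorial_div (r : ℕ) :
    Tendsto (fun n : ℕ => (n.descFactorial r : ℝ) / (n : ℝ) ^ r) atTop (𝓝 1) := by
  have h1 : Tendsto (fun n : ℕ => (1 - (r : ℝ) / n) ^ r) atTop (𝓝 1) := by
    have := ((tendsto_const_nhds (x := (1 : ℝ))).sub
      (tendsto_const_div_atTop_nhds_zero_nat (r : ℝ))).pow r
    simpa using this
  refine tendsto_of_tendsto_of_tendsto_of_le_of_le' h1 tendsto_const_nhds ?_ ?_
  · filter_upwards [eventually_ge_atTop (r + 1)] with n hn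
    have hn0 : (0 : ℝ) < n := by exact_mod_cast (by omega : 0 < n)
    rw [le_div_iff₀ (by positivity), ← mul_pow, sub_mul, div_mul_cancel₀ _ hn0.ne', one_mul]
    have h2 : ((n + 1 - r : ℕ) : ℝ) ^ r ≤ n.descFactorial r := by
      exact_mod_cast Nat.pow_sub_le_descFactorial n r
    refine le_trans (pow_le_pow_left₀ ?_ ?_ r) h2
    · rw [sub_nonneg]; exact_mod_cast (by omega : r ≤ n)
    · rw [Nat.cast_sub (by omega)]; push_cast; linarith
  · refine Eventually.of_forall fun n => div_le_one_of_le₀ ?_ (by positivity)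
    exact_mod_cast Nat.descFactorial_le_pow n r

end IsSparseRegime

lemma phiCost_le_clique {r : ℕ} (hr : 3 ≤ r) {δ c : ℝ} (hδ : 0 < δ) (hc : 0 < c) :
    phiCost r δ c ≤ δ ^ ((2 : ℝ) / r) / 2 :=
  (phiCost_le hr hδ hc (x := 0) (by simp)).trans_eq (psiCost_zero hr δ c)

namespace IsSparseRegime

variable {s : ℕ} {p : ℕ → unitInterval}

/-- The choice Λ = aL grows fast enough for 1/Λ to vanish and slowly enough for Λ^k p to vanish. -/
lemma eventually_truncation_error_le (h : IsSparseRegime s p) {a b c ε : ℝ} (ha : 0 < a)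
    (hε : 0 < ε) (k : ℕ) :
    ∀ᶠ n : ℕ in atTop, b / (a * Real.log (1 / (p n : ℝ)))
      + c * ((a * Real.log (1 / (p n : ℝ))) ^ k * p n) ≤ ε := by
  have h1 : Tendsto (fun n => b / (a * Real.log (1 / (p n : ℝ)))) atTop (𝓝 0) :=
    (h.tendsto_log_inv.const_mul_atTop ha).const_div_atTop b
  have h2 := ((h.tendsto_pow_mul k).const_mul (c * a ^ k))
  have h3 := h1.add h2
  rw [mul_zero, add_zero] at h3
  filter_upwards [h3.eventually_le_const hε] with n hn
  refine le_trans (le_of_eq ?_) hn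
  rw [mul_pow]; ring

/-- The crude bound on the probability that a graph has many non-truncated edges beats the rate. -/
lemma eventually_tail_le_exp (h : IsSparseRegime s p) {ρ a A N : ℝ} (hρ : 0 < ρ)
    (ha : A + 1 ≤ ρ * (a / N)) :
    ∀ᶠ n : ℕ in atTop, Real.exp (-ρ)
        ^ ⌊a * Real.log (1 / (p n : ℝ)) * edgeScale s p n ^ 2 / N⌋₊
      ≤ Real.exp (-(A * (edgeScale s p n ^ 2 * Real.log (1 / (p n : ℝ))))) / 2 := by
  filter_upwards [h.tendsto_sq_mul_log.eventually_ge_atTop (ρ + Real.log 2)] with n hn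
  set W := edgeScale s p n ^ 2 * Real.log (1 / (p n : ℝ)) with hW
  have e : a * Real.log (1 / (p n : ℝ)) * edgeScale s p n ^ 2 / N = a / N * W := by
    rw [hW]; ring
  have h2 := Real.log_nonneg (by norm_num : (1 : ℝ) ≤ 2)
  have hW0 : 0 ≤ W := by linarith
  have hfl := (Nat.lt_floor_add_one (a / N * W)).le
  rw [e, ← Real.exp_nat_mul, ← Real.exp_log (show (0 : ℝ) < 2 by norm_num), ← Real.exp_sub]
  refine Real.exp_le_exp.2 ?_
  nlinarith [mul_le_mul_of_nonneg_right ha hW0, mul_le_mul_of_nonneg_left hfl hρ.le]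

/-- Uniformity in A and B is needed because the rates substituted for them depend on n. -/
lemma eventually_mul_exp_le (h : IsSparseRegime s p) {ε : ℝ} (hε : 0 < ε) :
    ∀ᶠ n : ℕ in atTop, ∀ A B : ℝ, A + ε ≤ B → ((n : ℝ) ^ 2 + 1) ^ 2 *
        Real.exp (-(B * (edgeScale s p n ^ 2 * Real.log (1 / (p n : ℝ)))))
      ≤ Real.exp (-(A * (edgeScale s p n ^ 2 * Real.log (1 / (p n : ℝ))))) / 2 := by
  filter_upwards [h.eventually_log_le (b := ε / 7) (by positivity), eventually_ge_atTop 2]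
    with n hn h2 A B hAB
  set W := edgeScale s p n ^ 2 * Real.log (1 / (p n : ℝ)) with hW
  have h2' : (2 : ℝ) ≤ n := by exact_mod_cast h2
  have hn0 : (0 : ℝ) < n := by linarith
  have hl := Real.log_nonneg (by linarith : (1 : ℝ) ≤ n)
  have hW0 : 0 ≤ W := by
    have := hl.trans hn
    exact nonneg_of_mul_nonneg_right this (by positivity)
  have hpoly : ((n : ℝ) ^ 2 + 1) ^ 2 * 2 ≤ Real.exp (7 * Real.log n) := by
    have e : Real.exp (7 * Real.log n) = (n : ℝ) ^ 7 := by
      rw [← Real.exp_log hn0, ← Real.exp_nat_mul, Real.exp_log hn0]; norm_num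
    rw [e]
    have a1 : (n : ℝ) ^ 2 + 1 ≤ (n : ℝ) ^ 3 := by nlinarith [sq_nonneg (n : ℝ)]
    calc ((n : ℝ) ^ 2 + 1) ^ 2 * 2 ≤ ((n : ℝ) ^ 3) ^ 2 * n := by gcongr
      _ = (n : ℝ) ^ 7 := by ring
  rw [le_div_iff₀ two_pos, mul_right_comm]
  refine (mul_le_mul_of_nonneg_right hpoly (Real.exp_pos _).le).trans ?_
  rw [← Real.exp_add]
  refine Real.exp_le_exp.2 ?_
  nlinarith [mul_le_mul_of_nonneg_right hAB hW0]

/-! ### The asymptotic upper bound on the tail -/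

lemma eventually_upperTailProb_le (h : IsSparseRegime s p) (hs : 2 ≤ s) {δ ε : ℝ} (hδ : 0 < δ)
    (hε : 0 < ε) : ∀ᶠ n : ℕ in atTop, upperTailProb (s + 1) n (p n) δ ≤
      Real.exp (-((phiCost (s + 1) δ (n * (p n : ℝ) ^ s) - ε)
        * (edgeScale s p n ^ 2 * Real.log (1 / (p n : ℝ))))) := by
  have hr : 3 ≤ s + 1 := by omega
  set A := δ ^ ((2 : ℝ) / (s + 1 : ℕ)) / 2 with hA
  have hA0 : 0 < A := by positivity
  -- The truncation loss (4τ)^(2/r)/2, the entropy loss ηφ ≤ ηA and the hub overlap are each held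
  -- below ε/8, which leaves ε/2 for polynomial factors.
  set τ := min (δ / 2) ((ε / 4) ^ (((s + 1 : ℕ) : ℝ) / 2) / 4) with hτ
  have hτ0 : 0 < τ := lt_min (by positivity) (by positivity)
  have hτδ : τ ≤ δ / 2 := min_le_left _ _
  have hτε : (4 * τ) ^ ((2 : ℝ) / (s + 1 : ℕ)) / 2 ≤ ε / 8 := by
    have h1 : 4 * τ ≤ (ε / 4) ^ (((s + 1 : ℕ) : ℝ) / 2) := by
      have := min_le_right (δ / 2) ((ε / 4) ^ (((s + 1 : ℕ) : ℝ) / 2) / 4)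
      linarith
    have h2 := Real.rpow_le_rpow (by positivity) h1
      (by positivity : (0 : ℝ) ≤ (2 : ℝ) / (s + 1 : ℕ))
    rw [← Real.rpow_mul (by positivity)] at h2
    have e : ((s + 1 : ℕ) : ℝ) / 2 * (2 / (s + 1 : ℕ)) = 1 := by field_simp
    rw [e, Real.rpow_one] at h2
    linarith
  set η := min 1 (ε / (8 * A)) with hη
  have hη0 : 0 < η := lt_min one_pos (by positivity)
  have hηA : η * A ≤ ε / 8 := by
    have : η * A ≤ ε / (8 * A) * A := by
      gcongr
      exact min_le_right _ _
    refine this.trans_eq ?_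
    field_simp
  set ρ := Real.log ((1 + δ) / (1 + δ - τ)) with hρ
  have hden : 0 < 1 + δ - τ := by linarith
  have hρ0 : 0 < ρ := Real.log_pos ((one_lt_div hden).2 (by linarith))
  have hρe : Real.exp (-ρ) = (1 + δ - τ) / (1 + δ) := by
    rw [Real.exp_neg, hρ, Real.exp_log (by positivity), inv_div]
  set N : ℝ := ((s + 1).choose 2 : ℝ) with hN
  have hN0 : 0 < N := by
    rw [hN]; exact_mod_cast Nat.choose_pos (by omega)
  -- Large enough that the moment term e^(-ρk), with k about aLq²/(2N), decays faster than the
  -- clique rate A ≥ φ.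
  set a := (A + 1) * (2 * N) / ρ with ha
  have ha0 : 0 < a := by positivity
  have haρ : A + 1 ≤ ρ * (a / (2 * N)) := by
    rw [ha]
    refine le_of_eq ?_
    field_simp
  -- Makes the requirement on d in `upperTailProb_le` an equality.
  set κ := τ / (((s + 1 : ℕ) : ℝ) ^ 2 * a) with hκ
  have hκ0 : 0 < κ := by positivity
  have hdesc := ((tendsto_descFactorial_div (s + 1)).const_mul (δ - τ)).eventually_const_le
    (u := δ - 2 * τ) (by linarith)
  filter_upwards [h.pos, eventually_ge_atTop (s + 1), hdesc,
    h.eventually_truncation_error_le (b := (s + 1)) (c := s + 1 + 2 ^ (s + 1).choose 2) ha0 hτ0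
      (s + 6),
    h.eventually_truncation_error_le (b := 0) (c := 1) ha0 (show 0 < ε / 8 by positivity) 6,
    h.eventually_hub_entropy_le hs ha0 hη0, h.eventually_core_entropy_le hs ha0 hη0 hκ0,
    h.eventually_tail_le_exp (A := A) (N := 2 * N) hρ0 haρ,
    h.eventually_mul_exp_le (ε := ε / 2) (by positivity),
    h.tendsto_log_inv.eventually_ge_atTop (1 / a), h.tendsto_log_inv.eventually_gt_atTop 0,
    h.eventually_edgeScale_pos]
    with n hp hn hdesc herr hsmall hhub hcore htail hexp hLa hL0 hq0
  obtain ⟨d, hd0, hdpow, hcore⟩ := hcore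
  have hpow := edgeScale_pow_succ (s := s) hp
  have hsq := edgeScale_sq s p n
  set L := Real.log (1 / (p n : ℝ)) with hL
  set q := edgeScale s p n with hq
  have hn0 : 0 < n := by omega
  have hn0' : (0 : ℝ) < n := by exact_mod_cast hn0
  have hΛ : 1 ≤ a * L := by
    rwa [div_le_iff₀ ha0, mul_comm] at hLa
  have hφ := phiCost_le_clique hr hδ (c := n * (p n : ℝ) ^ s) (by positivity)
  set φ := phiCost (s + 1) δ (n * (p n : ℝ) ^ s) with hφd
  set W := q ^ 2 * L with hW
  have hW0 : 0 < W := by positivity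
  have key := upperTailProb_le (k := ⌊a * L * q ^ 2 / (2 * N)⌋₊) (η := η) hn0 hs (p n) hp hΛ hδ hτ0
    (by linarith) hd0 (min_le_left _ _) hn (by rwa [mul_div_assoc]) herr
    (by
      rw [← hpow, ← hsq, hdpow, hκ, pow_succ q s]
      refine le_of_eq ?_
      obtain ⟨m, rfl⟩ : ∃ m, s = m + 1 := ⟨s - 1, by omega⟩
      rw [Nat.add_sub_cancel, pow_succ q m]
      field_simp) hhub
    (by rwa [← hsq])
    (by
      rw [← hsq]
      have := Nat.floor_le (by positivity : 0 ≤ a * L * q ^ 2 / (2 * N))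
      rw [le_div_iff₀ (by positivity)] at this
      linarith)
  refine key.trans ?_
  rw [← hρe]
  have e2 : ∀ x : ℝ, x * ((n : ℝ) ^ 2 * (p n : ℝ) ^ s) * L = x * W := fun x => by
    rw [← hsq]; ring
  have e3 : (1 - η) * ((φ - (4 * τ) ^ ((2 : ℝ) / (s + 1 : ℕ)) / 2 - (a * L) ^ 6 * p n)
      * ((n : ℝ) ^ 2 * (p n : ℝ) ^ s)) * L
      = ((1 - η) * (φ - (4 * τ) ^ ((2 : ℝ) / (s + 1 : ℕ)) / 2 - (a * L) ^ 6 * p n)) * W := by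
    rw [← e2]; ring
  rw [e3]
  have hφA : η * φ ≤ ε / 8 := (mul_le_mul_of_nonneg_left hφ hη0.le).trans hηA
  have hE0 : 0 ≤ (4 * τ) ^ ((2 : ℝ) / (s + 1 : ℕ)) / 2 := by positivity
  have hE1 : 0 ≤ (a * L) ^ 6 * p n := by positivity
  have h2 := hexp (φ - ε) ((1 - η) * (φ - (4 * τ) ^ ((2 : ℝ) / (s + 1 : ℕ)) / 2
    - (a * L) ^ 6 * p n)) (by
      rw [zero_div, zero_add, one_mul] at hsmall
      have := mul_nonneg hη0.le (add_nonneg hE0 hE1)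
      linarith)
  have h1 : Real.exp (-(A * W)) ≤ Real.exp (-((φ - ε) * W)) := by
    refine Real.exp_le_exp.2 (neg_le_neg ?_)
    gcongr
    linarith
  linarith

end IsSparseRegime

/-! ### The asymptotic lower bound on the tail -/

/-- The clique contributes y, and the k full hubs with one of relative degree θ contribute
rT/(np^s), on the clique scale. The subtracted term covers the vertices reserved for hubs and the
falling factorials. The factors 1 - p^s and 1 - p^(r choose 2) discount what the copies already
contributed to the mean. -/
lemma le_factorial_mul_planted_gain {n s a k d : ℕ} {p y Y T θ : ℝ} (hn : 0 < n) (hs : 2 ≤ s)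
    (hp : 0 < p) (hp1 : p ≤ 1) (hY : 0 ≤ Y) (ha : Y ≤ (a + 1 - (s + 1) : ℕ))
    (hYy : Y ^ (s + 1) = y * ((n : ℝ) ^ (s + 1) * p ^ (s + 1).choose 2))
    (hθ : 0 ≤ θ) (hθ1 : θ ≤ 1) (hT : (k : ℝ) + θ ^ s = T) (hk : k + 1 ≤ n)
    (hd : θ * (n - k - 1) ≤ d + 1) :
    (y * (1 - p ^ (s + 1).choose 2)
      + ((s + 1 : ℕ) * T / (n * p ^ s)
        - (s + 1 : ℕ) * (s * ((k : ℝ) + 1 + s) ^ 2) / ((n : ℝ) ^ 2 * p ^ s)) * (1 - p ^ s))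
      * ((n : ℝ) ^ (s + 1) * p ^ (s + 1).choose 2)
    ≤ (s + 1).factorial * ((a.choose (s + 1) : ℝ) * (1 - p ^ (s + 1).choose 2)
      + (k * ((n - (k + 1)).choose s : ℝ) + (d.choose s : ℝ))
        * (p ^ ((s + 1).choose 2 - s) - p ^ (s + 1).choose 2)) := by
  have hn0 : (0 : ℝ) < n := by exact_mod_cast hn
  have hkn : (k : ℝ) + 1 ≤ n := by exact_mod_cast hk
  have hks : (0 : ℝ) ≤ k := k.cast_nonneg
  have hs0 : (0 : ℝ) ≤ s := s.cast_nonneg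
  have hP1 : p ^ (s + 1).choose 2 ≤ 1 := pow_le_one₀ hp.le hp1
  have hps : p ^ s ≤ 1 := pow_le_one₀ hp.le hp1
  have hcl : y * ((n : ℝ) ^ (s + 1) * p ^ (s + 1).choose 2)
      ≤ (s + 1).factorial * a.choose (s + 1) := by
    have := pow_sub_le_factorial_mul_choose a (s + 1) (u := Y) (w := 0) (n := Y) hY le_rfl le_rfl
      (by simpa using ha)
    rw [← hYy]
    simpa using this
  have hw : (0 : ℝ) ≤ k + 1 + s := by positivity
  have hhub : (n : ℝ) ^ s - s * (k + 1 + s) * (n : ℝ) ^ (s - 1)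
      ≤ s.factorial * (n - (k + 1)).choose s := by
    refine pow_sub_le_factorial_mul_choose (n - (k + 1)) s hn0.le le_rfl hw ?_
    have : n ≤ (n - (k + 1) + 1 - s) + (k + 1 + s) := by omega
    have : (n : ℝ) ≤ (n - (k + 1) + 1 - s : ℕ) + ((k : ℝ) + 1 + s) := by exact_mod_cast this
    linarith
  have hpart : (θ * n) ^ s - s * (k + 1 + s) * (n : ℝ) ^ (s - 1)
      ≤ s.factorial * d.choose s := by
    refine pow_sub_le_factorial_mul_choose d s (by positivity)
      (mul_le_of_le_one_left hn0.le hθ1) hw ?_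
    have h1 : d + 1 ≤ (d + 1 - s) + s := by omega
    have h1 : (d : ℝ) + 1 ≤ (d + 1 - s : ℕ) + s := by exact_mod_cast h1
    nlinarith
  set E := (s : ℝ) * (k + 1 + s) * (n : ℝ) ^ (s - 1) with hE
  have hE0 : 0 ≤ E := by positivity
  have hsum : T * (n : ℝ) ^ s - s * (k + 1 + s) ^ 2 * (n : ℝ) ^ (s - 1)
      ≤ s.factorial * (k * ((n - (k + 1)).choose s : ℝ) + (d.choose s : ℝ)) := by
    have h2 := mul_le_mul_of_nonneg_left hhub hks
    have h3 : s * ((k : ℝ) + 1 + s) ^ 2 * (n : ℝ) ^ (s - 1) = (k + 1 + s) * E := by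
      rw [hE]; ring
    rw [mul_pow] at hpart
    rw [h3, ← hT]
    nlinarith [mul_nonneg hs0 hE0]
  obtain ⟨m, hm⟩ : ∃ m, (s + 1).choose 2 = m + s := ⟨s.choose 2, by
    rw [Nat.choose_succ_succ' s 1, Nat.choose_one_right, add_comm]⟩
  obtain ⟨t, rfl⟩ : ∃ t, s = t + 1 := ⟨s - 1, by omega⟩
  have hdiff : p ^ ((t + 1 + 1).choose 2 - (t + 1)) - p ^ (t + 1 + 1).choose 2
      = p ^ m * (1 - p ^ (t + 1)) := by
    rw [hm, Nat.add_sub_cancel, pow_add]; ring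
  rw [hdiff, Nat.factorial_succ (t + 1)]
  have h5 : 0 ≤ ((t + 1 + 1 : ℕ) : ℝ) * (p ^ m * (1 - p ^ (t + 1))) :=
    mul_nonneg (by positivity) (mul_nonneg (by positivity) (by linarith))
  have h6 := mul_le_mul_of_nonneg_left hsum h5
  have h7 := mul_le_mul_of_nonneg_right hcl (sub_nonneg.2 hP1)
  have h8 : (((t + 1 + 1 : ℕ) : ℝ) * T / (n * p ^ (t + 1))
        - (t + 1 + 1 : ℕ) * ((t + 1 : ℕ) * ((k : ℝ) + 1 + (t + 1 : ℕ)) ^ 2)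
          / ((n : ℝ) ^ 2 * p ^ (t + 1)))
        * ((n : ℝ) ^ (t + 1 + 1) * p ^ (t + 1 + 1).choose 2)
      = (t + 1 + 1 : ℕ) * (p ^ m * (T * (n : ℝ) ^ (t + 1)
        - (t + 1 : ℕ) * (k + 1 + (t + 1 : ℕ)) ^ 2 * (n : ℝ) ^ (t + 1 - 1))) := by
    rw [hm, pow_add p m, Nat.add_sub_cancel, pow_succ (n : ℝ) (t + 1), pow_succ (n : ℝ) t]
    field_simp
  rw [Nat.factorial_succ (t + 1)] at h7
  push_cast at h6 h7 h8 ⊢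
  linear_combination h6 + h7 + (1 - p ^ (t + 1)) * h8

/-- A surplus of ε·E[X] in the conditional mean, divided by the maximal clique count, leaves ε·p^(r
choose 2). So planting loses only boundedly many extra factors p. -/
lemma rpow_mul_le_upperTailProb {n s a k d : ℕ} {p : unitInterval} {y Y T θ δ ε M : ℝ} (hsn : s + 1 ≤ n)
    (hs : 2 ≤ s) (hp : 0 < (p : ℝ)) (hY : 0 ≤ Y) (ha : Y ≤ (a + 1 - (s + 1) : ℕ))
    (hYy : Y ^ (s + 1) = y * ((n : ℝ) ^ (s + 1) * (p : ℝ) ^ (s + 1).choose 2))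
    (hθ : 0 ≤ θ) (hθ1 : θ ≤ 1) (hT : (k : ℝ) + θ ^ s = T)
    (hd : θ * (n - k - 1) ≤ d + 1) (han : k + 1 + a ≤ n) (hdn : k + 1 + d ≤ n) (hδ : 0 ≤ δ)
    (hε : 0 ≤ ε)
    (hgain : δ + ε ≤ y * (1 - (p : ℝ) ^ (s + 1).choose 2)
      + ((s + 1 : ℕ) * T / (n * (p : ℝ) ^ s)
        - (s + 1 : ℕ) * (s * ((k : ℝ) + 1 + s) ^ 2) / ((n : ℝ) ^ 2 * (p : ℝ) ^ s))
        * (1 - (p : ℝ) ^ s))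
    (hM : (a : ℝ) ^ 2 / 2 + (k * n + d) ≤ M) :
    (p : ℝ) ^ (M + (s + 1).choose 2) * ε ≤ upperTailProb (s + 1) n p δ := by
  have hp1 : (p : ℝ) ≤ 1 := p.2.2
  have hn : 0 < n := by omega
  have hn0 : (0 : ℝ) < n := by exact_mod_cast hn
  obtain ⟨U, hU, hcard, hmean⟩ := exists_planted (s := s) hp hp1 han hdn
  have hg := le_factorial_mul_planted_gain hn hs hp hp1 hY ha hYy hθ hθ1 hT (by omega) hd
  set g := (a.choose (s + 1) : ℝ) * (1 - (p : ℝ) ^ (s + 1).choose 2)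
      + (k * ((n - (k + 1)).choose s : ℝ) + (d.choose s : ℝ))
        * ((p : ℝ) ^ ((s + 1).choose 2 - s) - (p : ℝ) ^ (s + 1).choose 2) with hgdef
  set P := (p : ℝ) ^ (s + 1).choose 2 with hP
  have hP0 : 0 < P := by positivity
  have hdesc : ((s + 1).factorial : ℝ) * n.choose (s + 1) ≤ (n : ℝ) ^ (s + 1) := by
    have := Nat.descFactorial_le_pow n (s + 1)
    rw [Nat.descFactorial_eq_factorial_mul_choose] at this
    exact_mod_cast this
  have hf0 : (0 : ℝ) < (s + 1).factorial := by exact_mod_cast (s + 1).factorial_pos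
  have hC0 : (0 : ℝ) < n.choose (s + 1) := by
    exact_mod_cast Nat.choose_pos hsn
  have hgain' : (δ + ε) * (n.choose (s + 1) * P) ≤ g := by
    have h1 : (δ + ε) * ((n : ℝ) ^ (s + 1) * P) ≤ (s + 1).factorial * g :=
      (mul_le_mul_of_nonneg_right hgain (by positivity)).trans hg
    have h2 : (δ + ε) * P * ((s + 1).factorial * n.choose (s + 1))
        ≤ (δ + ε) * P * (n : ℝ) ^ (s + 1) := by gcongr
    refine le_of_mul_le_mul_left ?_ hf0
    linarith
  have key := pow_mul_condMean_sub_le (s + 1) n p U hU ((1 + δ) * meanCliques (s + 1) n p)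
    (by rw [meanCliques_eq]; positivity)
  rw [meanCliques_eq] at key
  have hX : (p : ℝ) ^ U.card * (ε * (n.choose (s + 1) * P))
      ≤ n.choose (s + 1) * upperTailProb (s + 1) n p δ := by
    rw [upperTailProb, meanCliques_eq]
    refine le_trans ?_ key
    gcongr
    linarith
  have hprob : (p : ℝ) ^ U.card * (ε * P) ≤ upperTailProb (s + 1) n p δ := by
    refine le_of_mul_le_mul_left ?_ hC0
    linarith
  refine le_trans ?_ hprob
  have hUM : (U.card : ℝ) ≤ M := by
    refine le_trans ?_ hM
    have h1 : (U.card : ℝ) ≤ a.choose 2 + (k * n + d) := by exact_mod_cast hcard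
    have h2 : (a.choose 2 : ℝ) ≤ (a : ℝ) ^ 2 / 2 := by
      rw [Nat.cast_choose_two]
      nlinarith [(a.cast_nonneg : (0 : ℝ) ≤ a)]
    linarith
  have h3 : (p : ℝ) ^ M ≤ (p : ℝ) ^ U.card := by
    rw [← Real.rpow_natCast]
    exact Real.rpow_le_rpow_of_exponent_ge hp hp1 hUM
  rw [Real.rpow_add hp, Real.rpow_natCast]
  calc (p : ℝ) ^ M * P * ε = (p : ℝ) ^ M * (ε * P) := by ring
    _ ≤ _ := by gcongr

namespace IsSparseRegime

variable {s : ℕ} {p : ℕ → unitInterval}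

lemma eventually_lower_order_le (h : IsSparseRegime s p) (b c : ℝ) {ε : ℝ} (hε : 0 < ε) :
    ∀ᶠ n : ℕ in atTop, b * p n + c / edgeScale s p n ^ 2 ≤ ε := by
  have := (h.tendsto_zero.const_mul b).add (h.tendsto_edgeScale_sq.const_div_atTop c)
  rw [mul_zero, add_zero] at this
  exact this.eventually_le_const hε

lemma eventually_add_div_sq_le (h : IsSparseRegime s p) (b c : ℝ) {ε : ℝ} (hε : 0 < ε) :
    ∀ᶠ n : ℕ in atTop, (b * edgeScale s p n + c) ^ 2 ≤ edgeScale s p n ^ 2 * (b ^ 2 + ε) := by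
  have := ((tendsto_const_nhds (x := b)).add (h.tendsto_edgeScale.const_div_atTop c)).pow 2
  rw [add_zero] at this
  filter_upwards [this.eventually_le_const (show b ^ 2 < b ^ 2 + ε by linarith),
    h.eventually_edgeScale_pos] with n hn hq
  have e : (b * edgeScale s p n + c) ^ 2
      = edgeScale s p n ^ 2 * (b + c / edgeScale s p n) ^ 2 := by
    rw [← mul_pow, mul_add, mul_div_cancel₀ _ hq.ne', mul_comm b]
  rw [e]
  gcongr

lemma edgeScale_le_mul (hs : 2 ≤ s) {n : ℕ} (hp : 0 < (p n : ℝ)) :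
    edgeScale s p n ≤ n * p n := by
  have h1 : (1 : ℝ) ≤ (s : ℝ) / 2 := by
    have : (2 : ℝ) ≤ s := by exact_mod_cast hs
    linarith
  have := Real.rpow_le_rpow_of_exponent_ge hp (p n).2.2 h1
  rw [Real.rpow_one] at this
  exact mul_le_mul_of_nonneg_left this n.cast_nonneg

/-- The N extra edges and the constant τ are absorbed into ε/2 because Q and QL diverge. -/
lemma eventually_exp_le_rpow_mul (h : IsSparseRegime s p) (N : ℝ) {τ ε : ℝ} (hτ : 0 < τ)
    (hε : 0 < ε) : ∀ᶠ n : ℕ in atTop, ∀ ψ : ℝ,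
      Real.exp (-((ψ + ε) * (edgeScale s p n ^ 2 * Real.log (1 / (p n : ℝ)))))
        ≤ (p n : ℝ) ^ (edgeScale s p n ^ 2 * (ψ + ε / 2) + N) * τ := by
  filter_upwards [h.pos, h.tendsto_edgeScale_sq.eventually_ge_atTop (4 * N / ε),
    h.tendsto_sq_mul_log.eventually_ge_atTop (-Real.log τ * 4 / ε),
    h.tendsto_log_inv.eventually_ge_atTop 0] with n hp h1 h2 h3 ψ
  rw [div_le_iff₀ hε] at h1 h2
  have hlog : Real.log (p n : ℝ) = -Real.log (1 / (p n : ℝ)) := by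
    rw [one_div, Real.log_inv, neg_neg]
  rw [Real.rpow_def_of_pos hp, hlog]
  set L := Real.log (1 / (p n : ℝ))
  set q := edgeScale s p n
  conv_rhs => rw [← Real.exp_log hτ]
  rw [← Real.exp_add]
  refine Real.exp_le_exp.2 ?_
  nlinarith [mul_le_mul_of_nonneg_right h1 h3]

lemma eventually_exp_le_upperTailProb (h : IsSparseRegime s p) (hs : 2 ≤ s) {δ x ε : ℝ}
    (hδ : 0 < δ) (hx : x ∈ Set.Icc (0 : ℝ) 1) (hε : 0 < ε) :
    ∀ᶠ n : ℕ in atTop,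
      Real.exp (-((psiCost (s + 1) δ (n * (p n : ℝ) ^ s) x + ε)
        * (edgeScale s p n ^ 2 * Real.log (1 / (p n : ℝ))))) ≤ upperTailProb (s + 1) n (p n) δ := by
  have hs0 : (0 : ℝ) < s := by exact_mod_cast (by omega : 0 < s)
  have hx1 : 0 ≤ δ * (1 - x) := mul_nonneg hδ.le (by linarith [hx.2])
  set r : ℝ := ((s + 1 : ℕ) : ℝ) with hr
  have hr0 : 0 < r := by positivity
  have hr1 : 1 ≤ r := by rw [hr]; exact_mod_cast (by omega : 1 ≤ s + 1)
  have hr2 : 2 / r ≤ 1 := by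
    rw [div_le_one hr0, hr]; exact_mod_cast (by omega : 2 ≤ s + 1)
  -- The clique is made too large by mass τ. Subadditivity of t^(2/r) limits the extra cost, and
  -- half of τ remains as surplus mean.
  set τ := (ε / 4) ^ (r / 2) with hτ
  have hτ0 : 0 < τ := by positivity
  have hτε : τ ^ (2 / r) = ε / 4 := by
    rw [hτ, ← Real.rpow_mul (by positivity)]
    have : r / 2 * (2 / r) = 1 := by field_simp
    rw [this, Real.rpow_one]
  set y := δ * (1 - x) + τ with hy
  have hy0 : 0 < y := by positivity
  set B := y ^ (1 / r) with hB
  have hB0 : 0 < B := by positivity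
  have hBr : B ^ (s + 1) = y := by
    rw [hB, one_div]
    exact Real.rpow_inv_natCast_pow hy0.le (by omega)
  have hB2 : B ^ 2 ≤ (δ * (1 - x)) ^ (2 / r) + ε / 4 := by
    have e : B ^ 2 = y ^ (2 / r) := by
      rw [hB, ← Real.rpow_natCast, ← Real.rpow_mul hy0.le]
      congr 1
      push_cast
      ring
    rw [e, hy, ← hτε]
    exact Real.rpow_add_le_add_rpow hx1 hτ0.le (by positivity) hr2
  filter_upwards [h.pos, h.eventually_edgeScale_pos,
    h.eventually_lower_order_le (y + δ + 2 * r * s * δ ^ 2) (2 * r * s * (1 + s) ^ 2)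
      (half_pos hτ0),
    h.eventually_lower_order_le (δ + B) 0 (half_pos one_pos), eventually_ge_atTop (2 * (2 + s)),
    h.eventually_add_div_sq_le B (1 + s) (show 0 < ε / 4 by positivity),
    h.eventually_exp_le_rpow_mul ((s + 1).choose 2 : ℝ) (half_pos hτ0) hε]
    with n hp hq herr hfit hn ha2 hexp
  refine (hexp _).trans ?_
  have hp1 : (p n : ℝ) ≤ 1 := (p n).2.2
  have hn0 : (0 : ℝ) < n := by exact_mod_cast (by omega : 0 < n)
  have hpow := edgeScale_pow_succ (s := s) hp
  have hsq := edgeScale_sq s p n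
  have hqn := edgeScale_le_mul hs hp
  set q := edgeScale s p n with hqdef
  have hps : (p n : ℝ) ^ s ≤ p n := pow_le_of_le_one hp.le hp1 (by omega)
  have hps0 : 0 < (p n : ℝ) ^ s := by positivity
  have hP : (p n : ℝ) ^ (s + 1).choose 2 ≤ p n :=
    pow_le_of_le_one hp.le hp1 (Nat.choose_pos (by omega)).ne'
  set c := n * (p n : ℝ) ^ s with hc
  have hc0 : 0 < c := by positivity
  set T := x * δ * c / r with hT
  have hT0 : 0 ≤ T := by have := hx.1; positivity
  have hTc : T ≤ δ * c := by
    rw [hT, div_le_iff₀ hr0]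
    have h1 : x * δ * c ≤ 1 * δ * c := by gcongr; exact hx.2
    have h2 : δ * c * 1 ≤ δ * c * r := by gcongr
    linarith
  have hkT : (⌊T⌋₊ : ℝ) ≤ T := Nat.floor_le hT0
  have hfr0 := Int.fract_nonneg T
  have hfr1 := (Int.fract_lt_one T).le
  set θ := Int.fract T ^ (1 / (r - 1)) with hθ
  have hrs : r - 1 = s := by rw [hr]; push_cast; ring
  have hθ0 : 0 ≤ θ := Real.rpow_nonneg hfr0 _
  have hθ1 : θ ≤ 1 := Real.rpow_le_one hfr0 hfr1 (by rw [hrs]; positivity)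
  have hθs : θ ^ s = Int.fract T := by
    rw [hθ, hrs, one_div]
    exact Real.rpow_inv_natCast_pow hfr0 (by omega)
  have hfloor : ((⌊T⌋₊ : ℕ) : ℝ) = (⌊T⌋ : ℝ) := by
    rw [← natCast_floor_eq_intCast_floor hT0]
  have hBq : ((⌈B * q⌉₊ : ℕ) : ℝ) ≤ B * q + 1 := (Nat.ceil_lt_add_one (by positivity)).le
  have hfit' : ⌊T⌋₊ + 1 + (⌈B * q⌉₊ + s) ≤ n := by
    have h1 : (δ + B) * p n ≤ 1 / 2 := by simpa using hfit
    have h2 : c ≤ n * p n := by rw [hc]; gcongr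
    have h3 : (2 * (2 + s) : ℝ) ≤ n := by exact_mod_cast hn
    have h4 : δ * c ≤ δ * (n * p n) := by gcongr
    have h5 : B * q ≤ B * (n * p n) := by gcongr
    have h6 := mul_le_mul_of_nonneg_right h1 hn0.le
    have : ((⌊T⌋₊ : ℕ) : ℝ) + 1 + ((⌈B * q⌉₊ : ℕ) + s) ≤ n := by linarith
    exact_mod_cast this
  have hkn : (⌊T⌋₊ : ℝ) + 1 ≤ n := by exact_mod_cast (by omega : ⌊T⌋₊ + 1 ≤ n)
  have hd0 : 0 ≤ θ * ((n : ℝ) - ⌊T⌋₊ - 1) := mul_nonneg hθ0 (by linarith)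
  have hdle := Nat.floor_le hd0
  -- The extra s clique vertices offset the falling factorial: the smallest factor of a(a-1)⋯(a-s)
  -- is still at least Bq.
  refine rpow_mul_le_upperTailProb (a := ⌈B * q⌉₊ + s) (k := ⌊T⌋₊)
    (d := ⌊θ * ((n : ℝ) - ⌊T⌋₊ - 1)⌋₊) (y := y) (Y := B * q) (T := T) (θ := θ)
    (by omega) hs hp (by positivity) ?_ (by rw [mul_pow, hBr, hpow]) hθ0 hθ1 ?_
    (Nat.lt_floor_add_one _).le hfit' ?_ hδ.le (half_pos hτ0).le ?_ ?_
  · rw [show ⌈B * q⌉₊ + s + 1 - (s + 1) = ⌈B * q⌉₊ by omega]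
    exact Nat.le_ceil _
  · rw [hθs, hfloor]
    exact Int.floor_add_fract T
  · have : ((⌊T⌋₊ : ℕ) : ℝ) + 1 + (⌊θ * ((n : ℝ) - ⌊T⌋₊ - 1)⌋₊ : ℕ) ≤ n := by
      have := mul_le_of_le_one_left (show 0 ≤ (n : ℝ) - ⌊T⌋₊ - 1 by linarith) hθ1
      linarith
    exact_mod_cast this
  · have e1 : r * T / (n * (p n : ℝ) ^ s) = x * δ := by
      rw [← hc, hT]; field_simp
    rw [← hr, e1, ← hsq]
    -- The number of full hubs is at most δnp^s, whose square is at most δ²q²p and so of lower order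
    -- than q².
    have hk2 : ((⌊T⌋₊ : ℝ) + 1 + s) ^ 2 ≤ 2 * (δ ^ 2 * (q ^ 2 * p n)) + 2 * (1 + s) ^ 2 := by
      have h1 : ((⌊T⌋₊ : ℝ)) ^ 2 ≤ (δ * c) ^ 2 :=
        pow_le_pow_left₀ (Nat.cast_nonneg _) (hkT.trans hTc) 2
      have h2 : c ^ 2 ≤ q ^ 2 * p n := by
        rw [hc, hsq]
        calc (n * (p n : ℝ) ^ s) ^ 2 = (n : ℝ) ^ 2 * (p n : ℝ) ^ s * (p n : ℝ) ^ s := by ring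
          _ ≤ _ := by gcongr
      have h3 : δ ^ 2 * c ^ 2 ≤ δ ^ 2 * (q ^ 2 * p n) := by gcongr
      have h4 := sq_nonneg ((⌊T⌋₊ : ℝ) - (1 + s))
      linarith only [h1, h3, h4]
    set K := ((⌊T⌋₊ : ℝ) + 1 + s) ^ 2 with hK
    have hK0 : 0 ≤ K := sq_nonneg _
    have hKq : r * (s * K) / q ^ 2 ≤ 2 * r * s * δ ^ 2 * p n + 2 * r * s * (1 + s) ^ 2 / q ^ 2 := by
      rw [div_le_iff₀ (by positivity), add_mul, div_mul_cancel₀ _ (by positivity)]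
      have : r * s * K ≤ r * s * (2 * (δ ^ 2 * (q ^ 2 * p n)) + 2 * (1 + s) ^ 2) := by gcongr
      linarith only [this]
    have hK1 : 0 ≤ r * (s * K) / q ^ 2 := by positivity
    have hyP : y * (p n : ℝ) ^ (s + 1).choose 2 ≤ y * p n := by gcongr
    have hxp : x * δ * (p n : ℝ) ^ s ≤ δ * p n := by
      have h1 : x * δ ≤ δ := mul_le_of_le_one_left hδ.le hx.2
      exact mul_le_mul h1 hps hps0.le hδ.le
    have hsum : y + x * δ = δ + τ := by rw [hy]; ring
    have h1 := mul_nonneg hK1 hps0.le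
    set K' := r * (s * K) / q ^ 2
    linarith only [h1, hsum, hxp, hyP, hKq, herr]
  · have hcost : (⌊T⌋₊ : ℝ) * n + θ * n
        = q ^ 2 * (((⌊T⌋ : ℝ) + Int.fract T ^ (1 / (r - 1))) / c) := by
      rw [hfloor, ← hθ, hsq, hc]
      field_simp
    have ha : (((⌈B * q⌉₊ + s : ℕ) : ℝ)) ^ 2 ≤ q ^ 2 * (B ^ 2 + ε / 4) := by
      refine le_trans (pow_le_pow_left₀ (by positivity) ?_ 2) ha2
      push_cast
      linarith only [hBq]
    have ha' : q ^ 2 * (B ^ 2 + ε / 4)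
        ≤ q ^ 2 * ((δ * (1 - x)) ^ (2 / r) + ε / 4 + ε / 4) := by gcongr
    have hdn : (⌊θ * ((n : ℝ) - ⌊T⌋₊ - 1)⌋₊ : ℝ) ≤ θ * n := by
      refine hdle.trans ?_
      gcongr
      linarith [(Nat.cast_nonneg ⌊T⌋₊ : (0 : ℝ) ≤ (⌊T⌋₊ : ℝ))]
    have hψ : psiCost (s + 1) δ c x = (δ * (1 - x)) ^ (2 / r) / 2
        + ((⌊T⌋ : ℝ) + Int.fract T ^ (1 / (r - 1))) / c := rfl
    rw [hψ]
    have : 0 < q ^ 2 * ε := by positivity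
    linarith only [ha, ha', hdn, hcost, this]

end IsSparseRegime

/-! ### Limits of the rate in the three regimes -/

namespace IsSparseRegime

variable {s : ℕ} {p : ℕ → unitInterval}

lemma eventually_upperTailRate_le (h : IsSparseRegime s p) (hs : 2 ≤ s) {δ x ε : ℝ}
    (hδ : 0 < δ) (hx : x ∈ Set.Icc (0 : ℝ) 1) (hε : 0 < ε) :
    ∀ᶠ n : ℕ in atTop,
      upperTailRate (s + 1) δ p n ≤ psiCost (s + 1) δ (n * (p n : ℝ) ^ s) x + ε := by
  filter_upwards [h.eventually_exp_le_upperTailProb hs hδ hx hε,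
    h.tendsto_sq_mul_log.eventually_gt_atTop 0] with n hn hW
  have := Real.log_le_log (Real.exp_pos _) hn
  rw [Real.log_exp] at this
  rw [upperTailRate, Nat.add_sub_cancel, ← edgeScale_sq, div_le_iff₀ hW]
  linarith

lemma eventually_le_upperTailRate (h : IsSparseRegime s p) (hs : 2 ≤ s) {δ ε : ℝ}
    (hδ : 0 < δ) (hε : 0 < ε) :
    ∀ᶠ n : ℕ in atTop,
      phiCost (s + 1) δ (n * (p n : ℝ) ^ s) - ε ≤ upperTailRate (s + 1) δ p n := by
  filter_upwards [h.eventually_exp_le_upperTailProb hs hδ (x := 0) (by simp) hε,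
    h.eventually_upperTailProb_le hs hδ hε,
    h.tendsto_sq_mul_log.eventually_gt_atTop 0] with n hpos hn hW
  -- The planting bound serves only to show that the probability is positive, which monotonicity of
  -- the logarithm requires.
  have := Real.log_le_log ((Real.exp_pos _).trans_le hpos) hn
  rw [Real.log_exp] at this
  rw [upperTailRate, Nat.add_sub_cancel, ← edgeScale_sq, le_div_iff₀ hW]
  linarith

/-- The planting bound holds eventually for each fixed x, not uniformly, so one x must serve for all
large n. -/
lemma tendsto_upperTailRate_of_limits (h : IsSparseRegime s p) (hs : 2 ≤ s) {δ ℓ : ℝ} (hδ : 0 < δ)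
    (hupper : ∀ ε > 0, ∃ x ∈ Set.Icc (0 : ℝ) 1,
      ∀ᶠ n : ℕ in atTop, psiCost (s + 1) δ (n * (p n : ℝ) ^ s) x ≤ ℓ + ε)
    (hlower : ∀ ε > 0, ∀ᶠ n : ℕ in atTop, ℓ - ε ≤ phiCost (s + 1) δ (n * (p n : ℝ) ^ s)) :
    Tendsto (upperTailRate (s + 1) δ p) atTop (𝓝 ℓ) := by
  refine Metric.tendsto_atTop'.2 fun ε hε => ?_
  have h3 : 0 < ε / 3 := by positivity
  obtain ⟨x, hx, hux⟩ := hupper (ε / 3) h3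
  have key : ∀ᶠ n : ℕ in atTop, dist (upperTailRate (s + 1) δ p n) ℓ < ε := by
    filter_upwards [hux, hlower (ε / 3) h3, h.eventually_upperTailRate_le hs hδ hx h3,
      h.eventually_le_upperTailRate hs hδ h3] with n h1 h2 h4 h5
    rw [Real.dist_eq, abs_lt]
    constructor <;> linarith
  obtain ⟨N, hN⟩ := eventually_atTop.1 key
  exact ⟨N, fun n hn => hN n hn.le⟩

lemma tendsto_upperTailRate_of_tendsto_zero (h : IsSparseRegime s p) (hs : 2 ≤ s) {δ : ℝ}
    (hδ : 0 < δ) (hc : Tendsto (fun n : ℕ => (n : ℝ) * (p n : ℝ) ^ s) atTop (𝓝 0)) :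
    Tendsto (upperTailRate (s + 1) δ p) atTop (𝓝 (δ ^ ((2 : ℝ) / (s + 1 : ℕ)) / 2)) := by
  have hr : 3 ≤ s + 1 := by omega
  have hpos : ∀ᶠ n : ℕ in atTop, 0 < (n : ℝ) * (p n : ℝ) ^ s := by
    filter_upwards [h.pos, eventually_gt_atTop 0] with n hp hn
    positivity
  refine h.tendsto_upperTailRate_of_limits hs hδ (fun ε hε => ⟨0, by simp, ?_⟩) fun ε hε => ?_
  · refine Eventually.of_forall fun n => ?_
    rw [psiCost_zero hr]
    linarith
  · filter_upwards [eventually_le_phiCost_of_tendsto_zero hr hδ hpos hc] with n hn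
    linarith

lemma tendsto_upperTailRate_of_tendsto_pos (h : IsSparseRegime s p) (hs : 2 ≤ s) {δ c : ℝ}
    (hδ : 0 < δ) (hc0 : 0 < c)
    (hc : Tendsto (fun n : ℕ => (n : ℝ) * (p n : ℝ) ^ s) atTop (𝓝 c)) :
    Tendsto (upperTailRate (s + 1) δ p) atTop (𝓝 (phiCost (s + 1) δ c)) := by
  have hr : 3 ≤ s + 1 := by omega
  obtain ⟨x, hx, hxφ⟩ := (isLeast_phiCost hr δ hc0).1
  refine h.tendsto_upperTailRate_of_limits hs hδ (fun ε hε => ⟨x, hx, ?_⟩) fun ε hε => ?_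
  -- The minimiser for the limit c remains nearly optimal along np^s → c by joint continuity.
  · have hcont := (continuous_psiCost_uncurry hr δ (half_pos hc0)).tendsto (c, x)
    have hlim := hcont.comp (hc.prodMk_nhds (tendsto_const_nhds (x := x)))
    simp only [max_eq_left (half_le_self hc0.le), hxφ] at hlim
    filter_upwards [hlim.eventually_le_const
      (show phiCost (s + 1) δ c < phiCost (s + 1) δ c + ε by linarith),
      hc.eventually_const_le (half_lt_self hc0)] with n hn hn2
    simpa [max_eq_left hn2] using hn
  · exact (tendsto_phiCost hr δ hc0 hc).eventually_const_le (by linarith)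

lemma tendsto_upperTailRate_of_tendsto_atTop (h : IsSparseRegime s p) (hs : 2 ≤ s) {δ : ℝ}
    (hδ : 0 < δ) (hc : Tendsto (fun n : ℕ => (n : ℝ) * (p n : ℝ) ^ s) atTop atTop) :
    Tendsto (upperTailRate (s + 1) δ p) atTop
      (𝓝 (min (δ ^ ((2 : ℝ) / (s + 1 : ℕ)) / 2) (δ / (s + 1 : ℕ)))) := by
  have hr : 3 ≤ s + 1 := by omega
  refine h.tendsto_upperTailRate_of_limits hs hδ (fun ε hε => ?_) fun ε hε => ?_
  -- A pure strategy suffices: x = 0 for the clique, x = 1 for hubs, whose rounding cost 1/(np^s)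
  -- vanishes.
  · rcases min_choice (δ ^ ((2 : ℝ) / (s + 1 : ℕ)) / 2) (δ / (s + 1 : ℕ)) with hm | hm <;> rw [hm]
    · refine ⟨0, by simp, Eventually.of_forall fun n => ?_⟩
      rw [psiCost_zero hr]
      linarith
    · refine ⟨1, by simp, ?_⟩
      filter_upwards [(hc.const_div_atTop 1).eventually_le_const hε, hc.eventually_gt_atTop 0]
        with n hn hn0
      exact (psiCost_one_le hr hn0).trans (by linarith)
  · filter_upwards [hc.eventually_gt_atTop 0] with n hn
    have := min_le_phiCost hr hδ hn
    linarith

end IsSparseRegime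

end

theorem theorem1p7 (r : ℕ) (hr : 3 ≤ r) (δ : ℝ) (hδ : 0 < δ) :
    (∀ p : ℕ → unitInterval,
      (fun n : ℕ => (n : ℝ)⁻¹ * Real.log n ^ ((1 : ℝ) / ((r : ℝ) - 2)))
        =o[atTop] (fun n : ℕ => (p n : ℝ) ^ (((r : ℝ) - 1) / 2)) →
      Tendsto (fun n : ℕ => (p n : ℝ) ^ (((r : ℝ) - 1) / 2)) atTop (𝓝 0) →
      (Tendsto (fun n : ℕ => (n : ℝ) * (p n : ℝ) ^ (r - 1)) atTop (𝓝 0) →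
        Tendsto (upperTailRate r δ p) atTop (𝓝 (δ ^ ((2 : ℝ) / r) / 2))) ∧
      (∀ c : ℝ, 0 < c →
        Tendsto (fun n : ℕ => (n : ℝ) * (p n : ℝ) ^ (r - 1)) atTop (𝓝 c) →
        Tendsto (upperTailRate r δ p) atTop (𝓝 (phiCost r δ c))) ∧
      (Tendsto (fun n : ℕ => (n : ℝ) * (p n : ℝ) ^ (r - 1)) atTop atTop →
        Tendsto (upperTailRate r δ p) atTop (𝓝 (min (δ ^ ((2 : ℝ) / r) / 2) (δ / r))))) ∧
    (∀ c : ℝ, 0 < c →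
      IsLeast (psiCost r δ c '' Set.Icc (0 : ℝ) 1) (phiCost r δ c) ∧
      phiCost r δ c =
        min (δ ^ ((2 : ℝ) / r) / 2)
          (min
            (((⌊δ * c / r⌋ : ℝ) + Int.fract (δ * c / r) ^ ((1 : ℝ) / ((r : ℝ) - 1))) / c)
            ((⌊δ * c / r⌋ : ℝ) / c
              + ((r : ℝ) * Int.fract (δ * c / r) / c) ^ ((2 : ℝ) / r) / 2))) := by
  refine ⟨fun p h₁ h₂ => ?_, fun c hc => ⟨isLeast_phiCost hr δ hc, phiCost_eq_min hr hδ hc⟩⟩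
  obtain ⟨s, rfl⟩ : ∃ s, r = s + 1 := ⟨r - 1, by omega⟩
  have hs : 2 ≤ s := by omega
  have h := isSparseRegime_of_isLittleO rfl hs h₁ h₂
  rw [Nat.add_sub_cancel]
  exact ⟨h.tendsto_upperTailRate_of_tendsto_zero hs hδ,
    fun c hc => h.tendsto_upperTailRate_of_tendsto_pos hs hδ hc,
    h.tendsto_upperTailRate_of_tendsto_atTop hs hδ⟩
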